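/- Let $\sigma\subset\mathbb H^3$ be a bi-infinite geodesic and let $\hat{\mathbb H}^3$ be the metric completion of the universal cover of $\mathbb H^3\setminus\sigma$ (with the lifted path metric); the additive group $\mathbb C$ acts on it by isometries, $z$ translating along the singular axis $\hat\sigma$ by $\operatorname{Re} z$ and rotating about it by the real-valued angle $\operatorname{Im} z$. For $\alpha>0$, $\lambda>0$, $\tau\in\mathbb R$ let the model solid torus $N=N_{\alpha,\lambda,\tau}$ be the quotient of $\hat{\mathbb H}^3$ by the subgroup of $\mathbb C$ generated by $i\alpha$ and $\lambda+i\tau$, and let its core $\Sigma$ be the image of $\hat\sigma$. For $x\in N$ let $\operatorname{injrad}(x)$ be the supremum of the radii $\rho\ge 0$ such that the open metric ball of radius $\rho$ about $x$ is isometric, for the induced path metrics, to an open ball of radius $\rho$ in $\mathbb H^3$ (so $\operatorname{injrad}(x)=0$ if $\alpha\ne2\pi$ and $x\in\Sigma$). For $\epsilon>0$ put $N^{\le\epsilon}=\{x\in N:\operatorname{injrad}(x)\le\epsilon/2\}$. If $N^{\le\epsilon}\neq\emptyset$ and $\alpha\le 2\pi$, all points of $\partial N^{\le\epsilon}$ lie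 at the same distance from $\Sigma$, which is denoted by $r_{\alpha,\lambda,\tau}(\epsilon)$. Put $d_{\alpha,\lambda,\tau}(\delta,\epsilon)=r_{\alpha,\lambda,\tau}(\epsilon)-r_{\alpha,\lambda,\tau}(\delta)$. Proposition 5.4. Suppose $0<\delta<\epsilon$, $0<\alpha\le 2\pi$, $\lambda>0$ and $\tau\in\mathbb R$, and suppose that $N_{\alpha,\lambda,\tau}^{\le\delta}$ is nonempty. Then $$d_{\alpha,\lambda,\tau}(\delta,\epsilon)\le\operatorname{arccosh}\sqrt{\frac{\cosh\epsilon-1}{\cosh\delta-1}}.$$ Furthermore, equality holds if and only if $\alpha=2\pi$, $\lambda=\delta$ and $\tau\in2\pi\mathbb Z$. -/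

import Mathlib

open Set
open scoped ENNReal

noncomputable section

namespace HypTube

/-! ### Hyperbolic 3-space (hyperboloid model) -/

/-- Hyperbolic 3-space: the upper sheet of the hyperboloid `t² - x² - y² - z² = 1`. -/
@[ext] structure H3 where
  t : ℝ
  x : ℝ
  y : ℝ
  z : ℝ
  norm_eq : t ^ 2 - x ^ 2 - y ^ 2 - z ^ 2 = 1
  t_pos : 0 < t

namespace H3

/-- The Lorentzian product, with the sign for which it equals `cosh` of the distance. -/
def lor (p q : H3) : ℝ := p.t * q.t - p.x * q.x - p.y * q.y - p.z * q.z

theorem lor_comm (p q : H3) : lor p q = lor q p := by unfold lor; ring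

theorem lor_self (p : H3) : lor p p = 1 := by
  have := p.norm_eq
  unfold lor; linarith

theorem sq_identity (p q : H3) :
    (p.t * q.t) ^ 2 - (1 + (p.x * q.x + p.y * q.y + p.z * q.z)) ^ 2 =
      (p.x - q.x) ^ 2 + (p.y - q.y) ^ 2 + (p.z - q.z) ^ 2 + (p.x * q.y - p.y * q.x) ^ 2 +
        (p.y * q.z - p.z * q.y) ^ 2 + (p.z * q.x - p.x * q.z) ^ 2 := by
  have h1 : p.t ^ 2 = 1 + p.x ^ 2 + p.y ^ 2 + p.z ^ 2 := by linarith [p.norm_eq]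
  have h2 : q.t ^ 2 = 1 + q.x ^ 2 + q.y ^ 2 + q.z ^ 2 := by linarith [q.norm_eq]
  rw [mul_pow, h1, h2]; ring

theorem one_le_lor (p q : H3) : 1 ≤ lor p q := by
  have h := sq_identity p q
  have hpos : 0 < p.t * q.t := mul_pos p.t_pos q.t_pos
  have : 1 + (p.x * q.x + p.y * q.y + p.z * q.z) ≤ p.t * q.t := by
    apply le_of_sq_le_sq _ hpos.le
    have : 0 ≤ (p.x - q.x) ^ 2 + (p.y - q.y) ^ 2 + (p.z - q.z) ^ 2 + (p.x * q.y - p.y * q.x) ^ 2 +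
        (p.y * q.z - p.z * q.y) ^ 2 + (p.z * q.x - p.x * q.z) ^ 2 := by positivity
    linarith
  unfold lor; linarith

theorem eq_of_lor_eq_one {p q : H3} (h : lor p q = 1) : p = q := by
  have hi := sq_identity p q
  have h' : p.t * q.t = 1 + (p.x * q.x + p.y * q.y + p.z * q.z) := by
    unfold lor at h; linarith
  rw [h', sub_self] at hi
  have e : (p.x - q.x) ^ 2 + (p.y - q.y) ^ 2 + (p.z - q.z) ^ 2 ≤ 0 := by
    nlinarith [sq_nonneg (p.x * q.y - p.y * q.x), sq_nonneg (p.y * q.z - p.z * q.y),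
      sq_nonneg (p.z * q.x - p.x * q.z)]
  have ex : p.x = q.x := by
    have : (p.x - q.x) ^ 2 = 0 := by
      nlinarith [sq_nonneg (p.x - q.x), sq_nonneg (p.y - q.y), sq_nonneg (p.z - q.z)]
    linarith [pow_eq_zero_iff (two_ne_zero) |>.1 this]
  have ey : p.y = q.y := by
    have : (p.y - q.y) ^ 2 = 0 := by
      nlinarith [sq_nonneg (p.x - q.x), sq_nonneg (p.y - q.y), sq_nonneg (p.z - q.z)]
    linarith [pow_eq_zero_iff (two_ne_zero) |>.1 this]
  have ez : p.z = q.z := by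
    have : (p.z - q.z) ^ 2 = 0 := by
      nlinarith [sq_nonneg (p.x - q.x), sq_nonneg (p.y - q.y), sq_nonneg (p.z - q.z)]
    linarith [pow_eq_zero_iff (two_ne_zero) |>.1 this]
  have et : p.t = q.t := by
    have h1 := p.norm_eq
    have h2 := q.norm_eq
    rw [ex, ey, ez] at h1
    have : p.t ^ 2 = q.t ^ 2 := by linarith
    exact (pow_left_inj₀ p.t_pos.le q.t_pos.le two_ne_zero).1 this
  exact H3.ext et ex ey ez

/-- The orthogonal complement of a point of the hyperboloid is positive. -/
theorem orth_nonneg (q : H3) (a b c d : ℝ) (h : q.t * a = b * q.x + c * q.y + d * q.z) :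
    0 ≤ b ^ 2 + c ^ 2 + d ^ 2 - a ^ 2 := by
  have hq : q.t ^ 2 = 1 + q.x ^ 2 + q.y ^ 2 + q.z ^ 2 := by linarith [q.norm_eq]
  have hpos : 0 < q.t ^ 2 := pow_pos q.t_pos 2
  have key : q.t ^ 2 * (b ^ 2 + c ^ 2 + d ^ 2 - a ^ 2) =
      b ^ 2 + c ^ 2 + d ^ 2 + (b * q.y - c * q.x) ^ 2 + (c * q.z - d * q.y) ^ 2 +
        (d * q.x - b * q.z) ^ 2 := by
    have : q.t ^ 2 * a ^ 2 = (b * q.x + c * q.y + d * q.z) ^ 2 := by rw [← h]; ring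
    rw [mul_sub, this, hq]; ring
  by_contra hneg
  push Not at hneg
  have : q.t ^ 2 * (b ^ 2 + c ^ 2 + d ^ 2 - a ^ 2) < 0 := mul_neg_of_pos_of_neg hpos hneg
  rw [key] at this
  have : 0 ≤ b ^ 2 + c ^ 2 + d ^ 2 + (b * q.y - c * q.x) ^ 2 + (c * q.z - d * q.y) ^ 2 +
        (d * q.x - b * q.z) ^ 2 := by positivity
  linarith

theorem lor_gram (p q s : H3) :
    (lor p s - lor p q * lor q s) ^ 2 ≤ (lor p q ^ 2 - 1) * (lor q s ^ 2 - 1) := by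
  set C := lor p q with hC
  set D := lor q s with hD
  set E := lor p s with hE
  have hp := p.norm_eq
  have hq := q.norm_eq
  have hs := s.norm_eq
  have main : ∀ k : ℝ, 0 ≤ (C ^ 2 - 1) * (k * k) + (2 * (C * D - E)) * k + (D ^ 2 - 1) := by
    intro k
    have h := orth_nonneg q (k * (p.t - C * q.t) + (s.t - D * q.t))
      (k * (p.x - C * q.x) + (s.x - D * q.x)) (k * (p.y - C * q.y) + (s.y - D * q.y))
      (k * (p.z - C * q.z) + (s.z - D * q.z)) (by
        have h1 : C = p.t * q.t - p.x * q.x - p.y * q.y - p.z * q.z := rfl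
        have h2 : D = q.t * s.t - q.x * s.x - q.y * s.y - q.z * s.z := rfl
        linear_combination (-k * C - D) * hq - k * h1 - h2)
    have h1 : C = p.t * q.t - p.x * q.x - p.y * q.y - p.z * q.z := rfl
    have h2 : D = q.t * s.t - q.x * s.x - q.y * s.y - q.z * s.z := rfl
    have h3 : E = p.t * s.t - p.x * s.x - p.y * s.y - p.z * s.z := rfl
    have e : (k * (p.x - C * q.x) + (s.x - D * q.x)) ^ 2 +
        (k * (p.y - C * q.y) + (s.y - D * q.y)) ^ 2 +
        (k * (p.z - C * q.z) + (s.z - D * q.z)) ^ 2 -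
        (k * (p.t - C * q.t) + (s.t - D * q.t)) ^ 2 =
        (C ^ 2 - 1) * (k * k) + (2 * (C * D - E)) * k + (D ^ 2 - 1) := by
      linear_combination (-k ^ 2) * hp - (k * C + D) ^ 2 * hq - hs
        - 2 * k * (k * C + D) * h1 - 2 * (k * C + D) * h2 + 2 * k * h3
    linarith
  have hd := discrim_le_zero main
  unfold discrim at hd
  nlinarith

/-- The hyperbolic distance: `cosh (dist p q) = lor p q`. -/
instance : MetricSpace H3 where
  dist p q := Real.arcosh (lor p q)
  dist_self p := by simp [lor_self]
  dist_comm p q := by rw [lor_comm]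
  dist_triangle p q s := by
    have h1 := one_le_lor p q
    have h2 := one_le_lor q s
    have h3 := one_le_lor p s
    have n1 := Real.arcosh_nonneg h1
    have n2 := Real.arcosh_nonneg h2
    rw [← Real.arcosh_cosh (add_nonneg n1 n2),
      Real.arcosh_le_arcosh (by linarith) (Real.cosh_pos _), Real.cosh_add,
      Real.cosh_arcosh h1, Real.cosh_arcosh h2, Real.sinh_arcosh h1, Real.sinh_arcosh h2,
      ← Real.sqrt_mul (by nlinarith)]
    have := Real.abs_le_sqrt (lor_gram p q s)
    linarith [le_abs_self (lor p s - lor p q * lor q s)]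
  eq_of_dist_eq_zero {p q} h :=
    eq_of_lor_eq_one ((Real.arcosh_eq_zero_iff (one_le_lor p q)).1 h)

theorem dist_def (p q : H3) : dist p q = Real.arcosh (lor p q) := rfl

theorem cosh_dist (p q : H3) : Real.cosh (dist p q) = lor p q :=
  Real.cosh_arcosh (one_le_lor p q)

/-- The basepoint of hyperbolic space. -/
def origin : H3 := ⟨1, 0, 0, 0, by norm_num, by norm_num⟩

/-- The hyperbolic distance is at most the Euclidean distance of the ambient space. -/
theorem dist_sq_le (p q : H3) :
    dist p q ^ 2 ≤ (p.t - q.t) ^ 2 + (p.x - q.x) ^ 2 + (p.y - q.y) ^ 2 + (p.z - q.z) ^ 2 := by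
  have h0 : 0 ≤ dist p q := dist_nonneg
  have h1 : 1 + dist p q ^ 2 / 2 ≤ Real.cosh (dist p q) := by
    have e : Real.cosh (dist p q) = 1 + 2 * Real.sinh (dist p q / 2) ^ 2 := by
      have : dist p q = 2 * (dist p q / 2) := by ring
      conv_lhs => rw [this, Real.cosh_two_mul, Real.cosh_sq]
      ring
    have s : dist p q / 2 ≤ Real.sinh (dist p q / 2) := Real.self_le_sinh_iff.2 (by linarith)
    rw [e]; nlinarith
  rw [cosh_dist] at h1
  have hp := p.norm_eq
  have hq := q.norm_eq
  unfold lor at h1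
  nlinarith [sq_nonneg (p.t - q.t)]

end H3

/-! ### The universal cover of the complement of a geodesic, and its completion -/

/-- The universal cover of `H3` minus the geodesic `σ = {y = z = 0}`, in cylindrical coordinates:
`r > 0` is the distance from `σ`, `ζ` the position along `σ` and `θ` the real-valued angle. -/
@[ext] structure Cover where
  r : ℝ
  ζ : ℝ
  θ : ℝ
  r_pos : 0 < r

namespace Cover

/-- The covering projection to `H3` (with image the complement of `σ`). -/
def proj (p : Cover) : H3 where
  t := Real.cosh p.r * Real.cosh p.ζ
  x := Real.cosh p.r * Real.sinh p.ζ
  y := Real.sinh p.r * Real.cos p.θ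
  z := Real.sinh p.r * Real.sin p.θ
  norm_eq := by
    have h1 := Real.cosh_sq p.r
    have h2 := Real.cosh_sq p.ζ
    have h3 := Real.sin_sq_add_cos_sq p.θ
    linear_combination (Real.cosh p.r) ^ 2 * h2 + h1 - Real.sinh p.r ^ 2 * h3
  t_pos := mul_pos (Real.cosh_pos _) (Real.cosh_pos _)

/-- `γ`, restricted to `[a, b]`, is a continuous curve from `p` to `q` in the cover. -/
structure IsCurve (γ : ℝ → Cover) (a b : ℝ) (p q : Cover) : Prop where
  le : a ≤ b
  left : γ a = p
  right : γ b = q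
  cont_r : ContinuousOn (fun s => (γ s).r) (Icc a b)
  cont_ζ : ContinuousOn (fun s => (γ s).ζ) (Icc a b)
  cont_θ : ContinuousOn (fun s => (γ s).θ) (Icc a b)

/-- The length of a curve in the cover, measured in `H3` after projection. -/
def length (γ : ℝ → Cover) (a b : ℝ) : ℝ≥0∞ := eVariationOn (fun s => (γ s).proj) (Icc a b)

/-- The path metric on the cover: the infimum of the lengths of the curves from `p` to `q`. -/
def pathEDist (p q : Cover) : ℝ≥0∞ :=
  ⨅ (γ : ℝ → Cover) (a : ℝ) (b : ℝ) (_ : IsCurve γ a b p q), length γ a b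

theorem pathEDist_le {γ : ℝ → Cover} {a b : ℝ} {p q : Cover} (h : IsCurve γ a b p q) :
    pathEDist p q ≤ length γ a b :=
  iInf_le_of_le γ (iInf_le_of_le a (iInf_le_of_le b (iInf_le _ h)))

theorem le_pathEDist {p q : Cover} {L : ℝ≥0∞}
    (h : ∀ γ a b, IsCurve γ a b p q → L ≤ length γ a b) : L ≤ pathEDist p q :=
  le_iInf fun γ => le_iInf fun a => le_iInf fun b => le_iInf fun hc => h γ a b hc

theorem pathEDist_self (p : Cover) : pathEDist p p = 0 := by
  have hc : IsCurve (fun _ => p) 0 0 p p :=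
    ⟨le_rfl, rfl, rfl, continuousOn_const, continuousOn_const, continuousOn_const⟩
  refine le_antisymm ((pathEDist_le hc).trans ?_) zero_le
  unfold length
  rw [eVariationOn.subsingleton _ (by simp)]

theorem IsCurve.reverse {γ : ℝ → Cover} {a b : ℝ} {p q : Cover} (h : IsCurve γ a b p q) :
    IsCurve (fun s => γ (-s)) (-b) (-a) q p := by
  have hm : MapsTo (fun s : ℝ => -s) (Icc (-b) (-a)) (Icc a b) := fun s hs =>
    ⟨by linarith [hs.2], by linarith [hs.1]⟩
  exact ⟨neg_le_neg h.le, by simpa using h.right, by simpa using h.left,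
    h.cont_r.comp continuous_neg.continuousOn hm, h.cont_ζ.comp continuous_neg.continuousOn hm,
    h.cont_θ.comp continuous_neg.continuousOn hm⟩

theorem pathEDist_comm_le (p q : Cover) : pathEDist q p ≤ pathEDist p q := by
  refine le_pathEDist fun γ a b h => (pathEDist_le h.reverse).trans ?_
  refine eVariationOn.comp_le_of_antitoneOn (fun s => (γ s).proj) (fun s : ℝ => -s)
    (fun s _ t _ hst => neg_le_neg hst) fun s hs => ⟨by linarith [hs.2], by linarith [hs.1]⟩

/-- Concatenation of two curves. -/
def concat (γ γ' : ℝ → Cover) (b a' : ℝ) (s : ℝ) : Cover :=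
  if s ≤ b then γ s else γ' (s - b + a')

theorem concat_right {γ γ' : ℝ → Cover} {b a' : ℝ} (h : γ b = γ' a') {s : ℝ} (hs : b ≤ s) :
    concat γ γ' b a' s = γ' (s - b + a') := by
  unfold concat
  split_ifs with h'
  · have : s = b := le_antisymm h' hs
    subst this; simpa using h
  · rfl

theorem IsCurve.concat {γ γ' : ℝ → Cover} {a b a' b' : ℝ} {p q s : Cover}
    (h : IsCurve γ a b p q) (h' : IsCurve γ' a' b' q s) :
    IsCurve (concat γ γ' b a') a (b + (b' - a')) p s := by
  have hm : MapsTo (fun s : ℝ => s - b + a') (Icc b (b + (b' - a'))) (Icc a' b') := fun s hs =>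
    ⟨by linarith [hs.1], by linarith [hs.2]⟩
  have hle : b ≤ b + (b' - a') := by linarith [h'.le]
  have hγ : γ b = γ' a' := h.right.trans h'.left.symm
  have hc : Continuous fun s : ℝ => s - b + a' := by fun_prop
  have key : ∀ f : Cover → ℝ, ContinuousOn (fun s => f (γ s)) (Icc a b) →
      ContinuousOn (fun s => f (γ' s)) (Icc a' b') →
      ContinuousOn (fun s => f (Cover.concat γ γ' b a' s)) (Icc a (b + (b' - a'))) := by
    intro f h1 h2
    rw [← Icc_union_Icc_eq_Icc h.le hle]
    refine ContinuousOn.union_of_isClosed ?_ ?_ isClosed_Icc isClosed_Icc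
    · exact h1.congr fun s hs => by simp [Cover.concat, hs.2]
    · exact (h2.comp hc.continuousOn hm).congr fun s hs => by
        simp [concat_right hγ hs.1]
  refine ⟨h.le.trans hle, ?_, ?_, key r h.cont_r h'.cont_r, key ζ h.cont_ζ h'.cont_ζ,
    key θ h.cont_θ h'.cont_θ⟩
  · simp [Cover.concat, h.le, h.left]
  · rw [concat_right hγ hle]
    have : b + (b' - a') - b + a' = b' := by ring
    rw [this, h'.right]

theorem length_concat_le {γ γ' : ℝ → Cover} {a b a' b' : ℝ} {p q s : Cover}
    (h : IsCurve γ a b p q) (h' : IsCurve γ' a' b' q s) :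
    length (concat γ γ' b a') a (b + (b' - a')) ≤ length γ a b + length γ' a' b' := by
  have hle : b ≤ b + (b' - a') := by linarith [h'.le]
  have hγ : γ b = γ' a' := h.right.trans h'.left.symm
  have hsplit := eVariationOn.Icc_add_Icc (fun s => (concat γ γ' b a' s).proj) (s := univ)
    h.le hle (mem_univ b)
  simp only [univ_inter] at hsplit
  unfold length
  rw [← hsplit]
  refine add_le_add (le_of_eq ?_) ?_
  · exact eVariationOn.congr fun s hs => by simp [concat, hs.2]
  · rw [eVariationOn.congr (g := (fun s => (γ' s).proj) ∘ fun s : ℝ => s - b + a')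
      fun s hs => by simp [concat_right hγ hs.1]]
    exact eVariationOn.comp_le_of_monotoneOn _ _ (fun s _ t _ hst => by simpa using hst)
      fun s hs => ⟨by linarith [hs.1], by linarith [hs.2]⟩

theorem pathEDist_triangle (p q s : Cover) :
    pathEDist p s ≤ pathEDist p q + pathEDist q s := by
  have hkey : ∀ γ a b, IsCurve γ a b p q → ∀ γ' a' b', IsCurve γ' a' b' q s →
      pathEDist p s ≤ length γ a b + length γ' a' b' := fun γ a b h γ' a' b' h' =>
    (pathEDist_le (h.concat h')).trans (length_concat_le h h')
  generalize pathEDist p s = L at hkey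
  unfold pathEDist
  simp only [ENNReal.iInf_add, ENNReal.add_iInf]
  exact le_iInf fun γ' => le_iInf fun a' => le_iInf fun b' => le_iInf fun h' => le_iInf fun γ =>
    le_iInf fun a => le_iInf fun b => le_iInf fun h => hkey γ a b h γ' a' b' h'

/-- The covering projection along a straight coordinate segment, in ambient coordinates. -/
def segment (r ζ θ r' ζ' θ' s : ℝ) : ℝ × ℝ × ℝ × ℝ :=
  (Real.cosh (r + s * r') * Real.cosh (ζ + s * ζ'),
    Real.cosh (r + s * r') * Real.sinh (ζ + s * ζ'),
    Real.sinh (r + s * r') * Real.cos (θ + s * θ'),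
    Real.sinh (r + s * r') * Real.sin (θ + s * θ'))

theorem exists_lipschitz_segment (r ζ θ r' ζ' θ' : ℝ) :
    ∃ K, LipschitzOnWith K (segment r ζ θ r' ζ' θ') (Icc 0 1) := by
  have hF : ContDiff ℝ 1 (segment r ζ θ r' ζ' θ') := by
    unfold segment
    fun_prop
  exact hF.contDiffOn.exists_lipschitzOnWith one_ne_zero (convex_Icc 0 1) isCompact_Icc

theorem dist_proj_le {p q : Cover} {a b : ℝ × ℝ × ℝ × ℝ}
    (ha : a = (p.proj.t, p.proj.x, p.proj.y, p.proj.z))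
    (hb : b = (q.proj.t, q.proj.x, q.proj.y, q.proj.z)) :
    dist p.proj q.proj ≤ 2 * dist a b := by
  have h2 := H3.dist_sq_le p.proj q.proj
  have hD0 : 0 ≤ dist a b := dist_nonneg
  have h1' : dist a b ≤ dist a b := le_rfl
  generalize hD : dist a b = D at hD0 ⊢
  nth_rewrite 2 [hD] at h1'
  subst ha hb
  simp only [Prod.dist_eq, max_le_iff, Real.dist_eq] at h1'
  obtain ⟨a1, a2, a3, a4⟩ := h1'
  have b1 := sq_le_sq' (abs_le.1 a1).1 (abs_le.1 a1).2
  have b2 := sq_le_sq' (abs_le.1 a2).1 (abs_le.1 a2).2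
  have b3 := sq_le_sq' (abs_le.1 a3).1 (abs_le.1 a3).2
  have b4 := sq_le_sq' (abs_le.1 a4).1 (abs_le.1 a4).2
  exact le_of_sq_le_sq (by nlinarith) (by positivity)

/-- Any two points of the cover are joined by a curve of finite length. -/
theorem pathEDist_ne_top (p q : Cover) : pathEDist p q ≠ ⊤ := by
  have hpos : ∀ s : ℝ, 0 < p.r + max 0 (min s 1) * (q.r - p.r) := fun s => by
    have h0 : 0 ≤ max 0 (min s 1) := le_max_left _ _
    have h1 : max 0 (min s 1) ≤ 1 := max_le zero_le_one (min_le_right _ _)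
    generalize max 0 (min s 1) = m at h0 h1
    rcases h1.eq_or_lt with h | h
    · subst h; linarith [q.r_pos]
    · nlinarith [mul_nonneg h0 q.r_pos.le, mul_pos (sub_pos.2 h) p.r_pos]
  let γ : ℝ → Cover := fun s =>
    ⟨p.r + max 0 (min s 1) * (q.r - p.r), p.ζ + s * (q.ζ - p.ζ), p.θ + s * (q.θ - p.θ), hpos s⟩
  have hc : IsCurve γ 0 1 p q := by
    refine ⟨zero_le_one, ?_, ?_, ?_, ?_, ?_⟩
    · ext <;> simp [γ]
    · ext <;> simp [γ]
    all_goals exact Continuous.continuousOn (by simp only [γ]; fun_prop)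
  obtain ⟨K, hK⟩ := exists_lipschitz_segment p.r p.ζ p.θ (q.r - p.r) (q.ζ - p.ζ) (q.θ - p.θ)
  have hseg : ∀ s ∈ Icc (0 : ℝ) 1,
      segment p.r p.ζ p.θ (q.r - p.r) (q.ζ - p.ζ) (q.θ - p.θ) s =
        ((γ s).proj.t, (γ s).proj.x, (γ s).proj.y, (γ s).proj.z) := fun s hs => by
    have e : max 0 (min s 1) = s := by rw [min_eq_left hs.2, max_eq_right hs.1]
    simp only [segment, proj, γ, e]
  have hL : LipschitzOnWith (2 * K) (fun s => (γ s).proj) (Icc 0 1) := by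
    refine LipschitzOnWith.of_dist_le_mul fun s hs t ht => ?_
    have h1 := hK.dist_le_mul s hs t ht
    have h2 := dist_proj_le (hseg s hs) (hseg t ht)
    push_cast
    linarith
  have hb := hL.locallyBoundedVariationOn 0 1 (by simp) (by simp)
  rw [inter_self] at hb
  exact ne_top_of_le_ne_top hb (pathEDist_le hc)

/-- The path metric as an extended metric. -/
abbrev pathEMetric : PseudoEMetricSpace Cover where
  edist := pathEDist
  edist_self := pathEDist_self
  edist_comm p q := le_antisymm (pathEDist_comm_le q p) (pathEDist_comm_le p q)
  edist_triangle := pathEDist_triangle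

/-- The cover with its path metric.  In cylindrical coordinates this is the metric of
`ds² = dr² + cosh² r dζ² + sinh² r dθ²`, since `proj` is a local isometry onto its image. -/
instance : PseudoMetricSpace Cover :=
  @PseudoEMetricSpace.toPseudoMetricSpace Cover pathEMetric pathEDist_ne_top

theorem edist_def (p q : Cover) : edist p q = pathEDist p q := rfl

/-- The complex number `w` translates by `Re w` along `σ` and rotates by the angle `Im w`. -/
instance : AddAction ℂ Cover where
  vadd w p := ⟨p.r, p.ζ + w.re, p.θ + w.im, p.r_pos⟩
  zero_vadd p := by
    change (⟨p.r, p.ζ + (0 : ℂ).re, p.θ + (0 : ℂ).im, p.r_pos⟩ : Cover) = p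
    ext <;> simp
  add_vadd w w' p := by
    change (⟨p.r, p.ζ + (w + w').re, p.θ + (w + w').im, p.r_pos⟩ : Cover) =
      ⟨p.r, p.ζ + w'.re + w.re, p.θ + w'.im + w.im, p.r_pos⟩
    ext
    · rfl
    · simp only [Complex.add_re]; ring
    · simp only [Complex.add_im]; ring

theorem vadd_def (w : ℂ) (p : Cover) : w +ᵥ p = ⟨p.r, p.ζ + w.re, p.θ + w.im, p.r_pos⟩ := rfl

theorem dist_proj_vadd (w : ℂ) (p q : Cover) :
    edist (w +ᵥ p).proj (w +ᵥ q).proj = edist p.proj q.proj := by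
  rw [edist_dist, edist_dist, H3.dist_def, H3.dist_def]
  congr 2
  have h : ∀ p q : Cover, H3.lor p.proj q.proj = Real.cosh p.r * Real.cosh q.r *
      Real.cosh (p.ζ - q.ζ) - Real.sinh p.r * Real.sinh q.r * Real.cos (p.θ - q.θ) := by
    intro p q
    simp only [H3.lor, proj, Real.cosh_sub, Real.cos_sub]; ring
  rw [h, h]
  simp only [vadd_def, add_sub_add_right_eq_sub]

theorem pathEDist_vadd_le (w : ℂ) (p q : Cover) : pathEDist (w +ᵥ p) (w +ᵥ q) ≤ pathEDist p q := by
  refine le_pathEDist fun γ a b h => ?_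
  have h' : IsCurve (fun s => w +ᵥ γ s) a b (w +ᵥ p) (w +ᵥ q) :=
    ⟨h.le, by rw [h.left], by rw [h.right], h.cont_r, h.cont_ζ.add continuousOn_const,
      h.cont_θ.add continuousOn_const⟩
  refine (pathEDist_le h').trans (le_of_eq ?_)
  simp only [length, eVariationOn, dist_proj_vadd]

instance : IsIsometricVAdd ℂ Cover where
  isometry_vadd w p q := by
    refine le_antisymm (pathEDist_vadd_le w p q) ?_
    have := pathEDist_vadd_le (-w) (w +ᵥ p) (w +ᵥ q)
    rwa [neg_vadd_vadd, neg_vadd_vadd] at this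

instance : UniformContinuousConstVAdd ℂ Cover :=
  ⟨fun w => (isometry_vadd Cover w).uniformContinuous⟩

end Cover

/-- The infinite cyclic branched cover of `H3`, branched over a geodesic: the metric completion of
the universal cover of the complement of the geodesic.  The action of `ℂ` extends to it. -/
abbrev HHat : Type := UniformSpace.Completion Cover

/-- The singular axis: the points added in the completion. -/
def axis : Set HHat := (range ((↑) : Cover → HHat))ᶜ

/-! ### Model solid tori -/

/-- The group generated by the elliptic of angle `α` and the loxodromic of complex length
`lam + i τ`, as a subgroup of `ℂ`. -/
def deckGroup (α lam τ : ℝ) : AddSubgroup ℂ :=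
  AddSubgroup.closure {⟨0, α⟩, ⟨lam, τ⟩}

/-- The model solid torus `N_{α,lam,τ}`: the quotient of the branched cover by the deck group. -/
def ModelSolidTorus (α lam τ : ℝ) : Type :=
  AddAction.orbitRel.Quotient (deckGroup α lam τ) HHat

namespace ModelSolidTorus

variable {α lam τ : ℝ}

/-- The quotient map. -/
def mk (p : HHat) : ModelSolidTorus α lam τ :=
  Quotient.mk (AddAction.orbitRel (deckGroup α lam τ) HHat) p

instance : TopologicalSpace (ModelSolidTorus α lam τ) := .coinduced mk inferInstance

/-- The quotient distance: the infimum of the distances between lifts. -/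
def dist (x y : ModelSolidTorus α lam τ) : ℝ :=
  sInf {d | ∃ p q : HHat, mk p = x ∧ mk q = y ∧ d = Dist.dist p q}

/-- The open metric ball of radius `ρ` about `x`. -/
def ball (x : ModelSolidTorus α lam τ) (ρ : ℝ) : Set (ModelSolidTorus α lam τ) :=
  {y | dist y x < ρ}

/-- The core curve. -/
def core : Set (ModelSolidTorus α lam τ) := mk '' axis

/-- The distance of a point to the core curve. -/
def radius (x : ModelSolidTorus α lam τ) : ℝ := sInf {d | ∃ c ∈ core, d = dist x c}

/-- The open `ρ`-ball about `x` is isometric, as a Riemannian manifold, to a `ρ`-ball in `H3`: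
there is a bijection `f` between the balls, taking centre to centre, that maps a small ball about
every point isometrically onto a ball. -/
def IsHyperbolicBall (x : ModelSolidTorus α lam τ) (ρ : ℝ) : Prop :=
  ∃ f : H3 → ModelSolidTorus α lam τ, f H3.origin = x ∧
    BijOn f (Metric.ball H3.origin ρ) (ball x ρ) ∧
    ∀ p ∈ Metric.ball H3.origin ρ, ∃ η > 0, Metric.ball p η ⊆ Metric.ball H3.origin ρ ∧
      f '' Metric.ball p η = ball (f p) η ∧
      ∀ u ∈ Metric.ball p η, ∀ v ∈ Metric.ball p η, dist (f u) (f v) = Dist.dist u v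

/-- The injectivity radius: the supremal radius of a hyperbolic ball about `x`.  (It is `0` when no
ball of positive radius is hyperbolic.) -/
def injrad (x : ModelSolidTorus α lam τ) : ℝ := sSup {ρ | 0 ≤ ρ ∧ IsHyperbolicBall x ρ}

end ModelSolidTorus

open ModelSolidTorus

/-- The closed `ε`-thin part `N^{≤ ε}`: the points of injectivity radius at most `ε / 2`. -/
def thinPart (α lam τ ε : ℝ) : Set (ModelSolidTorus α lam τ) := {x | injrad x ≤ ε / 2}

/-- The radius `r(ε)` of the `ε`-tube: the distance to the core of the points on the boundary of
`N^{≤ ε}` (all of these points have the same distance to the core). -/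
def tubeRadius (α lam τ ε : ℝ) : ℝ := sSup (radius '' frontier (thinPart α lam τ ε))

/-- The distance `d(δ, ε)` between the `δ`-tube and the `ε`-tube. -/
def tubeDist (α lam τ δ ε : ℝ) : ℝ := tubeRadius α lam τ ε - tubeRadius α lam τ δ

end HypTube

end

open Set
open scoped ENNReal

noncomputable section

namespace HypTube

/-! ### Hyperbolic distance in terms of the Lorentzian product. -/

namespace H3

/-! An element `w` of `ℂ` moves a point at distance `R` from the axis by a distance whose hyperbolic
cosine is `1 + c + B sinh² R`, where `c = cosh (Re w) - 1` and `B = cosh (Re w) - angCos (Im w)`, so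
that `0 ≤ c ≤ B` (`HHat.cosh_dist_vadd_self`). The injectivity radius is half the least displacement
by an essential deck element. With `E(ε) = cosh ε - 1`, the number `sinh² r(ε)` is therefore the
level `u` at which the lower envelope of the affine functions `c + B u` takes the value `E(ε)`
(`tubeRadius_spec`).

Put `r = r(δ)`, `s = r(ε)`, `d = s - r`, and choose `(c, B)` that is minimal at `s`. Then `c + B
sinh² s = E(ε)` and `c + B sinh² r ≥ E(δ)`. In the identity `E(ε) - cosh² d E(δ) = B (cosh² s -
cosh² d cosh² r) + (B - c) sinh² d + cosh² d (c + B sinh² r - E(δ))` all three terms are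
nonnegative, which is the bound (`cosh_sub_sq_mul_le`). Equality forces `r = 0` and `B = c = E(δ)`:
some deck element is a pure translation by `δ`, and no essential element moves the core by less.
Rotations fix the core, so they cannot be essential, which means `α = 2π`.

The rest of the work is to obtain the injectivity radius from its definition. The path metric of the
cover has a closed formula (`Cover.cosh_dist`): folding the cover into a half space bounds lengths
from below, while lifted geodesics and paths through the axis bound the distance from above. The
formula passes to the completion (`HHat.cosh_dist`). A ball in the quotient is hyperbolic exactly
when its radius is at most half of every essential displacement (`isHyperbolicBall_mk_iff`). If the
displacements are large, a section of the projection to `H3` is a chart. If one is small, the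
geodesic from a point to its translate becomes a loop inside the ball, and its pullback to `H3` is a
closed local geodesic, contrary to `H3.lor_of_local_geodesic`. For cone angle below `2π`, balls that
meet the core are excluded by `IsHyperbolicBall.le_rad`. -/

theorem lor_le_cosh_iff (p q : H3) {a : ℝ} (ha : 0 ≤ a) : lor p q ≤ Real.cosh a ↔ dist p q ≤ a := by
  rw [← cosh_dist, Real.cosh_le_cosh, abs_of_nonneg dist_nonneg, abs_of_nonneg ha]

theorem dist_eq_of_lor_eq_cosh {p q : H3} {a : ℝ} (ha : 0 ≤ a) (h : lor p q = Real.cosh a) :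
    dist p q = a := by
  rw [dist_def, h, Real.arcosh_cosh ha]

theorem dist_le_dist_of_lor_le {p q p' q' : H3} (h : lor p q ≤ lor p' q') :
    dist p q ≤ dist p' q' := by
  rw [← lor_le_cosh_iff _ _ dist_nonneg, cosh_dist]; exact h

theorem lor_origin (p : H3) : lor origin p = p.t := by simp [lor, origin]

theorem one_le_t (p : H3) : 1 ≤ p.t := lor_origin p ▸ one_le_lor origin p

/-! ### Point reflections -/

/-- The Gram inequality for `p`, `m` and the origin bounds `(p.t - L * m.t) ^ 2` by `(L ^ 2 - 1) *
(m.t ^ 2 - 1)` with `L = lor m p`. If the reflected time coordinate were not positive, the left side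
would be at least `(L * m.t) ^ 2`, which is larger. -/
theorem pointReflection_t_pos (m p : H3) : 0 < 2 * lor m p * m.t - p.t := by
  have h := lor_gram p m origin
  rw [lor_comm m origin, lor_comm p origin, lor_origin, lor_origin, lor_comm p m] at h
  have h1 := one_le_lor m p
  have h2 := one_le_t m
  by_contra hc
  push Not at hc
  have h3 : lor m p * m.t ≤ p.t - lor m p * m.t := by linarith
  have h4 : 0 ≤ lor m p * m.t := by positivity
  have h5 := pow_le_pow_left₀ h4 h3 2
  nlinarith

/-- The reflection of hyperbolic space in the point `m`. -/
def pointReflection (m p : H3) : H3 where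
  t := 2 * lor m p * m.t - p.t
  x := 2 * lor m p * m.x - p.x
  y := 2 * lor m p * m.y - p.y
  z := 2 * lor m p * m.z - p.z
  norm_eq := by
    have hm := m.norm_eq
    have hp := p.norm_eq
    have hl : lor m p = m.t * p.t - m.x * p.x - m.y * p.y - m.z * p.z := rfl
    linear_combination 4 * lor m p ^ 2 * hm + hp + 4 * lor m p * hl
  t_pos := pointReflection_t_pos m p

theorem lor_pointReflection (m p q : H3) :
    lor (pointReflection m p) (pointReflection m q) = lor p q := by
  have hm := m.norm_eq
  have hp : lor m p = m.t * p.t - m.x * p.x - m.y * p.y - m.z * p.z := rfl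
  have hq : lor m q = m.t * q.t - m.x * q.x - m.y * q.y - m.z * q.z := rfl
  change (2 * lor m p * m.t - p.t) * (2 * lor m q * m.t - q.t)
    - (2 * lor m p * m.x - p.x) * (2 * lor m q * m.x - q.x)
    - (2 * lor m p * m.y - p.y) * (2 * lor m q * m.y - q.y)
    - (2 * lor m p * m.z - p.z) * (2 * lor m q * m.z - q.z)
    = p.t * q.t - p.x * q.x - p.y * q.y - p.z * q.z
  linear_combination 4 * lor m p * lor m q * hm + 2 * lor m p * hq + 2 * lor m q * hp

theorem dist_pointReflection (m p q : H3) :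
    dist (pointReflection m p) (pointReflection m q) = dist p q := by
  rw [dist_def, dist_def, lor_pointReflection]

theorem lor_self_pointReflection (m p : H3) : lor m (pointReflection m p) = lor m p := by
  have hm := m.norm_eq
  have hp : lor m p = m.t * p.t - m.x * p.x - m.y * p.y - m.z * p.z := rfl
  change m.t * (2 * lor m p * m.t - p.t) - m.x * (2 * lor m p * m.x - p.x)
    - m.y * (2 * lor m p * m.y - p.y) - m.z * (2 * lor m p * m.z - p.z) = lor m p
  linear_combination 2 * lor m p * hm + hp

theorem pointReflection_involutive (m : H3) : Function.Involutive (pointReflection m) := by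
  intro p
  have h := lor_self_pointReflection m p
  ext
  · change 2 * lor m (pointReflection m p) * m.t - (2 * lor m p * m.t - p.t) = p.t
    rw [h]; ring
  · change 2 * lor m (pointReflection m p) * m.x - (2 * lor m p * m.x - p.x) = p.x
    rw [h]; ring
  · change 2 * lor m (pointReflection m p) * m.y - (2 * lor m p * m.y - p.y) = p.y
    rw [h]; ring
  · change 2 * lor m (pointReflection m p) * m.z - (2 * lor m p * m.z - p.z) = p.z
    rw [h]; ring

theorem dist_self_pointReflection (m p : H3) : dist m (pointReflection m p) = dist m p := by
  rw [dist_def, dist_def, lor_self_pointReflection]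

theorem dist_pointReflection_self (m p : H3) : dist p (pointReflection m p) = 2 * dist m p := by
  apply dist_eq_of_lor_eq_cosh (by positivity)
  rw [Real.cosh_two_mul, Real.sinh_sq, cosh_dist]
  have hm : lor m p = m.t * p.t - m.x * p.x - m.y * p.y - m.z * p.z := rfl
  have hp := p.norm_eq
  change p.t * (2 * lor m p * m.t - p.t) - p.x * (2 * lor m p * m.x - p.x)
    - p.y * (2 * lor m p * m.y - p.y) - p.z * (2 * lor m p * m.z - p.z) = _
  linear_combination (-2 * lor m p) * hm - hp

/-- Point reflections act transitively. -/
theorem exists_pointReflection_origin (q : H3) : ∃ m, pointReflection m origin = q := by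
  have hq := q.norm_eq
  have h1 := one_le_t q
  set k := Real.sqrt (2 * (1 + q.t)) with hk
  have hk0 : 0 < k := Real.sqrt_pos.2 (by linarith)
  have hk2 : k ^ 2 = 2 * (1 + q.t) := Real.sq_sqrt (by linarith)
  let m : H3 := ⟨(1 + q.t) / k, q.x / k, q.y / k, q.z / k, by
    field_simp
    rw [hk2]; linarith, by positivity⟩
  have hl : lor m origin = (1 + q.t) / k := by rw [lor_comm, lor_origin]
  have hkk : ∀ a : ℝ, 2 * ((1 + q.t) / k) * (a / k) = a := fun a => by
    field_simp
    rw [hk2]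
  refine ⟨m, ?_⟩
  ext
  · change 2 * lor m origin * ((1 + q.t) / k) - 1 = q.t
    rw [hl, hkk]; ring
  · change 2 * lor m origin * (q.x / k) - 0 = q.x
    rw [hl, hkk]; ring
  · change 2 * lor m origin * (q.y / k) - 0 = q.y
    rw [hl, hkk]; ring
  · change 2 * lor m origin * (q.z / k) - 0 = q.z
    rw [hl, hkk]; ring

/-! ### Geodesics -/

/-- If `b` is the midpoint of `a` and `c` then `a + c = 2 cosh s • b` in the ambient space. -/
theorem lor_add_lor_of_midpoint {a b c : H3} {s : ℝ} (hab : lor a b = Real.cosh s)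
    (hbc : lor b c = Real.cosh s) (hac : lor a c = Real.cosh (2 * s)) (q : H3) :
    lor q a + lor q c = 2 * Real.cosh s * lor q b := by
  have ha := a.norm_eq
  have hb := b.norm_eq
  have hc := c.norm_eq
  rw [Real.cosh_two_mul, Real.sinh_sq] at hac
  set C := Real.cosh s
  unfold lor at hab hbc hac
  -- The defect vector `a + c - 2 C b` is orthogonal to `b` and null. The Lorentzian form is
  -- definite on the orthogonal complement of `b`, so the vector vanishes.
  obtain ⟨T, hT⟩ : ∃ T, T = a.t + c.t - 2 * C * b.t := ⟨_, rfl⟩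
  obtain ⟨X, hX⟩ : ∃ X, X = a.x + c.x - 2 * C * b.x := ⟨_, rfl⟩
  obtain ⟨Y, hY⟩ : ∃ Y, Y = a.y + c.y - 2 * C * b.y := ⟨_, rfl⟩
  obtain ⟨Z, hZ⟩ : ∃ Z, Z = a.z + c.z - 2 * C * b.z := ⟨_, rfl⟩
  have horth : b.t * T = X * b.x + Y * b.y + Z * b.z := by
    rw [hT, hX, hY, hZ]; linear_combination hab + hbc - 2 * C * hb
  have hnull : T ^ 2 - X ^ 2 - Y ^ 2 - Z ^ 2 = 0 := by
    rw [hT, hX, hY, hZ]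
    linear_combination ha + hc + 4 * C ^ 2 * hb + 2 * hac - 4 * C * hab - 4 * C * hbc
  have hb2 : b.t ^ 2 = 1 + b.x ^ 2 + b.y ^ 2 + b.z ^ 2 := by linarith
  have key : 0 = X ^ 2 + Y ^ 2 + Z ^ 2 + (X * b.y - Y * b.x) ^ 2 + (Y * b.z - Z * b.y) ^ 2 +
        (Z * b.x - X * b.z) ^ 2 := by
    have h1 : b.t ^ 2 * T ^ 2 = (X * b.x + Y * b.y + Z * b.z) ^ 2 := by rw [← horth]; ring
    have h2 : T ^ 2 = X ^ 2 + Y ^ 2 + Z ^ 2 := by linarith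
    rw [h2, hb2] at h1
    linear_combination -h1
  have p1 := sq_nonneg (X * b.y - Y * b.x)
  have p2 := sq_nonneg (Y * b.z - Z * b.y)
  have p3 := sq_nonneg (Z * b.x - X * b.z)
  have hX0 : X = 0 := by
    apply pow_eq_zero_iff (two_ne_zero) |>.1
    linarith only [key, p1, p2, p3, sq_nonneg X, sq_nonneg Y, sq_nonneg Z]
  have hY0 : Y = 0 := by
    apply pow_eq_zero_iff (two_ne_zero) |>.1
    linarith only [key, p1, p2, p3, sq_nonneg X, sq_nonneg Y, sq_nonneg Z]
  have hZ0 : Z = 0 := by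
    apply pow_eq_zero_iff (two_ne_zero) |>.1
    linarith only [key, p1, p2, p3, sq_nonneg X, sq_nonneg Y, sq_nonneg Z]
  have hT0 : T = 0 := by
    rw [hX0, hY0, hZ0] at hnull
    apply pow_eq_zero_iff (two_ne_zero) |>.1
    linarith
  unfold lor
  rw [hT0] at hT; rw [hX0] at hX; rw [hY0] at hY; rw [hZ0] at hZ
  linear_combination (-q.t) * hT + q.x * hX + q.y * hY + q.z * hZ

/-- The geodesic segment from `p` to `q`, in ambient coordinates. -/
theorem exists_geodesic {p q : H3} (hpq : p ≠ q) :
    ∃ (G : ℝ → H3) (A B : ℝ → ℝ), Continuous A ∧ Continuous B ∧ G 0 = p ∧ G (dist p q) = q ∧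
      (∀ s ∈ Icc 0 (dist p q), 0 ≤ A s ∧ 0 ≤ B s ∧ 0 < A s + B s ∧
        (G s).t = A s * p.t + B s * q.t ∧ (G s).x = A s * p.x + B s * q.x ∧
        (G s).y = A s * p.y + B s * q.y ∧ (G s).z = A s * p.z + B s * q.z) ∧
      (∀ s ∈ Icc 0 (dist p q), ∀ s' ∈ Icc 0 (dist p q), dist (G s) (G s') = |s - s'|) := by
  classical
  set d := dist p q with hd
  have hd0 : 0 < d := dist_pos.2 hpq
  have hS : 0 < Real.sinh d := Real.sinh_pos_iff.2 hd0
  have hp := p.norm_eq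
  have hq := q.norm_eq
  have hl : p.t * q.t - p.x * q.x - p.y * q.y - p.z * q.z = Real.cosh d := (cosh_dist p q).symm
  -- These are the weights of hyperbolic linear interpolation; `hAB` below says that the resulting
  -- curve has unit speed.
  let A : ℝ → ℝ := fun s => Real.sinh (d - s) / Real.sinh d
  let B : ℝ → ℝ := fun s => Real.sinh s / Real.sinh d
  have hA : ∀ s, A s = Real.sinh (d - s) / Real.sinh d := fun _ => rfl
  have hB : ∀ s, B s = Real.sinh s / Real.sinh d := fun _ => rfl
  have hAB : ∀ s s', A s * A s' + B s * B s' + (A s * B s' + B s * A s') * Real.cosh d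
      = Real.cosh (s - s') := by
    intro s s'
    have h1 : Real.cosh d ^ 2 = Real.sinh d ^ 2 + 1 := Real.cosh_sq d
    rw [hA, hA, hB, hB]
    field_simp
    rw [Real.sinh_sub, Real.sinh_sub, Real.cosh_sub]
    linear_combination (-Real.sinh s * Real.sinh s') * h1
  have hpos : ∀ s ∈ Icc 0 d, 0 ≤ A s ∧ 0 ≤ B s ∧ 0 < A s + B s := by
    intro s hs
    have h1 : 0 ≤ Real.sinh (d - s) := Real.sinh_nonneg_iff.2 (by linarith [hs.2])
    have h2 : 0 ≤ Real.sinh s := Real.sinh_nonneg_iff.2 hs.1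
    refine ⟨by positivity, by positivity, ?_⟩
    rw [hA, hB, ← add_div]
    apply div_pos _ hS
    rcases hs.1.eq_or_lt with h | h
    · rw [← h]; simpa using hS
    · have := Real.sinh_pos_iff.2 h
      linarith
  let G : ℝ → H3 := fun s => if h : s ∈ Icc 0 d then
    ⟨A s * p.t + B s * q.t, A s * p.x + B s * q.x, A s * p.y + B s * q.y, A s * p.z + B s * q.z, by
      have := hAB s s
      rw [sub_self, Real.cosh_zero] at this
      linear_combination A s ^ 2 * hp + B s ^ 2 * hq + 2 * A s * B s * hl + this, by
      obtain ⟨h1, h2, h3⟩ := hpos s h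
      rcases h1.eq_or_lt with h | h
      · have : 0 < B s := by linarith
        have := mul_pos this q.t_pos
        rw [← h]; linarith
      · have := mul_pos h p.t_pos
        have := mul_nonneg h2 q.t_pos.le
        linarith⟩ else p
  have hG : ∀ s ∈ Icc 0 d, (G s).t = A s * p.t + B s * q.t ∧ (G s).x = A s * p.x + B s * q.x ∧
        (G s).y = A s * p.y + B s * q.y ∧ (G s).z = A s * p.z + B s * q.z := by
    intro s hs
    simp only [G, dif_pos hs, and_self]
  have hA0 : A 0 = 1 := by simp [hA, hS.ne']
  have hB0 : B 0 = 0 := by simp [hB]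
  have hAd : A d = 0 := by simp [hA]
  have hBd : B d = 1 := by simp [hB, hS.ne']
  have hAc : Continuous A :=
    (Real.continuous_sinh.comp (continuous_const.sub continuous_id)).div_const _
  have hBc : Continuous B := Real.continuous_sinh.div_const _
  refine ⟨G, A, B, hAc, hBc, ?_, ?_, ?_, ?_⟩
  · obtain ⟨h1, h2, h3, h4⟩ := hG 0 ⟨le_rfl, hd0.le⟩
    rw [hA0, hB0] at h1 h2 h3 h4
    ext <;> linarith
  · obtain ⟨h1, h2, h3, h4⟩ := hG d ⟨hd0.le, le_rfl⟩
    rw [hAd, hBd] at h1 h2 h3 h4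
    ext <;> linarith
  · intro s hs
    obtain ⟨h1, h2, h3⟩ := hpos s hs
    exact ⟨h1, h2, h3, hG s hs⟩
  · intro s hs s' hs'
    apply dist_eq_of_lor_eq_cosh (abs_nonneg _)
    obtain ⟨h1, h2, h3, h4⟩ := hG s hs
    obtain ⟨h1', h2', h3', h4'⟩ := hG s' hs'
    rw [Real.cosh_abs, ← hAB]
    unfold lor
    rw [h1, h2, h3, h4, h1', h2', h3', h4']
    linear_combination A s * A s' * hp + B s * B s' * hq + (A s * B s' + B s * A s') * hl

theorem continuousOn_comp_of_local {d : ℝ} {e : ℝ → H3}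
    (hloc : ∀ t ∈ Icc 0 d, ∃ η > 0, ∀ t' ∈ Icc 0 d, ∀ t'' ∈ Icc 0 d, |t' - t| < η → |t'' - t| < η →
      dist (e t') (e t'') = |t' - t''|) : ContinuousOn e (Icc 0 d) := by
  intro t ht
  obtain ⟨η, hη, h⟩ := hloc t ht
  rw [Metric.continuousWithinAt_iff]
  intro ε hε
  refine ⟨min ε η, lt_min hε hη, fun {t'} ht' hd => ?_⟩
  rw [Real.dist_eq] at hd
  rw [h t' ht' t ht (hd.trans_le (min_le_right _ _)) (by simpa using hη)]
  exact hd.trans_le (min_le_left _ _)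

/-- Local geodesics in hyperbolic space are global geodesics. -/
theorem lor_of_local_geodesic {d : ℝ} (hd : 0 < d) {e : ℝ → H3}
    (hloc : ∀ t ∈ Icc 0 d, ∃ η > 0, ∀ t' ∈ Icc 0 d, ∀ t'' ∈ Icc 0 d, |t' - t| < η → |t'' - t| < η →
      dist (e t') (e t'') = |t' - t''|) : lor (e 0) (e d) = Real.cosh d := by
  have hcont : ContinuousOn (fun t => dist (e 0) (e t)) (Icc 0 d) :=
    (continuous_const.dist continuous_id).comp_continuousOn (continuousOn_comp_of_local hloc)
  have hcont' : ContinuousOn (fun t => lor (e 0) (e t) - Real.cosh t) (Icc 0 d) := by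
    have : (fun t => lor (e 0) (e t) - Real.cosh t) =
        fun t => Real.cosh (dist (e 0) (e t)) - Real.cosh t := by
      funext t; rw [cosh_dist]
    rw [this]
    exact (Real.continuous_cosh.comp_continuousOn hcont).sub Real.continuous_cosh.continuousOn
  set g := fun t => lor (e 0) (e t) - Real.cosh t with hg
  have hg0 : g 0 = 0 := by simp [hg, lor_self]
  -- Continuous induction. The strict inequality makes `s` an intersection of closed rays, so it is
  -- closed without any appeal to continuity; the value at `t` itself is recovered in `hval` as a
  -- limit from the left.
  let s : Set ℝ := {t | ∀ t' ∈ Icc 0 d, t' < t → g t' = 0}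
  have hs : IsClosed s := by
    have : s = ⋂ t' ∈ {t' | t' ∈ Icc 0 d ∧ g t' ≠ 0}, Iic t' := by
      ext t
      simp only [s, mem_ofPred_eq, mem_iInter, mem_Iic, ne_eq, and_imp]
      exact ⟨fun h t' h1 h2 => not_lt.1 fun h3 => h2 (h t' h1 h3),
        fun h t' h1 h2 => by_contra fun h3 => not_lt.2 (h t' h1 h3) h2⟩
    rw [this]
    exact isClosed_biInter fun _ _ => isClosed_Iic
  have hval : ∀ t ∈ s, t ∈ Icc 0 d → g t = 0 := by
    intro t hts ht
    rcases ht.1.eq_or_lt with h | h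
    · rw [← h]; exact hg0
    · have hne : (nhdsWithin t (Ico 0 t)).NeBot := by
        rw [← mem_closure_iff_nhdsWithin_neBot, closure_Ico h.ne]
        exact ⟨h.le, le_rfl⟩
      have h1 : Filter.Tendsto g (nhdsWithin t (Ico 0 t)) (nhds (g t)) :=
        (hcont' t ht).mono_left (nhdsWithin_mono _ fun u hu => ⟨hu.1, hu.2.le.trans ht.2⟩)
      have h2 : Filter.Tendsto g (nhdsWithin t (Ico 0 t)) (nhds 0) := by
        refine tendsto_const_nhds.congr' ?_
        filter_upwards [self_mem_nhdsWithin] with u hu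
        exact (hts u ⟨hu.1, hu.2.le.trans ht.2⟩ hu.2).symm
      exact tendsto_nhds_unique h1 h2
  have key : Icc 0 d ⊆ s := by
    refine IsClosed.Icc_subset_of_forall_mem_nhdsWithin (hs.inter isClosed_Icc)
      (fun t' ht' h => absurd ht'.1 (not_le.2 h)) ?_
    rintro t ⟨hts, ht⟩
    obtain ⟨η, hη, h⟩ := hloc t ⟨ht.1, ht.2.le⟩
    have hT : t ∈ Icc 0 d := ⟨ht.1, ht.2.le⟩
    rcases ht.1.eq_or_lt with h0 | h0
    · subst h0
      filter_upwards [Ioo_mem_nhdsGT hη] with u hu t' ht' htu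
      have := h 0 hT t' ht' (by simpa using hη)
        (by rw [sub_zero, abs_of_nonneg ht'.1]; exact htu.trans hu.2)
      rw [zero_sub, abs_neg, abs_of_nonneg ht'.1] at this
      simp only [hg]
      rw [← cosh_dist, this, sub_self]
    · have hmin : 0 < min η t := lt_min hη h0
      filter_upwards [Ioo_mem_nhdsGT (show t < t + min η t by linarith)] with u hu t' ht' htu
      rcases lt_trichotomy t' t with hlt | heq | hgt
      · exact hts t' ht' hlt
      · rw [heq]; exact hval t hts hT
      · obtain ⟨k, rfl⟩ : ∃ k, t' = t + k := ⟨t' - t, by ring⟩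
        have hk0 : 0 < k := by linarith
        have hk : k < min η t := by linarith [hu.2]
        have hk1 := hk.trans_le (min_le_left _ _)
        have hk2 := hk.trans_le (min_le_right _ _)
        -- Locally `e t` is the midpoint of `e (t - k)` and `e (t + k)`. Hence `lor (e 0) (e ·)`
        -- obeys the recursion `f (t + k) + f (t - k) = 2 cosh k f t`, as `cosh` does, and agreement
        -- at `t - k` and `t` propagates to `t + k`.
        have hm : t - k ∈ Icc 0 d := ⟨by linarith, by linarith [ht.2]⟩
        have e1 : |t - k - t| < η := by rw [abs_lt]; constructor <;> linarith
        have e2 : |t + k - t| < η := by rw [abs_lt]; constructor <;> linarith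
        have e3 : |t - t| < η := by simpa using hη
        have d1 := h _ hm _ hT e1 e3
        have d2 := h _ hT _ ht' e3 e2
        have d3 := h _ hm _ ht' e1 e2
        rw [show t - k - t = -k by ring, abs_neg, abs_of_pos hk0] at d1
        rw [show t - (t + k) = -k by ring, abs_neg, abs_of_pos hk0] at d2
        rw [show t - k - (t + k) = -(2 * k) by ring, abs_neg, abs_of_pos (by linarith)] at d3
        have hmid := lor_add_lor_of_midpoint (a := e (t - k)) (b := e t) (c := e (t + k)) (s := k)
          (by rw [← cosh_dist, d1]) (by rw [← cosh_dist, d2]) (by rw [← cosh_dist, d3]) (e 0)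
        have g1 := hts _ hm (by linarith)
        have g2 := hval t hts hT
        simp only [hg] at g1 g2 ⊢
        have c1 := Real.cosh_add t k
        have c2 := Real.cosh_sub t k
        linear_combination hmid - g1 + 2 * Real.cosh k * g2 - c1 - c2
  have := hval d (key ⟨hd.le, le_rfl⟩) ⟨hd.le, le_rfl⟩
  simp only [hg] at this
  linarith

end H3

/-! ### The truncated cosine of a real-valued angle. -/

/-- The cosine of an angle on a cone of infinite total angle: angles beyond `π` count as `π`. -/
def angCos (θ : ℝ) : ℝ := Real.cos (min |θ| Real.pi)

theorem angCos_eq_cos {θ : ℝ} (h : |θ| ≤ Real.pi) : angCos θ = Real.cos θ := by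
  rw [angCos, min_eq_left h, Real.cos_abs]

theorem angCos_eq_neg_one {θ : ℝ} (h : Real.pi ≤ |θ|) : angCos θ = -1 := by
  rw [angCos, min_eq_right h, Real.cos_pi]

theorem angCos_le_cos (θ : ℝ) : angCos θ ≤ Real.cos θ := by
  rcases le_total |θ| Real.pi with h | h
  · rw [angCos_eq_cos h]
  · rw [angCos_eq_neg_one h]; exact Real.neg_one_le_cos θ

theorem angCos_le_one (θ : ℝ) : angCos θ ≤ 1 := Real.cos_le_one _

theorem neg_one_le_angCos (θ : ℝ) : -1 ≤ angCos θ := Real.neg_one_le_cos _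

theorem angCos_zero : angCos 0 = 1 := by
  rw [angCos_eq_cos (by simp [Real.pi_pos.le]), Real.cos_zero]

theorem continuous_angCos : Continuous angCos := by
  unfold angCos
  fun_prop

theorem angCos_le_angCos {θ θ' : ℝ} (h : |θ| ≤ |θ'|) : angCos θ' ≤ angCos θ :=
  Real.cos_le_cos_of_nonneg_of_le_pi (le_min (abs_nonneg _) Real.pi_pos.le) (min_le_right _ _)
    (min_le_min_right _ h)

theorem angCos_lt_one {θ : ℝ} (h : θ ≠ 0) : angCos θ < 1 := by
  rw [← Real.cos_zero]
  exact Real.cos_lt_cos_of_nonneg_of_le_pi le_rfl (min_le_right _ _)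
    (lt_min (abs_pos.2 h) Real.pi_pos)

namespace H3

/-- The point of the axis at position `ζ`. -/
def axisPoint (ζ : ℝ) : H3 :=
  ⟨Real.cosh ζ, Real.sinh ζ, 0, 0, by rw [Real.cosh_sq]; ring, Real.cosh_pos _⟩

end H3

/-! ### The path metric of the cover. -/

namespace Cover

theorem lor_proj (p q : Cover) : H3.lor p.proj q.proj = Real.cosh p.r * Real.cosh q.r *
      Real.cosh (p.ζ - q.ζ) - Real.sinh p.r * Real.sinh q.r * Real.cos (p.θ - q.θ) := by
  simp only [H3.lor, proj, Real.cosh_sub, Real.cos_sub]; ring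

theorem lor_proj_axisPoint (p : Cover) (ζ : ℝ) :
    H3.lor p.proj (H3.axisPoint ζ) = Real.cosh p.r * Real.cosh (p.ζ - ζ) := by
  simp only [H3.lor, proj, H3.axisPoint, Real.cosh_sub]; ring

/-- The hyperbolic cosine of the path distance in the cover. -/
def lor (p q : Cover) : ℝ := Real.cosh p.r * Real.cosh q.r * Real.cosh (p.ζ - q.ζ) -
  Real.sinh p.r * Real.sinh q.r * angCos (p.θ - q.θ)

theorem sinh_r_pos (p : Cover) : 0 < Real.sinh p.r := Real.sinh_pos_iff.2 p.r_pos

theorem lor_proj_le (p q : Cover) : H3.lor p.proj q.proj ≤ lor p q := by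
  rw [lor_proj, lor]
  have := mul_le_mul_of_nonneg_left (angCos_le_cos (p.θ - q.θ))
    (mul_pos p.sinh_r_pos q.sinh_r_pos).le
  linarith

theorem one_le_lor (p q : Cover) : 1 ≤ lor p q := (H3.one_le_lor _ _).trans (lor_proj_le p q)

theorem lor_eq_of_abs_le {p q : Cover} (h : |p.θ - q.θ| ≤ Real.pi) :
    lor p q = H3.lor p.proj q.proj := by
  rw [lor_proj, lor, angCos_eq_cos h]

/-- Fold the cover onto a half space bounded by planes through the axis. -/
def fold (θ₀ : ℝ) (p : Cover) : Cover := ⟨p.r, p.ζ, min |p.θ - θ₀| Real.pi, p.r_pos⟩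

/-- The map `θ ↦ min |θ - θ₀| π` is 1-Lipschitz and `cos` decreases on `[0, π]`. The hypothesis on
the angles is needed because the projection does not see full turns. -/
theorem lor_fold_le (θ₀ : ℝ) {p q : Cover} (h : |p.θ - q.θ| ≤ Real.pi) :
    H3.lor (fold θ₀ p).proj (fold θ₀ q).proj ≤ H3.lor p.proj q.proj := by
  rw [lor_proj, lor_proj]
  have h1 : |min |p.θ - θ₀| Real.pi - min |q.θ - θ₀| Real.pi| ≤ |p.θ - q.θ| := by
    refine (abs_min_sub_min_le_max _ _ _ _).trans (max_le ?_ (by simp))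
    refine (abs_abs_sub_abs_le _ _).trans (le_of_eq ?_)
    congr 1; ring
  have h2 : Real.cos (p.θ - q.θ) ≤ Real.cos (min |p.θ - θ₀| Real.pi - min |q.θ - θ₀| Real.pi) := by
    rw [← Real.cos_abs (p.θ - q.θ), ← Real.cos_abs (_ - min _ _)]
    exact Real.cos_le_cos_of_nonneg_of_le_pi (abs_nonneg _) h h1
  have := mul_le_mul_of_nonneg_left h2 (mul_pos p.sinh_r_pos q.sinh_r_pos).le
  simp only [fold]
  linarith

theorem lor_fold_self (p q : Cover) :
    H3.lor (fold p.θ p).proj (fold p.θ q).proj = lor p q := by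
  rw [lor_proj, lor]
  simp only [fold, sub_self, abs_zero, min_eq_left Real.pi_pos.le, zero_sub, Real.cos_neg, angCos]
  rw [abs_sub_comm]

/-- Cut the curve so finely that consecutive angles differ by less than `π`. Folding about the
initial angle then shortens every step, and the folded endpoints are at distance `arcosh (lor p q)`
in `H3` by `lor_fold_self`. -/
theorem le_length {γ : ℝ → Cover} {a b : ℝ} {p q : Cover} (h : IsCurve γ a b p q) :
    ENNReal.ofReal (Real.arcosh (lor p q)) ≤ length γ a b := by
  have huc := isCompact_Icc.uniformContinuousOn_of_continuous h.cont_θ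
  rw [Metric.uniformContinuousOn_iff] at huc
  obtain ⟨η, hη, huc⟩ := huc Real.pi Real.pi_pos
  obtain ⟨N, hN⟩ := exists_nat_gt ((b - a) / η)
  have hba : 0 ≤ b - a := sub_nonneg.2 h.le
  have hN0 : (0 : ℝ) < N := lt_of_le_of_lt (by positivity) hN
  have hstep : (b - a) / N < η := by
    rw [div_lt_iff₀ hη] at hN
    rw [div_lt_iff₀ hN0]; linarith
  -- The clamp at `b` keeps every partition point in the interval, for all natural indices.
  let u : ℕ → ℝ := fun i => min (a + i * ((b - a) / N)) b
  have hu : Monotone u := fun i j hij => by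
    apply min_le_min_right
    gcongr
  have hus : ∀ i, u i ∈ Icc a b := fun i =>
    ⟨le_min (le_add_of_nonneg_right (by positivity)) h.le, min_le_right _ _⟩
  have hu0 : u 0 = a := by simp [u, h.le]
  have huN : u N = b := by
    have : a + N * ((b - a) / N) = b := by field_simp; ring
    simp only [u, this, min_self]
  have hsum := eVariationOn.sum_le (f := fun s => (γ s).proj) (n := N) hu hus
  refine le_trans ?_ hsum
  have htri := edist_le_range_sum_edist (fun i => (fold p.θ (γ (u i))).proj) N
  have hend : edist ((fold p.θ (γ (u 0))).proj) ((fold p.θ (γ (u N))).proj) =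
      ENNReal.ofReal (Real.arcosh (lor p q)) := by
    rw [hu0, huN, h.left, h.right, edist_dist, H3.dist_def, lor_fold_self]
  rw [← hend]
  refine htri.trans (Finset.sum_le_sum fun i _ => ?_)
  rw [edist_comm ((γ (u (i+1))).proj), edist_dist, edist_dist]
  apply ENNReal.ofReal_le_ofReal
  apply H3.dist_le_dist_of_lor_le
  apply lor_fold_le
  have hd : dist (u i) (u (i + 1)) < η := by
    rw [dist_comm, Real.dist_eq, abs_of_nonneg (sub_nonneg.2 (hu (Nat.le_succ i)))]
    refine lt_of_le_of_lt ?_ hstep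
    have e : a + ((i + 1 : ℕ) : ℝ) * ((b - a) / N) = a + i * ((b - a) / N) + (b - a) / N := by
      push_cast; ring
    have hs : 0 ≤ (b - a) / N := by positivity
    simp only [u, e]
    rcases le_total (a + i * ((b - a) / N)) b with h' | h'
    · rw [min_eq_left h']
      linarith [min_le_left (a + i * ((b - a) / N) + (b - a) / N) b]
    · rw [min_eq_right h', min_eq_right (by linarith)]; simpa using hs
  exact (huc _ (hus i) _ (hus (i + 1)) hd).le

theorem arcosh_lor_le_dist (p q : Cover) : Real.arcosh (lor p q) ≤ dist p q := by
  have h : ENNReal.ofReal (Real.arcosh (lor p q)) ≤ edist p q :=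
    le_pathEDist fun γ a b h => le_length h
  rw [edist_dist] at h
  exact (ENNReal.ofReal_le_ofReal_iff dist_nonneg).1 h

/-! ### Sections of the covering projection -/

/-- The coordinates of the plane orthogonal to the axis, rotated by `-θ₀`. -/
def planar (θ₀ : ℝ) (P : H3) : ℂ :=
  ⟨P.y * Real.cos θ₀ + P.z * Real.sin θ₀, P.z * Real.cos θ₀ - P.y * Real.sin θ₀⟩

/-- The section of the covering projection with angles near `θ₀`. -/
def sec (θ₀ : ℝ) (P : H3) : Cover where
  r := if P.y ^ 2 + P.z ^ 2 = 0 then 1 else Real.arsinh (Real.sqrt (P.y ^ 2 + P.z ^ 2))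
  ζ := Real.arsinh (P.x / Real.sqrt (1 + P.y ^ 2 + P.z ^ 2))
  θ := θ₀ + Complex.arg (planar θ₀ P)
  r_pos := by
    split_ifs with h
    · exact one_pos
    · refine Real.arsinh_pos_iff.2 (Real.sqrt_pos.2 (lt_of_le_of_ne (by positivity) (Ne.symm h)))

theorem norm_planar (θ₀ : ℝ) (P : H3) : ‖planar θ₀ P‖ = Real.sqrt (P.y ^ 2 + P.z ^ 2) := by
  rw [Complex.norm_def, Complex.normSq_apply]
  congr 1
  have := Real.sin_sq_add_cos_sq θ₀
  simp only [planar]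
  linear_combination (P.y ^ 2 + P.z ^ 2) * this

theorem proj_sec (θ₀ : ℝ) {P : H3} (hP : P.y ^ 2 + P.z ^ 2 ≠ 0) : (sec θ₀ P).proj = P := by
  have hpos : 0 < P.y ^ 2 + P.z ^ 2 := lt_of_le_of_ne (by positivity) hP.symm
  have hr : Real.sinh (sec θ₀ P).r = Real.sqrt (P.y ^ 2 + P.z ^ 2) := by
    simp only [sec, if_neg hP, Real.sinh_arsinh]
  have hc : Real.cosh (sec θ₀ P).r = Real.sqrt (1 + P.y ^ 2 + P.z ^ 2) := by
    rw [← abs_of_pos (Real.cosh_pos (sec θ₀ P).r), ← Real.sqrt_sq_eq_abs, Real.cosh_sq, hr,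
      Real.sq_sqrt hpos.le]
    congr 1; ring
  have hk : 0 < Real.sqrt (1 + P.y ^ 2 + P.z ^ 2) := Real.sqrt_pos.2 (by positivity)
  have hk2 : Real.sqrt (1 + P.y ^ 2 + P.z ^ 2) ^ 2 = 1 + P.y ^ 2 + P.z ^ 2 :=
    Real.sq_sqrt (by positivity)
  have hx : Real.cosh (sec θ₀ P).r * Real.sinh (sec θ₀ P).ζ = P.x := by
    rw [hc]; simp only [sec, Real.sinh_arsinh]
    field_simp
  have ht : Real.cosh (sec θ₀ P).r * Real.cosh (sec θ₀ P).ζ = P.t := by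
    have h0 : 0 ≤ Real.cosh (sec θ₀ P).r * Real.cosh (sec θ₀ P).ζ := by positivity
    refine (pow_left_inj₀ h0 P.t_pos.le two_ne_zero).1 ?_
    have h1 := P.norm_eq
    have h2 := Real.cosh_sq (sec θ₀ P).ζ
    rw [← hc] at hk2
    linear_combination (Real.cosh (sec θ₀ P).r) ^ 2 * h2 + hk2 - h1 +
      (Real.cosh (sec θ₀ P).r * Real.sinh (sec θ₀ P).ζ + P.x) * hx
  have hw : planar θ₀ P ≠ 0 := by
    rw [← norm_ne_zero_iff, norm_planar]
    exact (Real.sqrt_pos.2 hpos).ne'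
  have hcos := Complex.norm_mul_cos_arg (planar θ₀ P)
  have hsin := Complex.norm_mul_sin_arg (planar θ₀ P)
  rw [norm_planar, ← hr] at hcos hsin
  have h1 := Real.sin_sq_add_cos_sq θ₀
  ext
  · exact ht
  · exact hx
  · change Real.sinh (sec θ₀ P).r * Real.cos (θ₀ + Complex.arg (planar θ₀ P)) = P.y
    rw [Real.cos_add]
    have e1 : (planar θ₀ P).re = P.y * Real.cos θ₀ + P.z * Real.sin θ₀ := rfl
    have e2 : (planar θ₀ P).im = P.z * Real.cos θ₀ - P.y * Real.sin θ₀ := rfl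
    rw [e1] at hcos; rw [e2] at hsin
    linear_combination Real.cos θ₀ * hcos - Real.sin θ₀ * hsin + P.y * h1
  · change Real.sinh (sec θ₀ P).r * Real.sin (θ₀ + Complex.arg (planar θ₀ P)) = P.z
    rw [Real.sin_add]
    have e1 : (planar θ₀ P).re = P.y * Real.cos θ₀ + P.z * Real.sin θ₀ := rfl
    have e2 : (planar θ₀ P).im = P.z * Real.cos θ₀ - P.y * Real.sin θ₀ := rfl
    rw [e1] at hcos; rw [e2] at hsin
    linear_combination Real.sin θ₀ * hcos + Real.cos θ₀ * hsin + P.z * h1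

theorem planar_proj (θ₀ : ℝ) (p : Cover) : planar θ₀ p.proj =
    (Real.sinh p.r : ℂ) * (Real.cos (p.θ - θ₀) + Real.sin (p.θ - θ₀) * Complex.I) := by
  apply Complex.ext
  · simp only [planar, proj, Real.cos_sub, Complex.mul_re, Complex.add_re, Complex.ofReal_re,
      Complex.I_re, Complex.ofReal_im, Complex.I_im, Complex.add_im, Complex.mul_im]
    ring
  · simp only [planar, proj, Real.sin_sub, Complex.mul_re, Complex.add_re, Complex.ofReal_re,
      Complex.I_re, Complex.ofReal_im, Complex.I_im, Complex.add_im, Complex.mul_im]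
    ring

theorem planar_re_pos {θ₀ : ℝ} {p : Cover} (h : |p.θ - θ₀| < Real.pi / 2) :
    0 < (planar θ₀ p.proj).re := by
  have e : (planar θ₀ p.proj).re = Real.sinh p.r * Real.cos (p.θ - θ₀) := by
    simp only [planar, proj, Real.cos_sub]; ring
  rw [e]
  exact mul_pos p.sinh_r_pos (Real.cos_pos_of_mem_Ioo (abs_lt.1 h))

theorem proj_sq_pos (p : Cover) : 0 < p.proj.y ^ 2 + p.proj.z ^ 2 := by
  have : p.proj.y ^ 2 + p.proj.z ^ 2 = Real.sinh p.r ^ 2 := by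
    simp only [proj]
    linear_combination Real.sinh p.r ^ 2 * Real.sin_sq_add_cos_sq p.θ
  rw [this]
  exact pow_pos p.sinh_r_pos 2

theorem sec_proj {θ₀ : ℝ} {p : Cover} (h : |p.θ - θ₀| < Real.pi) : sec θ₀ p.proj = p := by
  have hs : p.proj.y ^ 2 + p.proj.z ^ 2 = Real.sinh p.r ^ 2 := by
    simp only [proj]
    linear_combination Real.sinh p.r ^ 2 * Real.sin_sq_add_cos_sq p.θ
  ext
  · simp only [sec, if_neg p.proj_sq_pos.ne']
    rw [hs, Real.sqrt_sq p.sinh_r_pos.le, Real.arsinh_sinh]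
  · simp only [sec]
    rw [add_assoc, hs, add_comm, ← Real.cosh_sq, Real.sqrt_sq (Real.cosh_pos _).le]
    simp only [proj]
    rw [mul_div_cancel_left₀ _ (Real.cosh_pos _).ne', Real.arsinh_sinh]
  · simp only [sec]
    rw [planar_proj, Complex.ofReal_cos, Complex.ofReal_sin,
      Complex.arg_mul_cos_add_sin_mul_I p.sinh_r_pos ⟨(abs_lt.1 h).1, (abs_lt.1 h).2.le⟩]
    ring

theorem sq_pos_of_planar_re_pos {θ₀ : ℝ} {P : H3} (h : 0 < (planar θ₀ P).re) :
    0 < P.y ^ 2 + P.z ^ 2 := by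
  have : 0 < ‖planar θ₀ P‖ := norm_pos_iff.2 fun h0 => by simp [h0] at h
  rw [norm_planar] at this
  exact Real.sqrt_pos.1 this

theorem abs_sec_θ_sub_lt {θ₀ : ℝ} {P : H3} (h : 0 < (planar θ₀ P).re) :
    |(sec θ₀ P).θ - θ₀| < Real.pi / 2 := by
  simp only [sec, add_sub_cancel_left]
  exact Complex.abs_arg_lt_pi_div_two_iff.2 (Or.inl h)

/-- A geodesic between points whose angles differ by less than `π` lifts to the cover. -/
theorem exists_lift_geodesic {p q : Cover} (h : |p.θ - q.θ| < Real.pi) (hpq : p.proj ≠ q.proj) :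
    ∃ γ : ℝ → Cover, IsCurve γ 0 (dist p.proj q.proj) p q ∧
      ∀ s ∈ Icc 0 (dist p.proj q.proj), ∀ s' ∈ Icc 0 (dist p.proj q.proj),
        dist (γ s).proj (γ s').proj = |s - s'| ∧ |(γ s).θ - (γ s').θ| < Real.pi := by
  obtain ⟨G, A, B, hA, hB, G0, G1, Gc, Gd⟩ := H3.exists_geodesic hpq
  set d := dist p.proj q.proj
  -- About the mean angle both endpoints lie in the open half space `0 < (planar θ₀ ·).re`. A
  -- geodesic consists of nonnegative combinations of its endpoints, so it stays there, away from
  -- the axis and from the branch cut of `arg`.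
  obtain ⟨θ₀, hθ₀⟩ : ∃ θ₀, θ₀ = (p.θ + q.θ) / 2 := ⟨_, rfl⟩
  have hp : |p.θ - θ₀| < Real.pi / 2 := by
    rw [hθ₀]; rw [abs_lt] at h ⊢; constructor <;> linarith
  have hq : |q.θ - θ₀| < Real.pi / 2 := by
    rw [hθ₀]; rw [abs_lt] at h ⊢; constructor <;> linarith
  have hre : ∀ s ∈ Icc 0 d, 0 < (planar θ₀ (G s)).re := by
    intro s hs
    obtain ⟨ha, hb, hab, -, -, ey, ez⟩ := Gc s hs
    have h1 := planar_re_pos hp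
    have h2 := planar_re_pos hq
    simp only [planar] at h1 h2 ⊢
    rw [ey, ez]
    rcases ha.eq_or_lt with h' | h'
    · have hb' : 0 < B s := by linarith
      rw [← h']
      linarith [mul_pos hb' h2]
    · linarith [mul_pos h' h1, mul_nonneg hb h2.le]
  have hπ := Real.pi_pos
  have cx : ContinuousOn (fun s => (G s).x) (Icc 0 d) :=
    ((hA.mul continuous_const).add (hB.mul continuous_const)).continuousOn.congr
      fun s hs => (Gc s hs).2.2.2.2.1
  have cy : ContinuousOn (fun s => (G s).y) (Icc 0 d) :=
    ((hA.mul continuous_const).add (hB.mul continuous_const)).continuousOn.congr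
      fun s hs => (Gc s hs).2.2.2.2.2.1
  have cz : ContinuousOn (fun s => (G s).z) (Icc 0 d) :=
    ((hA.mul continuous_const).add (hB.mul continuous_const)).continuousOn.congr
      fun s hs => (Gc s hs).2.2.2.2.2.2
  refine ⟨fun s => sec θ₀ (G s), ⟨dist_nonneg, ?_, ?_, ?_, ?_, ?_⟩, ?_⟩
  · simp only [G0]; exact sec_proj (hp.trans (by linarith))
  · simp only [G1]; exact sec_proj (hq.trans (by linarith))
  · have : ContinuousOn (fun s => Real.arsinh (Real.sqrt ((G s).y ^ 2 + (G s).z ^ 2))) (Icc 0 d) :=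
      Real.continuous_arsinh.comp_continuousOn
        (Real.continuous_sqrt.comp_continuousOn ((cy.pow 2).add (cz.pow 2)))
    exact this.congr fun s hs => by
      simp only [sec, if_neg (sq_pos_of_planar_re_pos (hre s hs)).ne']
  · refine Real.continuous_arsinh.comp_continuousOn (cx.div
      (Real.continuous_sqrt.comp_continuousOn ((continuousOn_const.add (cy.pow 2)).add (cz.pow 2)))
      fun s _ => (Real.sqrt_pos.2 (by positivity)).ne')
  · refine continuousOn_const.add ?_
    intro s hs
    have h1 : ContinuousWithinAt (fun s => planar θ₀ (G s)) (Icc 0 d) s := by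
      have : (fun s => planar θ₀ (G s)) = fun s => Complex.equivRealProdCLM.symm
        ((G s).y * Real.cos θ₀ + (G s).z * Real.sin θ₀,
          (G s).z * Real.cos θ₀ - (G s).y * Real.sin θ₀) := by
        funext s
        apply Complex.ext <;> simp [planar]
      rw [this]
      refine Complex.equivRealProdCLM.symm.continuous.continuousAt.comp_continuousWithinAt ?_
      exact (((cy.mul continuousOn_const).add (cz.mul continuousOn_const)).prodMk
        ((cz.mul continuousOn_const).sub (cy.mul continuousOn_const))) s hs
    exact ContinuousAt.comp_continuousWithinAt (f := fun s => planar θ₀ (G s))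
      (Complex.continuousAt_arg (Or.inl (hre s hs))) h1
  · intro s hs s' hs'
    have h1 := abs_sec_θ_sub_lt (hre s hs)
    have h2 := abs_sec_θ_sub_lt (hre s' hs')
    refine ⟨?_, ?_⟩
    · rw [proj_sec _ (sq_pos_of_planar_re_pos (hre s hs)).ne',
        proj_sec _ (sq_pos_of_planar_re_pos (hre s' hs')).ne']
      exact Gd s hs s' hs'
    · rw [abs_lt] at h1 h2 ⊢
      constructor <;> linarith

theorem edist_le_of_lift {p q : Cover} {γ : ℝ → Cover} {d : ℝ} (h : IsCurve γ 0 d p q)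
    (hd : ∀ s ∈ Icc 0 d, ∀ s' ∈ Icc 0 d, dist (γ s).proj (γ s').proj = |s - s'|) :
    dist p q ≤ d := by
  have h1 : edist p q ≤ ENNReal.ofReal d := by
    refine (pathEDist_le h).trans ?_
    have hL : LipschitzOnWith 1 (fun s => (γ s).proj) (Icc 0 d) :=
      LipschitzOnWith.of_dist_le_mul fun s hs t ht => by
        rw [hd s hs t ht, Real.dist_eq]; simp
    have := hL.comp_eVariationOn_le (g := id) (s := Icc 0 d) (mapsTo_id _)
    simp only [ENNReal.coe_one, one_mul] at this
    have hm := (monotone_id.monotoneOn (Icc 0 d)).eVariationOn_eq (left_mem_Icc.2 h.le)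
      (right_mem_Icc.2 h.le)
    rw [inter_self, id, id, sub_zero] at hm
    rwa [hm] at this
  rw [edist_dist] at h1
  exact (ENNReal.ofReal_le_ofReal_iff h.le).1 h1

/-- The lifted geodesic gives the upper bound and folding gives the lower one. If the projections
coincide, the section at `p.θ` shows that `p = q`. -/
theorem dist_eq_of_abs_lt {p q : Cover} (h : |p.θ - q.θ| < Real.pi) :
    dist p q = dist p.proj q.proj := by
  refine le_antisymm ?_ ?_
  · by_cases hpq : p.proj = q.proj
    · have h1 := sec_proj (θ₀ := p.θ) (p := p) (by simpa using Real.pi_pos)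
      have h2 := sec_proj (θ₀ := p.θ) (p := q) (by rwa [abs_sub_comm])
      rw [← hpq, h1] at h2
      rw [h2, dist_self, dist_self]
    · obtain ⟨γ, hγ, h1⟩ := exists_lift_geodesic h hpq
      exact edist_le_of_lift hγ fun s hs s' hs' => (h1 s hs s' hs').1
  · rw [H3.dist_def, ← lor_eq_of_abs_le h.le]
    exact arcosh_lor_le_dist p q

theorem dist_proj_axisPoint_self (p : Cover) : dist p.proj (H3.axisPoint p.ζ) = p.r := by
  apply H3.dist_eq_of_lor_eq_cosh p.r_pos.le
  rw [lor_proj_axisPoint, sub_self, Real.cosh_zero, mul_one]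

/-- Rotating a point at distance `s` from the axis moves it by at most a multiple of `s`. -/
theorem exists_dist_rotate_le (ζ θ θ' : ℝ) : ∃ K : ℝ, 0 ≤ K ∧ ∀ (s : ℝ) (hs : 0 < s),
    dist (⟨s, ζ, θ, hs⟩ : Cover) ⟨s, ζ, θ', hs⟩ ≤ K * s := by
  obtain ⟨N, hN⟩ := exists_nat_gt |θ' - θ|
  have hN0 : (0 : ℝ) < N := lt_of_le_of_lt (abs_nonneg _) hN
  -- Each of the `N` rotations turns by less than `1 < π`, so its cost is a distance in `H3`, at
  -- most `2 * s` by comparison with the axis point.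
  refine ⟨2 * N, by positivity, fun s hs => ?_⟩
  let f : ℕ → Cover := fun i => ⟨s, ζ, θ + i * ((θ' - θ) / N), hs⟩
  have h0 : f 0 = ⟨s, ζ, θ, hs⟩ := by simp [f]
  have h1 : f N = ⟨s, ζ, θ', hs⟩ := by
    have : θ + N * ((θ' - θ) / N) = θ' := by field_simp; ring
    simp only [f, this]
  rw [← h0, ← h1]
  refine (dist_le_range_sum_dist f N).trans ?_
  have hstep : ∀ i ∈ Finset.range N, dist (f i) (f (i + 1)) ≤ 2 * s := by
    intro i _
    have hθ : |(f i).θ - (f (i + 1)).θ| < Real.pi := by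
      have e : (f i).θ - (f (i + 1)).θ = -((θ' - θ) / N) := by
        simp only [f]; push_cast; ring
      rw [e, abs_neg, abs_div, abs_of_pos hN0]
      have : |θ' - θ| / N < 1 := (div_lt_one hN0).2 hN
      linarith [Real.pi_gt_three]
    rw [dist_eq_of_abs_lt hθ]
    have a1 := dist_proj_axisPoint_self (f i)
    have a2 := dist_proj_axisPoint_self (f (i + 1))
    have a3 := dist_triangle_right (f i).proj (f (i + 1)).proj (H3.axisPoint ζ)
    simp only [f] at a1 a2 a3 ⊢
    linarith
  refine (Finset.sum_le_sum hstep).trans (le_of_eq ?_)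
  rw [Finset.sum_const, Finset.card_range, nsmul_eq_mul]; ring

/-- A path may always pass through the axis. -/
theorem dist_le_add_axisPoint (p q : Cover) (ζ : ℝ) :
    dist p q ≤ dist p.proj (H3.axisPoint ζ) + dist q.proj (H3.axisPoint ζ) := by
  obtain ⟨K, hK, h⟩ := exists_dist_rotate_le ζ p.θ q.θ
  refine le_of_forall_pos_le_add fun η hη => ?_
  -- Going round the axis at radius `s` costs `K * s` for the turn and at most `s` more on each leg,
  -- hence an excess of `(K + 2) * s = η`.
  have hs : 0 < η / (K + 2) := by positivity
  set s := η / (K + 2) with hs'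
  have hKs : (K + 2) * s = η := by rw [hs']; field_simp
  let a : Cover := ⟨s, ζ, p.θ, hs⟩
  let b : Cover := ⟨s, ζ, q.θ, hs⟩
  have h1 : dist p a = dist p.proj a.proj := dist_eq_of_abs_lt (by simpa [a] using Real.pi_pos)
  have h2 : dist b q = dist b.proj q.proj := dist_eq_of_abs_lt (by simpa [b] using Real.pi_pos)
  have h3 : dist a b ≤ K * s := h s hs
  have a1 : dist a.proj (H3.axisPoint ζ) = s := dist_proj_axisPoint_self a
  have a2 : dist b.proj (H3.axisPoint ζ) = s := dist_proj_axisPoint_self b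
  have t1 := dist_triangle4 p a b q
  have t2 := dist_triangle_right p.proj a.proj (H3.axisPoint ζ)
  have t3 := dist_triangle_right b.proj q.proj (H3.axisPoint ζ)
  linarith

/-- Turn the two points into a common plane through the axis, on opposite sides. Their geodesic
crosses the axis by the intermediate value theorem, distances to axis points ignore the angle, and
`dist_le_add_axisPoint` applies at the crossing. -/
theorem cosh_dist_le (p q : Cover) : Real.cosh (dist p q) ≤
    Real.cosh p.r * Real.cosh q.r * Real.cosh (p.ζ - q.ζ) + Real.sinh p.r * Real.sinh q.r := by
  let p' : Cover := ⟨p.r, p.ζ, 0, p.r_pos⟩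
  let q' : Cover := ⟨q.r, q.ζ, Real.pi, q.r_pos⟩
  have hl : H3.lor p'.proj q'.proj = Real.cosh p.r * Real.cosh q.r * Real.cosh (p.ζ - q.ζ) +
      Real.sinh p.r * Real.sinh q.r := by
    rw [lor_proj]; simp [p', q']
  have hpy : p'.proj.y = Real.sinh p.r := by simp [proj, p']
  have hqy : q'.proj.y = -Real.sinh q.r := by simp [proj, q']
  have hpz : p'.proj.z = 0 := by simp [proj, p']
  have hqz : q'.proj.z = 0 := by simp [proj, q']
  have hne : p'.proj ≠ q'.proj := by
    intro h
    rw [h, hqy] at hpy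
    linarith [p.sinh_r_pos, q.sinh_r_pos]
  obtain ⟨G, A, B, hA, hB, G0, G1, Gc, Gd⟩ := H3.exists_geodesic hne
  set d := dist p'.proj q'.proj with hd
  have hd0 : 0 ≤ d := dist_nonneg
  have cy : ContinuousOn (fun s => (G s).y) (Icc 0 d) :=
    ((hA.mul continuous_const).add (hB.mul continuous_const)).continuousOn.congr
      fun s hs => (Gc s hs).2.2.2.2.2.1
  obtain ⟨s, hs, hsy⟩ : (0 : ℝ) ∈ (fun s => (G s).y) '' Icc 0 d := by
    apply intermediate_value_Icc' hd0 cy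
    simp only [G0, G1, hpy, hqy]
    exact ⟨by linarith [q.sinh_r_pos], p.sinh_r_pos.le⟩
  have hsz : (G s).z = 0 := by rw [(Gc s hs).2.2.2.2.2.2, hpz, hqz]; ring
  obtain ⟨ζ₀, hO⟩ : ∃ ζ₀, G s = H3.axisPoint ζ₀ := by
    refine ⟨Real.arsinh (G s).x, ?_⟩
    have hn := (G s).norm_eq
    rw [show (G s).y = 0 from hsy, hsz] at hn
    ext
    · simp only [H3.axisPoint]
      refine (pow_left_inj₀ (G s).t_pos.le (Real.cosh_pos _).le two_ne_zero).1 ?_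
      rw [Real.cosh_sq, Real.sinh_arsinh]; linarith
    · simp [H3.axisPoint]
    · exact hsy
    · exact hsz
  have e1 : dist p.proj (G s) = s := by
    have h1 := Gd 0 ⟨le_rfl, hd0⟩ s hs
    rw [G0, zero_sub, abs_neg, abs_of_nonneg hs.1] at h1
    rw [hO] at h1 ⊢
    rw [← h1, H3.dist_def, H3.dist_def, lor_proj_axisPoint, lor_proj_axisPoint]
  have e2 : dist q.proj (G s) = d - s := by
    have h1 := Gd d ⟨hd0, le_rfl⟩ s hs
    rw [G1, abs_of_nonneg (by linarith [hs.2])] at h1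
    rw [hO] at h1 ⊢
    rw [← h1, H3.dist_def, H3.dist_def, lor_proj_axisPoint, lor_proj_axisPoint]
  have key := dist_le_add_axisPoint p q ζ₀
  rw [← hO, e1, e2] at key
  have : dist p q ≤ d := by linarith
  rw [← hl, ← H3.cosh_dist, Real.cosh_le_cosh, abs_of_nonneg dist_nonneg,
    abs_of_nonneg dist_nonneg]
  exact this

/-- The path metric of the cover. -/
theorem cosh_dist (p q : Cover) : Real.cosh (dist p q) = lor p q := by
  rcases lt_or_ge |p.θ - q.θ| Real.pi with h | h
  · rw [dist_eq_of_abs_lt h, H3.cosh_dist, lor_eq_of_abs_le h.le]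
  · refine le_antisymm ?_ ?_
    · have := cosh_dist_le p q
      rw [lor, angCos_eq_neg_one h]
      linarith
    · have h1 := arcosh_lor_le_dist p q
      rw [← Real.cosh_arcosh (one_le_lor p q), Real.cosh_le_cosh, abs_of_nonneg dist_nonneg,
        abs_of_nonneg (Real.arcosh_nonneg (one_le_lor p q))]
      exact h1

end Cover

/-! ### Radius, height and angle are controlled by the distance. -/

theorem cosh_sub_le_of_one_le {a b c : ℝ} (hc : 1 ≤ c) :
    Real.cosh (a - b) ≤ Real.cosh a * Real.cosh b * c - Real.sinh a * Real.sinh b := by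
  rw [Real.cosh_sub]
  have := mul_le_mul_of_nonneg_left hc (mul_pos (Real.cosh_pos a) (Real.cosh_pos b)).le
  linarith

theorem le_cosh_mul_sub {a b c : ℝ} (hc : 1 ≤ c) :
    c ≤ Real.cosh a * Real.cosh b * c - Real.sinh a * Real.sinh b := by
  have h1 := Real.one_le_cosh (a - b)
  rw [Real.cosh_sub] at h1
  have h2 : 1 ≤ Real.cosh a * Real.cosh b :=
    one_le_mul_of_one_le_of_one_le (Real.one_le_cosh a) (Real.one_le_cosh b)
  nlinarith

namespace Cover

theorem lor_ge (p q : Cover) : Real.cosh p.r * Real.cosh q.r * Real.cosh (p.ζ - q.ζ) -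
    Real.sinh p.r * Real.sinh q.r ≤ lor p q := by
  have := mul_le_mul_of_nonneg_left (angCos_le_one (p.θ - q.θ))
    (mul_pos p.sinh_r_pos q.sinh_r_pos).le
  rw [lor]; linarith

theorem abs_r_sub_le (p q : Cover) : |p.r - q.r| ≤ dist p q := by
  rw [← abs_of_nonneg (dist_nonneg (x := p) (y := q)), ← Real.cosh_le_cosh, cosh_dist]
  exact (cosh_sub_le_of_one_le (Real.one_le_cosh _)).trans (lor_ge p q)

theorem abs_ζ_sub_le (p q : Cover) : |p.ζ - q.ζ| ≤ dist p q := by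
  rw [← abs_of_nonneg (dist_nonneg (x := p) (y := q)), ← Real.cosh_le_cosh, cosh_dist]
  exact (le_cosh_mul_sub (Real.one_le_cosh _)).trans (lor_ge p q)

theorem lipschitzWith_r : LipschitzWith 1 r :=
  LipschitzWith.of_dist_le_mul fun p q => by simpa [Real.dist_eq] using abs_r_sub_le p q

theorem lipschitzWith_ζ : LipschitzWith 1 ζ :=
  LipschitzWith.of_dist_le_mul fun p q => by simpa [Real.dist_eq] using abs_ζ_sub_le p q

theorem eq_of_dist_eq_zero {p q : Cover} (h : dist p q = 0) : p = q := by
  have hr : p.r = q.r := by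
    have := abs_r_sub_le p q
    rw [h] at this
    exact sub_eq_zero.1 (abs_eq_zero.1 (le_antisymm this (abs_nonneg _)))
  have hζ : p.ζ = q.ζ := by
    have := abs_ζ_sub_le p q
    rw [h] at this
    exact sub_eq_zero.1 (abs_eq_zero.1 (le_antisymm this (abs_nonneg _)))
  have hl := cosh_dist p q
  rw [h, lor, hζ, hr, sub_self, Real.cosh_zero] at hl
  have h1 := Real.cosh_sq q.r
  have h2 : Real.sinh q.r ^ 2 * (1 - angCos (p.θ - q.θ)) = 0 := by linarith
  have h3 : angCos (p.θ - q.θ) = 1 := by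
    rcases mul_eq_zero.1 h2 with h | h
    · exact absurd h (pow_pos q.sinh_r_pos 2).ne'
    · linarith
  refine Cover.ext hr hζ ?_
  by_contra hne
  exact (angCos_lt_one (sub_ne_zero.2 hne)).ne h3

/-- From `cos x ≤ 1 - 2 x² / π²` on `[-π, π]`. At radius at least `m`, a small distance thus forces
a small angle difference, so Cauchy sequences that stay off the axis have Cauchy angles. -/
theorem abs_sq_angle_le {p q : Cover} {m : ℝ} (hm : 0 < m) (hp : m ≤ p.r) (hq : m ≤ q.r) :
    2 / Real.pi ^ 2 * (min |p.θ - q.θ| Real.pi) ^ 2 ≤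
      (Real.cosh (dist p q) - 1) / Real.sinh m ^ 2 := by
  have hs : 0 < Real.sinh m := Real.sinh_pos_iff.2 hm
  have h1 := Real.sinh_le_sinh.2 hp
  have h2 := Real.sinh_le_sinh.2 hq
  have hx : |min |p.θ - q.θ| Real.pi| ≤ Real.pi := by
    rw [abs_of_nonneg (le_min (abs_nonneg _) Real.pi_pos.le)]
    exact min_le_right _ _
  have h3 := Real.cos_le_one_sub_mul_cos_sq hx
  rw [le_div_iff₀ (by positivity), cosh_dist, lor]
  change angCos (p.θ - q.θ) ≤ _ at h3
  have h4 := cosh_sub_le_of_one_le (a := p.r) (b := q.r) (Real.one_le_cosh (p.ζ - q.ζ))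
  have h5 := Real.one_le_cosh (p.r - q.r)
  have h6 : Real.sinh m ^ 2 ≤ Real.sinh p.r * Real.sinh q.r := by
    rw [sq]; exact mul_le_mul h1 h2 hs.le (hs.le.trans h1)
  have h7 : 0 ≤ 2 / Real.pi ^ 2 * (min |p.θ - q.θ| Real.pi) ^ 2 := by positivity
  nlinarith [mul_le_mul_of_nonneg_left h6 h7, mul_nonneg (mul_pos p.sinh_r_pos q.sinh_r_pos).le
    (sub_nonneg.2 h3)]

end Cover

/-! ### Cylindrical coordinates and distance on the completion. -/

namespace HHat

open UniformSpace Filter Topology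

/-- The distance to the singular axis. -/
def rad : HHat → ℝ := Completion.extension Cover.r

/-- The position of the projection to the singular axis. -/
def height : HHat → ℝ := Completion.extension Cover.ζ

/-- The angle about the singular axis (with value `0` on the axis). -/
def angle (ξ : HHat) : ℝ := by
  classical
  exact if h : ∃ p : Cover, (p : HHat) = ξ then h.choose.θ else 0

theorem continuous_rad : Continuous rad := Completion.continuous_extension

theorem continuous_height : Continuous height := Completion.continuous_extension

theorem rad_coe (p : Cover) : rad p = p.r :=
  Completion.extension_coe Cover.lipschitzWith_r.uniformContinuous p

theorem height_coe (p : Cover) : height p = p.ζ :=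
  Completion.extension_coe Cover.lipschitzWith_ζ.uniformContinuous p

theorem coe_injective : Function.Injective ((↑) : Cover → HHat) := fun p q h =>
  Cover.eq_of_dist_eq_zero (by rw [← Completion.dist_eq, h, dist_self])

theorem angle_coe (p : Cover) : angle p = p.θ := by
  have h : ∃ q : Cover, (q : HHat) = p := ⟨p, rfl⟩
  rw [angle, dif_pos h, coe_injective h.choose_spec]

theorem rad_nonneg (ξ : HHat) : 0 ≤ rad ξ := by
  induction ξ using Completion.induction_on with
  | hp => exact isClosed_le continuous_const continuous_rad
  | ih p => rw [rad_coe]; exact p.r_pos.le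

/-- The form of the distance formula that passes to limits: the angle has no continuous extension to
the axis, but its contribution is bounded by a product that vanishes there. -/
theorem cosh_dist_bounds (ξ η : HHat) :
    |Real.cosh (dist ξ η) - Real.cosh (rad ξ) * Real.cosh (rad η) *
      Real.cosh (height ξ - height η)| ≤ Real.sinh (rad ξ) * Real.sinh (rad η) := by
  induction ξ, η using Completion.induction_on₂ with
  | hp =>
    have h1 := continuous_rad
    have h2 := continuous_height
    have h3 := Real.continuous_cosh
    have h4 := Real.continuous_sinh
    apply isClosed_le <;> fun_prop
  | ih p q =>
    rw [rad_coe, rad_coe, height_coe, height_coe, Completion.dist_eq, Cover.cosh_dist, abs_le,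
      Cover.lor]
    have h := mul_pos p.sinh_r_pos q.sinh_r_pos
    constructor
    · nlinarith [angCos_le_one (p.θ - q.θ)]
    · nlinarith [neg_one_le_angCos (p.θ - q.θ)]

/-- Approximate `ξ` from the cover. The radii are eventually at least `rad ξ / 2`, so the angles
form a Cauchy sequence by `Cover.abs_sq_angle_le`. The limits of the three coordinates define a
point of the cover, and continuity of `Cover.lor` identifies it with `ξ`. -/
theorem exists_coe_of_rad_pos {ξ : HHat} (h : 0 < rad ξ) : ∃ p : Cover, (p : HHat) = ξ := by
  have hseq : ∀ n : ℕ, ∃ p : Cover, dist (p : HHat) ξ < 1 / ((n : ℝ) + 1) := fun n => by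
    obtain ⟨p, hp⟩ := Metric.denseRange_iff.1 (Completion.denseRange_coe (α := Cover)) ξ
      (1 / ((n : ℝ) + 1)) (by positivity)
    exact ⟨p, by rwa [dist_comm]⟩
  choose p hp using hseq
  have hlim : Tendsto (fun n => (p n : HHat)) atTop (𝓝 ξ) := by
    rw [tendsto_iff_dist_tendsto_zero]
    exact squeeze_zero (fun _ => dist_nonneg) (fun n => (hp n).le)
      tendsto_one_div_add_atTop_nhds_zero_nat
  have hr : Tendsto (fun n => (p n).r) atTop (𝓝 (rad ξ)) := by
    simpa only [Function.comp_def, rad_coe] using (continuous_rad.tendsto ξ).comp hlim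
  have hζ : Tendsto (fun n => (p n).ζ) atTop (𝓝 (height ξ)) := by
    simpa only [Function.comp_def, height_coe] using (continuous_height.tendsto ξ).comp hlim
  have hcau : CauchySeq p := by
    have := hlim.cauchySeq
    rw [Metric.cauchySeq_iff] at this ⊢
    simpa only [Completion.dist_eq] using this
  obtain ⟨M, hM⟩ : ∃ M, ∀ n ≥ M, rad ξ / 2 ≤ (p n).r :=
    eventually_atTop.1 (hr.eventually (eventually_ge_nhds (by linarith)))
  have hm : 0 < rad ξ / 2 := by linarith
  have hs : 0 < Real.sinh (rad ξ / 2) := Real.sinh_pos_iff.2 hm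
  have hθc : CauchySeq fun n => (p n).θ := by
    rw [Metric.cauchySeq_iff] at hcau ⊢
    intro ε hε
    set k := min ε Real.pi with hk
    have hk0 : 0 < k := lt_min hε Real.pi_pos
    have hK : 0 < 2 / Real.pi ^ 2 * k ^ 2 * Real.sinh (rad ξ / 2) ^ 2 := by
      have := Real.pi_pos
      positivity
    obtain ⟨N, hN⟩ := hcau (Real.arcosh (1 + 2 / Real.pi ^ 2 * k ^ 2 * Real.sinh (rad ξ / 2) ^ 2))
      (Real.arcosh_pos (by linarith))
    refine ⟨max M N, fun m hmm n hnn => ?_⟩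
    have hd := hN m ((le_max_right _ _).trans hmm) n ((le_max_right _ _).trans hnn)
    have hb := Cover.abs_sq_angle_le hm (hM m ((le_max_left _ _).trans hmm))
      (hM n ((le_max_left _ _).trans hnn))
    have hc : Real.cosh (dist (p m) (p n)) - 1 <
        2 / Real.pi ^ 2 * k ^ 2 * Real.sinh (rad ξ / 2) ^ 2 := by
      have := Real.cosh_lt_cosh.2 (show |dist (p m) (p n)| < 
          |Real.arcosh (1 + 2 / Real.pi ^ 2 * k ^ 2 * Real.sinh (rad ξ / 2) ^ 2)| by
        rw [abs_of_nonneg dist_nonneg, abs_of_nonneg (Real.arcosh_nonneg (by linarith))]; exact hd)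
      rw [Real.cosh_arcosh (by linarith)] at this
      linarith
    have hlt : 2 / Real.pi ^ 2 * (min |(p m).θ - (p n).θ| Real.pi) ^ 2 < 2 / Real.pi ^ 2 * k ^ 2 :=
      hb.trans_lt ((div_lt_iff₀ (by positivity)).2 hc)
    have hlt2 := lt_of_mul_lt_mul_left hlt (by positivity)
    have hlt3 := lt_of_pow_lt_pow_left₀ 2 hk0.le hlt2
    rw [Real.dist_eq]
    rcases min_lt_iff.1 hlt3 with h' | h'
    · exact h'.trans_le (min_le_left _ _)
    · exact absurd h' (not_lt.2 (min_le_right _ _))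
  obtain ⟨θ, hθ⟩ := cauchySeq_tendsto_of_complete hθc
  let q : Cover := ⟨rad ξ, height ξ, θ, h⟩
  refine ⟨q, tendsto_nhds_unique ?_ hlim⟩
  rw [tendsto_iff_dist_tendsto_zero]
  have hl : Tendsto (fun n => Cover.lor (p n) q) atTop (𝓝 (Cover.lor q q)) := by
    unfold Cover.lor
    exact (((Real.continuous_cosh.tendsto _).comp hr |>.mul_const _).mul
      ((Real.continuous_cosh.tendsto _).comp (hζ.sub_const _))).sub
      (((Real.continuous_sinh.tendsto _).comp hr |>.mul_const _).mul
      ((continuous_angCos.tendsto _).comp (hθ.sub_const _)))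
  have hqq : Cover.lor q q = 1 := by rw [← Cover.cosh_dist, dist_self, Real.cosh_zero]
  rw [hqq] at hl
  have h1 : Tendsto (fun n => Real.arcosh (Cover.lor (p n) q)) atTop (𝓝 (Real.arcosh 1)) := by
    have := (Real.continuousOn_arcosh 1 (by simp)).tendsto
    exact this.comp (tendsto_nhdsWithin_iff.2
      ⟨hl, Eventually.of_forall fun n => Cover.one_le_lor _ _⟩)
  rw [Real.arcosh_zero] at h1
  refine h1.congr fun n => ?_
  rw [← Cover.cosh_dist, Real.arcosh_cosh dist_nonneg, Completion.dist_eq]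

theorem mem_axis_iff {ξ : HHat} : ξ ∈ axis ↔ rad ξ = 0 := by
  constructor
  · intro h
    by_contra h0
    exact h (exists_coe_of_rad_pos (lt_of_le_of_ne (rad_nonneg ξ) (Ne.symm h0)))
  · rintro h ⟨p, rfl⟩
    rw [rad_coe] at h
    exact p.r_pos.ne' h

/-- The metric of the branched cover. -/
theorem cosh_dist (ξ η : HHat) : Real.cosh (dist ξ η) =
    Real.cosh (rad ξ) * Real.cosh (rad η) * Real.cosh (height ξ - height η) -
      Real.sinh (rad ξ) * Real.sinh (rad η) * angCos (angle ξ - angle η) := by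
  by_cases h : 0 < rad ξ ∧ 0 < rad η
  · obtain ⟨p, rfl⟩ := exists_coe_of_rad_pos h.1
    obtain ⟨q, rfl⟩ := exists_coe_of_rad_pos h.2
    simp only [rad_coe, height_coe, angle_coe, Completion.dist_eq, Cover.cosh_dist, Cover.lor]
  · have h0 : Real.sinh (rad ξ) * Real.sinh (rad η) = 0 := by
      rw [not_and_or, not_lt, not_lt] at h
      rcases h with h | h
      · rw [le_antisymm h (rad_nonneg ξ), Real.sinh_zero, zero_mul]
      · rw [le_antisymm h (rad_nonneg η), Real.sinh_zero, mul_zero]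
    have hb := cosh_dist_bounds ξ η
    rw [h0] at hb ⊢
    have := abs_eq_zero.1 (le_antisymm hb (abs_nonneg _))
    linarith

theorem eq_of_coords {ξ η : HHat} (hr : rad ξ = rad η) (hζ : height ξ = height η)
    (hθ : 0 < rad ξ → angle ξ = angle η) : ξ = η := by
  have h := cosh_dist ξ η
  rw [← dist_eq_zero]
  rw [← hr, ← hζ, sub_self, Real.cosh_zero] at h
  have h1 : Real.sinh (rad ξ) * Real.sinh (rad ξ) * angCos (angle ξ - angle η) =
      Real.sinh (rad ξ) * Real.sinh (rad ξ) := by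
    rcases (rad_nonneg ξ).eq_or_lt with h0 | h0
    · rw [← h0]; simp
    · rw [hθ h0, sub_self, angCos_zero, mul_one]
  have h2 := Real.cosh_sq (rad ξ)
  have h3 : Real.cosh (dist ξ η) = 1 := by rw [h, h1]; linarith
  by_contra hne
  exact (Real.one_lt_cosh.2 hne).ne' h3

/-- Points that approach the axis radially are no farther apart than their radii, hence form a
Cauchy sequence. -/
theorem exists_axis_point (ζ : ℝ) : ∃ ξ : HHat, rad ξ = 0 ∧ height ξ = ζ := by
  let a : ℕ → Cover := fun n => ⟨1 / ((n : ℝ) + 1), ζ, 0, by positivity⟩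
  have hd : ∀ m n, dist (a m) (a n) ≤ |(a m).r - (a n).r| := fun m n => by
    have : Cover.lor (a m) (a n) = Real.cosh ((a m).r - (a n).r) := by
      rw [Cover.lor, Real.cosh_sub (a m).r]
      simp only [a, sub_self, Real.cosh_zero, angCos_zero, mul_one]
    rw [← abs_of_nonneg (dist_nonneg (x := a m) (y := a n)), ← Real.cosh_le_cosh, Cover.cosh_dist,
      this]
  have hr : Tendsto (fun n => (a n).r) atTop (𝓝 0) := tendsto_one_div_add_atTop_nhds_zero_nat
  have hc : CauchySeq fun n => (a n : HHat) := by
    have := hr.cauchySeq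
    rw [Metric.cauchySeq_iff] at this ⊢
    intro ε hε
    obtain ⟨N, hN⟩ := this ε hε
    refine ⟨N, fun m hm n hn => ?_⟩
    rw [Completion.dist_eq]
    exact (hd m n).trans_lt (hN m hm n hn)
  obtain ⟨ξ, hξ⟩ := cauchySeq_tendsto_of_complete hc
  refine ⟨ξ, ?_, ?_⟩
  · refine tendsto_nhds_unique ((continuous_rad.tendsto ξ).comp hξ) ?_
    simpa only [Function.comp_def, rad_coe] using hr
  · refine tendsto_nhds_unique ((continuous_height.tendsto ξ).comp hξ) ?_
    simp only [Function.comp_def, height_coe]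
    exact tendsto_const_nhds

theorem exists_coords {r : ℝ} (hr : 0 ≤ r) (ζ θ : ℝ) :
    ∃ ξ : HHat, rad ξ = r ∧ height ξ = ζ ∧ (0 < r → angle ξ = θ) := by
  rcases hr.eq_or_lt with h | h
  · obtain ⟨ξ, h1, h2⟩ := exists_axis_point ζ
    exact ⟨ξ, h1.trans h, h2, fun h' => absurd h' (by rw [← h]; exact lt_irrefl _)⟩
  · exact ⟨((⟨r, ζ, θ, h⟩ : Cover) : HHat), rad_coe _, height_coe _, fun _ => angle_coe _⟩

/-- The point of the branched cover with the given cylindrical coordinates. -/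
def ofCoords (r ζ θ : ℝ) : HHat := (exists_coords (le_max_right r 0) ζ θ).choose

theorem rad_ofCoords {r : ℝ} (hr : 0 ≤ r) (ζ θ : ℝ) : rad (ofCoords r ζ θ) = r :=
  ((exists_coords (le_max_right r 0) ζ θ).choose_spec.1).trans (max_eq_left hr)

theorem height_ofCoords (r ζ θ : ℝ) : height (ofCoords r ζ θ) = ζ :=
  (exists_coords (le_max_right r 0) ζ θ).choose_spec.2.1

theorem angle_ofCoords {r : ℝ} (hr : 0 < r) (ζ θ : ℝ) : angle (ofCoords r ζ θ) = θ :=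
  (exists_coords (le_max_right r 0) ζ θ).choose_spec.2.2 (lt_max_of_lt_left hr)

theorem abs_rad_sub_le (ξ η : HHat) : |rad ξ - rad η| ≤ dist ξ η := by
  induction ξ, η using Completion.induction_on₂ with
  | hp =>
    have h1 := continuous_rad
    apply isClosed_le <;> fun_prop
  | ih p q =>
    rw [rad_coe, rad_coe, Completion.dist_eq]
    exact Cover.abs_r_sub_le p q

theorem abs_height_sub_le (ξ η : HHat) : |height ξ - height η| ≤ dist ξ η := by
  induction ξ, η using Completion.induction_on₂ with
  | hp =>
    have h1 := continuous_height
    apply isClosed_le <;> fun_prop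
  | ih p q =>
    rw [height_coe, height_coe, Completion.dist_eq]
    exact Cover.abs_ζ_sub_le p q

/-! ### The action of `ℂ` -/

theorem rad_vadd (w : ℂ) (ξ : HHat) : rad (w +ᵥ ξ) = rad ξ := by
  induction ξ using Completion.induction_on with
  | hp =>
    exact isClosed_eq (continuous_rad.comp (continuous_const_vadd w)) continuous_rad
  | ih p => rw [← Completion.coe_vadd, rad_coe, rad_coe]; rfl

theorem height_vadd (w : ℂ) (ξ : HHat) : height (w +ᵥ ξ) = height ξ + w.re := by
  induction ξ using Completion.induction_on with
  | hp =>
    exact isClosed_eq (continuous_height.comp (continuous_const_vadd w))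
      (continuous_height.add continuous_const)
  | ih p => rw [← Completion.coe_vadd, height_coe, height_coe]; rfl

theorem angle_vadd (w : ℂ) {ξ : HHat} (h : 0 < rad ξ) : angle (w +ᵥ ξ) = angle ξ + w.im := by
  obtain ⟨p, rfl⟩ := exists_coe_of_rad_pos h
  rw [← Completion.coe_vadd, angle_coe, angle_coe]; rfl

theorem dist_vadd (w : ℂ) (ξ η : HHat) : dist (w +ᵥ ξ) (w +ᵥ η) = dist ξ η := by
  induction ξ, η using Completion.induction_on₂ with
  | hp =>
    exact isClosed_eq (((continuous_const_vadd w).comp continuous_fst).dist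
      ((continuous_const_vadd w).comp continuous_snd)) (continuous_fst.dist continuous_snd)
  | ih p q =>
    rw [← Completion.coe_vadd, ← Completion.coe_vadd, Completion.dist_eq, Completion.dist_eq]
    exact (isometry_vadd Cover w).dist_eq p q

/-- The displacement of `w` is affine in `sinh²` of the radius. The whole comparison of tubes rests
on this shape. -/
theorem cosh_dist_vadd_self (w : ℂ) (ξ : HHat) : Real.cosh (dist ξ (w +ᵥ ξ)) =
    Real.cosh w.re + Real.sinh (rad ξ) ^ 2 * (Real.cosh w.re - angCos w.im) := by
  rw [cosh_dist, rad_vadd, height_vadd]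
  have h1 : Real.sinh (rad ξ) * Real.sinh (rad ξ) * angCos (angle ξ - angle (w +ᵥ ξ)) =
      Real.sinh (rad ξ) ^ 2 * angCos w.im := by
    rcases (rad_nonneg ξ).eq_or_lt with h | h
    · rw [← h]; simp
    · rw [angle_vadd w h, angCos, angCos]; rw [sub_add_cancel_left, abs_neg]; ring
  rw [h1, sub_add_cancel_left, Real.cosh_neg]
  have := Real.cosh_sq (rad ξ)
  linear_combination Real.cosh w.re * this

end HHat

namespace HHat

/-! ### The projection to hyperbolic space -/

/-- The extension of the covering projection to the branched cover. -/
def pr (ξ : HHat) : H3 where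
  t := Real.cosh (rad ξ) * Real.cosh (height ξ)
  x := Real.cosh (rad ξ) * Real.sinh (height ξ)
  y := Real.sinh (rad ξ) * Real.cos (angle ξ)
  z := Real.sinh (rad ξ) * Real.sin (angle ξ)
  norm_eq := by
    have h1 := Real.cosh_sq (rad ξ)
    have h2 := Real.cosh_sq (height ξ)
    have h3 := Real.sin_sq_add_cos_sq (angle ξ)
    linear_combination (Real.cosh (rad ξ)) ^ 2 * h2 + h1 - Real.sinh (rad ξ) ^ 2 * h3
  t_pos := mul_pos (Real.cosh_pos _) (Real.cosh_pos _)

theorem pr_coe (p : Cover) : pr p = p.proj := by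
  ext <;> simp only [pr, Cover.proj, rad_coe, height_coe, angle_coe]

theorem lor_pr (ξ η : HHat) : H3.lor (pr ξ) (pr η) = Real.cosh (rad ξ) * Real.cosh (rad η) *
      Real.cosh (height ξ - height η) -
        Real.sinh (rad ξ) * Real.sinh (rad η) * Real.cos (angle ξ - angle η) := by
  simp only [H3.lor, pr, Real.cosh_sub, Real.cos_sub]; ring

theorem sinh_rad_nonneg (ξ : HHat) : 0 ≤ Real.sinh (rad ξ) := Real.sinh_nonneg_iff.2 (rad_nonneg ξ)

theorem dist_pr_le (ξ η : HHat) : dist (pr ξ) (pr η) ≤ dist ξ η := by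
  rw [← H3.lor_le_cosh_iff _ _ dist_nonneg, lor_pr, cosh_dist]
  have := mul_le_mul_of_nonneg_left (angCos_le_cos (angle ξ - angle η))
    (mul_nonneg (sinh_rad_nonneg ξ) (sinh_rad_nonneg η))
  linarith

theorem dist_eq_dist_pr {ξ η : HHat} (h : |angle ξ - angle η| ≤ Real.pi) :
    dist ξ η = dist (pr ξ) (pr η) := by
  symm
  apply H3.dist_eq_of_lor_eq_cosh dist_nonneg
  rw [lor_pr, cosh_dist, angCos_eq_cos h]

theorem dist_pr_vadd (w : ℂ) (ξ η : HHat) :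
    dist (pr (w +ᵥ ξ)) (pr (w +ᵥ η)) = dist (pr ξ) (pr η) := by
  rw [H3.dist_def, H3.dist_def, lor_pr, lor_pr, rad_vadd, rad_vadd, height_vadd, height_vadd,
    add_sub_add_right_eq_sub]
  congr 2
  rcases (rad_nonneg ξ).eq_or_lt with h | h
  · rw [← h]; simp
  rcases (rad_nonneg η).eq_or_lt with h' | h'
  · rw [← h']; simp
  rw [angle_vadd w h, angle_vadd w h', add_sub_add_right_eq_sub]

theorem sinh_rad_sq (ξ : HHat) : (pr ξ).y ^ 2 + (pr ξ).z ^ 2 = Real.sinh (rad ξ) ^ 2 := by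
  simp only [pr]
  linear_combination Real.sinh (rad ξ) ^ 2 * Real.sin_sq_add_cos_sq (angle ξ)

theorem rad_eq_of_pr_eq {ξ η : HHat} (h : pr ξ = pr η) : rad ξ = rad η := by
  have h1 := sinh_rad_sq ξ
  rw [h, sinh_rad_sq] at h1
  exact Real.sinh_injective
    ((pow_left_inj₀ (sinh_rad_nonneg ξ) (sinh_rad_nonneg η) two_ne_zero).1 h1.symm)

theorem height_eq_of_pr_eq {ξ η : HHat} (h : pr ξ = pr η) : height ξ = height η := by
  have h1 := congrArg H3.x h
  simp only [pr] at h1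
  rw [rad_eq_of_pr_eq h] at h1
  exact Real.sinh_injective (mul_left_cancel₀ (Real.cosh_pos _).ne' h1)

/-- Two points with the same projection differ by a number of full turns. -/
theorem exists_turns_of_pr_eq {ξ η : HHat} (h : pr ξ = pr η) :
    ∃ n : ℤ, ξ = (⟨0, n * (2 * Real.pi)⟩ : ℂ) +ᵥ η := by
  have hr := rad_eq_of_pr_eq h
  rcases (rad_nonneg η).eq_or_lt with h0 | h0
  · refine ⟨0, eq_of_coords ?_ ?_ ?_⟩
    · rw [rad_vadd, hr]
    · rw [height_vadd, height_eq_of_pr_eq h]; simp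
    · intro h1; rw [hr, ← h0] at h1; exact absurd h1 (lt_irrefl _)
  · have hs : Real.sinh (rad η) ≠ 0 := (Real.sinh_pos_iff.2 h0).ne'
    have hc : Real.cos (angle ξ) = Real.cos (angle η) := by
      have := congrArg H3.y h
      simp only [pr] at this
      rw [hr] at this
      exact mul_left_cancel₀ hs this
    have hsn : Real.sin (angle ξ) = Real.sin (angle η) := by
      have := congrArg H3.z h
      simp only [pr] at this
      rw [hr] at this
      exact mul_left_cancel₀ hs this
    obtain ⟨n, hn⟩ := Real.Angle.angle_eq_iff_two_pi_dvd_sub.1 (Real.Angle.cos_sin_inj hc hsn)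
    refine ⟨n, eq_of_coords ?_ ?_ fun _ => ?_⟩
    · rw [rad_vadd, hr]
    · rw [height_vadd, height_eq_of_pr_eq h]; simp
    · rw [angle_vadd _ h0]
      linarith

theorem pr_turns (n : ℤ) (ξ : HHat) : pr ((⟨0, n * (2 * Real.pi)⟩ : ℂ) +ᵥ ξ) = pr ξ := by
  apply H3.eq_of_lor_eq_one
  rw [← H3.lor_self (pr ξ), lor_pr, lor_pr, rad_vadd, height_vadd]
  congr 1
  · simp
  · rcases (rad_nonneg ξ).eq_or_lt with h | h
    · rw [← h]; simp
    · rw [angle_vadd _ h, sub_self, Real.cos_zero]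
      simp only [add_sub_cancel_left]
      rw [Real.cos_int_mul_two_pi]

/-- The section of the projection with angles near `θ₀`. -/
def sect (θ₀ : ℝ) (P : H3) : HHat :=
  ofCoords (Real.arsinh (Real.sqrt (P.y ^ 2 + P.z ^ 2)))
    (Real.arsinh (P.x / Real.sqrt (1 + P.y ^ 2 + P.z ^ 2))) (θ₀ + Complex.arg (Cover.planar θ₀ P))

theorem sect_eq_coe (θ₀ : ℝ) {P : H3} (hP : P.y ^ 2 + P.z ^ 2 ≠ 0) :
    sect θ₀ P = (Cover.sec θ₀ P : HHat) := by
  have hpos : 0 < P.y ^ 2 + P.z ^ 2 := lt_of_le_of_ne (by positivity) hP.symm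
  have h0 : 0 < Real.arsinh (Real.sqrt (P.y ^ 2 + P.z ^ 2)) :=
    Real.arsinh_pos_iff.2 (Real.sqrt_pos.2 hpos)
  apply eq_of_coords
  · rw [rad_coe, sect, rad_ofCoords h0.le]
    simp only [Cover.sec, if_neg hP]
  · rw [height_coe, sect, height_ofCoords]; rfl
  · intro _
    rw [angle_coe, sect, angle_ofCoords h0]; rfl

theorem pr_sect (θ₀ : ℝ) (P : H3) : pr (sect θ₀ P) = P := by
  by_cases hP : P.y ^ 2 + P.z ^ 2 = 0
  · have hy : P.y = 0 := by nlinarith [sq_nonneg P.y, sq_nonneg P.z]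
    have hz : P.z = 0 := by nlinarith [sq_nonneg P.y, sq_nonneg P.z]
    have hr : rad (sect θ₀ P) = 0 := by
      rw [sect, hP, Real.sqrt_zero, Real.arsinh_zero, rad_ofCoords le_rfl]
    have hh : height (sect θ₀ P) = Real.arsinh P.x := by
      rw [sect, height_ofCoords, hy, hz]; simp
    have hn := P.norm_eq
    rw [hy, hz] at hn
    ext
    · simp only [pr]
      rw [hr, hh, Real.cosh_zero, one_mul]
      refine (pow_left_inj₀ (Real.cosh_pos _).le P.t_pos.le two_ne_zero).1 ?_
      rw [Real.cosh_sq, Real.sinh_arsinh]; linarith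
    · simp only [pr]
      rw [hr, hh, Real.cosh_zero, one_mul, Real.sinh_arsinh]
    · simp only [pr]; rw [hr, hy]; simp
    · simp only [pr]; rw [hr, hz]; simp
  · rw [sect_eq_coe θ₀ hP, pr_coe, Cover.proj_sec θ₀ hP]

theorem sect_pr {θ₀ : ℝ} {ξ : HHat} (h : |angle ξ - θ₀| < Real.pi) : sect θ₀ (pr ξ) = ξ := by
  rcases (rad_nonneg ξ).eq_or_lt with h0 | h0
  · have hp := pr_sect θ₀ (pr ξ)
    have hr := rad_eq_of_pr_eq hp
    refine eq_of_coords hr (height_eq_of_pr_eq hp) fun h1 => ?_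
    rw [hr, ← h0] at h1
    exact absurd h1 (lt_irrefl _)
  · obtain ⟨p, rfl⟩ := exists_coe_of_rad_pos h0
    rw [angle_coe] at h
    rw [pr_coe, sect_eq_coe _ p.proj_sq_pos.ne', Cover.sec_proj h]

theorem sect_pr_self (ξ : HHat) : sect (angle ξ) (pr ξ) = ξ :=
  sect_pr (by simpa using Real.pi_pos)

theorem abs_angle_sect_sub_lt {θ₀ : ℝ} {P : H3} (h : 0 < (Cover.planar θ₀ P).re) :
    |angle (sect θ₀ P) - θ₀| < Real.pi / 2 := by
  rw [sect_eq_coe _ (Cover.sq_pos_of_planar_re_pos h).ne', angle_coe]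
  exact Cover.abs_sec_θ_sub_lt h

theorem dist_sect {θ₀ : ℝ} {P Q : H3} (hP : 0 < (Cover.planar θ₀ P).re)
    (hQ : 0 < (Cover.planar θ₀ Q).re) : dist (sect θ₀ P) (sect θ₀ Q) = dist P Q := by
  rw [dist_eq_dist_pr, pr_sect, pr_sect]
  have h1 := abs_angle_sect_sub_lt hP
  have h2 := abs_angle_sect_sub_lt hQ
  rw [abs_lt] at h1 h2
  rw [abs_le]
  constructor <;> linarith

/-- The plane through the axis perpendicular to the direction of `ξ` is at distance `rad ξ` from `pr
ξ`, so a smaller ball stays on one side of it. -/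
theorem planar_re_pos_of_dist_lt {ξ : HHat} {P : H3} (h : dist (pr ξ) P < rad ξ) :
    0 < (Cover.planar (angle ξ) P).re := by
  by_contra hneg
  push Not at hneg
  have h1 := H3.one_le_lor (H3.axisPoint (height ξ)) P
  have h2 : H3.lor (pr ξ) P = Real.cosh (rad ξ) * H3.lor (H3.axisPoint (height ξ)) P -
      Real.sinh (rad ξ) * (Cover.planar (angle ξ) P).re := by
    simp only [H3.lor, pr, H3.axisPoint, Cover.planar]; ring
  have h3 : Real.cosh (rad ξ) ≤ H3.lor (pr ξ) P := by
    rw [h2]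
    nlinarith [Real.cosh_pos (rad ξ), mul_nonneg (sinh_rad_nonneg ξ) (neg_nonneg.2 hneg)]
  rw [← H3.cosh_dist, Real.cosh_le_cosh, abs_of_nonneg (rad_nonneg ξ),
    abs_of_nonneg dist_nonneg] at h3
  linarith

/-- When the angles differ by `π` or more, the shortest path runs through the axis and is at least
`rad ξ` long. -/
theorem abs_angle_sub_lt_of_dist_lt {ξ η : HHat} (h : dist ξ η < rad ξ) :
    |angle ξ - angle η| < Real.pi := by
  by_contra hneg
  push Not at hneg
  have h1 := cosh_dist ξ η
  rw [angCos_eq_neg_one hneg] at h1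
  have h2 : Real.cosh (rad ξ) ≤ Real.cosh (dist ξ η) := by
    rw [h1]
    have h3 : 1 ≤ Real.cosh (rad η) * Real.cosh (height ξ - height η) :=
      one_le_mul_of_one_le_of_one_le (Real.one_le_cosh _) (Real.one_le_cosh _)
    nlinarith [Real.cosh_pos (rad ξ), mul_nonneg (sinh_rad_nonneg ξ) (sinh_rad_nonneg η)]
  rw [Real.cosh_le_cosh, abs_of_nonneg (rad_nonneg ξ), abs_of_nonneg dist_nonneg] at h2
  linarith

end HHat

open HHat

/-! ### The deck group -/

/-- The element of the deck group with given exponents. -/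
def deck (α lam τ : ℝ) (m n : ℤ) : ℂ := ⟨m * lam, n * α + m * τ⟩

theorem mem_deckGroup_iff {α lam τ : ℝ} {w : ℂ} :
    w ∈ deckGroup α lam τ ↔ ∃ m n : ℤ, w = deck α lam τ m n := by
  rw [deckGroup, AddSubgroup.mem_closure_pair]
  have h : ∀ n m : ℤ, n • (⟨0, α⟩ : ℂ) + m • (⟨lam, τ⟩ : ℂ) = deck α lam τ m n := fun n m => by
    apply Complex.ext <;> simp [deck]
  simp only [h]
  exact ⟨fun ⟨n, m, h⟩ => ⟨m, n, h.symm⟩, fun ⟨m, n, h⟩ => ⟨n, m, h.symm⟩⟩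

theorem deck_zero_two_pi (lam τ : ℝ) (n : ℤ) :
    deck (2 * Real.pi) lam τ 0 n = ⟨0, n * (2 * Real.pi)⟩ := by
  simp [deck]

theorem deck_zero (α lam τ : ℝ) : deck α lam τ 0 0 = 0 := by
  apply Complex.ext <;> simp [deck]

theorem deck_add (α lam τ : ℝ) (m n m' n' : ℤ) :
    deck α lam τ (m + m') (n + n') = deck α lam τ m n + deck α lam τ m' n' := by
  apply Complex.ext
  · simp only [deck, Complex.add_re]; push_cast; ring
  · simp only [deck, Complex.add_im]; push_cast; ring

theorem deck_neg (α lam τ : ℝ) (m n : ℤ) : deck α lam τ (-m) (-n) = -deck α lam τ m n := by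
  apply Complex.ext
  · simp [deck]
  · simp [deck]; ring

/-! ### The quotient metric and the quotient topology. -/

namespace ModelSolidTorus

variable {α lam τ : ℝ}

theorem mk_eq_mk_iff {ξ η : HHat} : (mk ξ : ModelSolidTorus α lam τ) = mk η ↔
    ∃ m n : ℤ, ξ = deck α lam τ m n +ᵥ η := by
  have h : (mk ξ : ModelSolidTorus α lam τ) = mk η ↔
      ∃ g : deckGroup α lam τ, g +ᵥ η = ξ :=
    ⟨fun h => Quotient.exact (s := AddAction.orbitRel (deckGroup α lam τ) HHat) h,
      fun h => Quotient.sound (s := AddAction.orbitRel (deckGroup α lam τ) HHat) h⟩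
  rw [h]
  constructor
  · rintro ⟨⟨w, hw⟩, rfl⟩
    obtain ⟨m, n, rfl⟩ := mem_deckGroup_iff.1 hw
    exact ⟨m, n, rfl⟩
  · rintro ⟨m, n, rfl⟩
    exact ⟨⟨_, mem_deckGroup_iff.2 ⟨m, n, rfl⟩⟩, rfl⟩

theorem mk_deck_vadd (m n : ℤ) (ξ : HHat) :
    (mk (deck α lam τ m n +ᵥ ξ) : ModelSolidTorus α lam τ) = mk ξ :=
  mk_eq_mk_iff.2 ⟨m, n, rfl⟩

theorem mk_surjective : Function.Surjective (mk : HHat → ModelSolidTorus α lam τ) :=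
  Quotient.mk_surjective

theorem bddBelow_dists (x y : ModelSolidTorus α lam τ) :
    BddBelow {d | ∃ p q : HHat, mk p = x ∧ mk q = y ∧ d = Dist.dist p q} :=
  ⟨0, by rintro _ ⟨p, q, -, -, rfl⟩; exact dist_nonneg⟩

theorem nonempty_dists (x y : ModelSolidTorus α lam τ) :
    {d | ∃ p q : HHat, mk p = x ∧ mk q = y ∧ d = Dist.dist p q}.Nonempty := by
  obtain ⟨p, rfl⟩ := mk_surjective x
  obtain ⟨q, rfl⟩ := mk_surjective y
  exact ⟨_, p, q, rfl, rfl, rfl⟩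

theorem dist_mk_le (ξ η : HHat) :
    dist (mk ξ : ModelSolidTorus α lam τ) (mk η) ≤ Dist.dist ξ η :=
  csInf_le (bddBelow_dists _ _) ⟨ξ, η, rfl, rfl, rfl⟩

/-- Because the action is isometric, it is enough to vary the lift of one of the two points. -/
theorem le_dist_mk {ξ η : HHat} {c : ℝ}
    (h : ∀ m n : ℤ, c ≤ Dist.dist ξ (deck α lam τ m n +ᵥ η)) :
    c ≤ dist (mk ξ : ModelSolidTorus α lam τ) (mk η) := by
  refine le_csInf (nonempty_dists _ _) ?_
  rintro _ ⟨p, q, hp, hq, rfl⟩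
  obtain ⟨m, n, rfl⟩ := mk_eq_mk_iff.1 hp
  obtain ⟨m', n', rfl⟩ := mk_eq_mk_iff.1 hq
  have := h (-m + m') (-n + n')
  rwa [deck_add, deck_neg, add_vadd, ← dist_vadd (deck α lam τ m n), vadd_neg_vadd] at this

theorem exists_lift {ξ : HHat} {y : ModelSolidTorus α lam τ} {η : ℝ}
    (h : dist (mk ξ) y < η) : ∃ q, mk q = y ∧ Dist.dist ξ q < η := by
  obtain ⟨_, ⟨p, q, hp, rfl, rfl⟩, hlt⟩ := exists_lt_of_csInf_lt (nonempty_dists _ _) h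
  obtain ⟨m, n, rfl⟩ := mk_eq_mk_iff.1 hp
  refine ⟨deck α lam τ (-m) (-n) +ᵥ q, mk_deck_vadd _ _ q, ?_⟩
  rwa [deck_neg, ← dist_vadd (deck α lam τ m n), vadd_neg_vadd]

theorem dist_comm (x y : ModelSolidTorus α lam τ) : dist x y = dist y x := by
  unfold dist
  congr 1
  ext d
  constructor
  · rintro ⟨p, q, hp, hq, rfl⟩; exact ⟨q, p, hq, hp, _root_.dist_comm _ _⟩
  · rintro ⟨p, q, hp, hq, rfl⟩; exact ⟨q, p, hq, hp, _root_.dist_comm _ _⟩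

theorem dist_nonneg (x y : ModelSolidTorus α lam τ) : 0 ≤ dist x y :=
  Real.sInf_nonneg (by rintro _ ⟨p, q, -, -, rfl⟩; exact _root_.dist_nonneg)

theorem abs_rad_sub_le_dist (ξ η : HHat) :
    |rad ξ - rad η| ≤ dist (mk ξ : ModelSolidTorus α lam τ) (mk η) :=
  le_dist_mk fun m n => by
    have := abs_rad_sub_le ξ (deck α lam τ m n +ᵥ η)
    rwa [rad_vadd] at this

theorem radius_mk (ξ : HHat) : radius (mk ξ : ModelSolidTorus α lam τ) = rad ξ := by
  obtain ⟨a, ha, hh⟩ := exists_axis_point (height ξ)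
  have hd : Dist.dist ξ a = rad ξ := by
    have h := HHat.cosh_dist ξ a
    rw [ha, hh, sub_self, Real.cosh_zero, Real.sinh_zero] at h
    have h' : Real.cosh (Dist.dist ξ a) = Real.cosh (rad ξ) := by rw [h]; ring
    exact Real.cosh_injOn _root_.dist_nonneg (rad_nonneg ξ) h'
  have hlow : ∀ d ∈ {d | ∃ c ∈ core, d = dist (mk ξ : ModelSolidTorus α lam τ) c}, rad ξ ≤ d := by
    rintro _ ⟨_, ⟨b, hb, rfl⟩, rfl⟩
    have := abs_rad_sub_le_dist (α := α) (lam := lam) (τ := τ) ξ b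
    rw [mem_axis_iff.1 hb, sub_zero] at this
    exact (le_abs_self _).trans this
  have hmem : dist (mk ξ : ModelSolidTorus α lam τ) (mk a) ∈
      {d | ∃ c ∈ core, d = dist (mk ξ : ModelSolidTorus α lam τ) c} :=
    ⟨mk a, ⟨a, mem_axis_iff.2 ha, rfl⟩, rfl⟩
  refine le_antisymm ?_ (le_csInf ⟨_, hmem⟩ hlow)
  exact (csInf_le ⟨_, hlow⟩ hmem).trans ((dist_mk_le ξ a).trans hd.le)

theorem continuous_mk : Continuous (mk : HHat → ModelSolidTorus α lam τ) :=
  continuous_coinduced_rng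

theorem isOpenMap_mk : IsOpenMap (mk : HHat → ModelSolidTorus α lam τ) := by
  intro U hU
  rw [isOpen_coinduced]
  have : (mk : HHat → ModelSolidTorus α lam τ) ⁻¹' (mk '' U) =
      ⋃ (m : ℤ) (n : ℤ), (fun ξ => deck α lam τ m n +ᵥ ξ) ⁻¹' U := by
    ext ξ
    simp only [mem_preimage, mem_image, mem_iUnion]
    constructor
    · rintro ⟨η, hη, h⟩
      obtain ⟨m, n, rfl⟩ := mk_eq_mk_iff.1 h
      exact ⟨m, n, hη⟩
    · rintro ⟨m, n, h⟩
      exact ⟨_, h, mk_deck_vadd m n ξ⟩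
  rw [this]
  exact isOpen_iUnion fun m => isOpen_iUnion fun n => hU.preimage (continuous_const_vadd _)

end ModelSolidTorus

/-- Every real number is within `a / 2` of `0` modulo `a`. -/
theorem exists_int_abs_add_mul_le {a : ℝ} (ha : 0 < a) (θ : ℝ) : ∃ n : ℤ, |θ + n * a| ≤ a / 2 := by
  refine ⟨-round (θ / a), ?_⟩
  have h := abs_sub_round (θ / a)
  have e : θ + ((-round (θ / a) : ℤ) : ℝ) * a = (θ / a - round (θ / a)) * a := by
    push_cast; field_simp; ring
  rw [e, abs_mul, abs_of_pos ha]
  nlinarith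

theorem HHat.dist_axis {ξ a : HHat} (ha : rad a = 0) (h : height a = height ξ) :
    dist ξ a = rad ξ := by
  have h1 := HHat.cosh_dist ξ a
  rw [ha, h, sub_self, Real.cosh_zero, Real.sinh_zero] at h1
  have h' : Real.cosh (dist ξ a) = Real.cosh (rad ξ) := by rw [h1]; ring
  exact Real.cosh_injOn dist_nonneg (rad_nonneg ξ) h'

/-! ### Criteria for and obstructions to hyperbolic balls. -/

namespace ModelSolidTorus

variable {α lam τ : ℝ}

/-- A map from `H3` that is nonexpanding, lifts short distances and is injective on a ball
exhibits a hyperbolic ball. -/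
theorem isHyperbolicBall_of_map {P : H3} {ρ : ℝ} (π : H3 → ModelSolidTorus α lam τ)
    (h1 : ∀ u ∈ Metric.ball P ρ, ∀ v ∈ Metric.ball P ρ, dist (π u) (π v) ≤ Dist.dist u v)
    (h2 : ∀ u ∈ Metric.ball P ρ, ∀ η, η + Dist.dist u P ≤ ρ → ∀ y, dist (π u) y < η →
      ∃ v, Dist.dist u v < η ∧ π v = y)
    (h3 : InjOn π (Metric.ball P ρ)) : IsHyperbolicBall (π P) ρ := by
  -- The definition asks for a ball about the origin; composing with a point reflection recentres it
  -- at `P`.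
  obtain ⟨S, hm, hS, hSd⟩ : ∃ S : H3 → H3, S H3.origin = P ∧ Function.Involutive S ∧
      ∀ u v, Dist.dist (S u) (S v) = Dist.dist u v := by
    obtain ⟨m, hm⟩ := H3.exists_pointReflection_origin P
    exact ⟨_, hm, H3.pointReflection_involutive m, H3.dist_pointReflection m⟩
  have hball : ∀ u η p, S u ∈ Metric.ball (S p) η ↔ u ∈ Metric.ball p η := fun u η p => by
    rw [Metric.mem_ball, Metric.mem_ball, hSd]
  have hb0 : ∀ u, S u ∈ Metric.ball P ρ ↔ u ∈ Metric.ball H3.origin ρ := fun u => by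
    rw [← hm]; exact hball u ρ _
  have hloc : ∀ u ∈ Metric.ball P ρ, ∀ η, η + Dist.dist u P ≤ ρ →
      Metric.ball u η ⊆ Metric.ball P ρ := fun u _ η hη v hv => by
    rw [Metric.mem_ball] at hv ⊢
    linarith [dist_triangle v u P]
  have himg : ∀ u ∈ Metric.ball P ρ, ∀ η, η + Dist.dist u P ≤ ρ →
      π '' Metric.ball u η = ball (π u) η := fun u hu η hη => by
    ext y
    constructor
    · rintro ⟨v, hv, rfl⟩
      exact (h1 v (hloc u hu η hη hv) u hu).trans_lt hv
    · intro hy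
      obtain ⟨v, hv, rfl⟩ := h2 u hu η hη y (by rw [dist_comm]; exact hy)
      exact ⟨v, by rwa [Metric.mem_ball, _root_.dist_comm], rfl⟩
  have himg' : ∀ p η, (fun u => π (S u)) '' Metric.ball p η = π '' Metric.ball (S p) η := by
    intro p η
    ext y
    constructor
    · rintro ⟨v, hv, rfl⟩
      exact ⟨S v, (hball v η p).2 hv, rfl⟩
    · rintro ⟨v, hv, rfl⟩
      refine ⟨S v, (hball _ η p).1 (by rwa [hS v]), ?_⟩
      change π (S (S v)) = π v
      rw [hS v]
  refine ⟨fun u => π (S u), by simp only [hm], ⟨?_, ?_, ?_⟩, ?_⟩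
  · intro u hu
    have hu' := (hb0 u).2 hu
    have hP : P ∈ Metric.ball P ρ :=
      Metric.mem_ball_self (_root_.dist_nonneg.trans_lt hu')
    exact (h1 _ hu' P hP).trans_lt hu'
  · intro u hu v hv huv
    exact hS.injective (h3 ((hb0 u).2 hu) ((hb0 v).2 hv) huv)
  · rcases le_or_gt ρ 0 with hρ | hρ
    · intro y hy
      exact absurd (hy : dist _ _ < ρ) (not_lt.2 (hρ.trans (dist_nonneg _ _)))
    · have hP : P ∈ Metric.ball P ρ := Metric.mem_ball_self hρ
      intro y hy
      rw [himg', hm, himg P hP ρ (by simp)]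
      exact hy
  · intro p hp
    have hq := (hb0 p).2 hp
    set q := S p
    set κ := ρ - Dist.dist q P with hκ
    have hκ0 : 0 < κ := by rw [hκ]; exact sub_pos.2 hq
    -- For two points of the `κ / 3`-ball, their distance plus the distance of one of them to `P` is
    -- at most `2κ/3 + κ/3 + (ρ - κ) = ρ`. So `h2` applies: a shorter distance in the quotient would
    -- lift to a nearer preimage of the same point, contrary to injectivity.
    refine ⟨κ / 3, by positivity, ?_, ?_, ?_⟩
    · intro u hu
      exact (hb0 u).1 (hloc q hq (κ / 3) (by linarith) ((hball u _ p).2 hu))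
    · rw [himg', himg q hq (κ / 3) (by linarith)]
    · intro u hu v hv
      have hu' := (hball u _ p).2 hu
      have hv' := (hball v _ p).2 hv
      rw [← hSd u v]
      have huP := hloc q hq (κ / 3) (by linarith) hu'
      have hvP := hloc q hq (κ / 3) (by linarith) hv'
      refine le_antisymm (h1 _ huP _ hvP) ?_
      by_contra hlt
      push Not at hlt
      rw [Metric.mem_ball] at hu' hv'
      have d1 := dist_triangle_right (S u) (S v) q
      have d2 := dist_triangle (S u) q P
      have hsum : Dist.dist (S u) (S v) + Dist.dist (S u) P ≤ ρ := by linarith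
      obtain ⟨w, hw, hπ⟩ := h2 _ huP _ hsum _ hlt
      have hwP : w ∈ Metric.ball P ρ := by
        rw [Metric.mem_ball]
        linarith [dist_triangle_left w P (S u)]
      rw [h3 hwP hvP hπ] at hw
      exact lt_irrefl _ hw

/-- A hyperbolic ball contains no closed local geodesic through its centre. -/
theorem not_isHyperbolicBall_of_loop {x : ModelSolidTorus α lam τ} {ρ d : ℝ} (hd : 0 < d)
    {c : ℝ → ModelSolidTorus α lam τ} (c0 : c 0 = x) (c1 : c d = x)
    (hc : ∀ t ∈ Icc 0 d, c t ∈ ball x ρ)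
    (hloc : ∀ t ∈ Icc 0 d, ∃ η > 0, ∀ t' ∈ Icc 0 d, ∀ t'' ∈ Icc 0 d, |t' - t| < η → |t'' - t| < η →
      dist (c t') (c t'') = |t' - t''|) : ¬ IsHyperbolicBall x ρ := by
  rintro ⟨f, f0, hf, hfl⟩
  have hρ : 0 < ρ := (dist_nonneg _ _).trans_lt (hc 0 ⟨le_rfl, hd.le⟩)
  have ho : H3.origin ∈ Metric.ball H3.origin ρ := Metric.mem_ball_self hρ
  -- The curve `e` chosen here is the pullback of the loop by the bijection `f`. It begins and ends
  -- at the origin and is a local geodesic because `f` is a local isometry.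
  have hex : ∀ t, ∃ p, t ∈ Icc 0 d → p ∈ Metric.ball H3.origin ρ ∧ f p = c t := fun t => by
    by_cases ht : t ∈ Icc 0 d
    · obtain ⟨p, hp, hfp⟩ := hf.surjOn (hc t ht)
      exact ⟨p, fun _ => ⟨hp, hfp⟩⟩
    · exact ⟨H3.origin, fun h => absurd h ht⟩
  choose e he using hex
  have e0 : e 0 = H3.origin := by
    obtain ⟨h1, h2⟩ := he 0 ⟨le_rfl, hd.le⟩
    exact hf.injOn h1 ho (by rw [h2, c0, f0])
  have e1 : e d = H3.origin := by
    obtain ⟨h1, h2⟩ := he d ⟨hd.le, le_rfl⟩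
    exact hf.injOn h1 ho (by rw [h2, c1, f0])
  have hel : ∀ t ∈ Icc 0 d, ∃ η > 0, ∀ t' ∈ Icc 0 d, ∀ t'' ∈ Icc 0 d, |t' - t| < η →
      |t'' - t| < η → Dist.dist (e t') (e t'') = |t' - t''| := by
    intro t ht
    obtain ⟨h1, h2⟩ := he t ht
    obtain ⟨η₁, hη₁, hsub, him, hiso⟩ := hfl _ h1
    obtain ⟨η₂, hη₂, hl⟩ := hloc t ht
    have key : ∀ t' ∈ Icc 0 d, |t' - t| < min η₁ η₂ → e t' ∈ Metric.ball (e t) η₁ := by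
      intro t' ht' hlt
      obtain ⟨h1', h2'⟩ := he t' ht'
      have : c t' ∈ ball (f (e t)) η₁ := by
        rw [h2]
        change dist _ _ < _
        rw [hl t' ht' t ht (hlt.trans_le (min_le_right _ _)) (by simpa using hη₂)]
        exact hlt.trans_le (min_le_left _ _)
      rw [← him] at this
      obtain ⟨w, hw, hfw⟩ := this
      rw [← hf.injOn (hsub hw) h1' (by rw [hfw, h2'])]
      exact hw
    refine ⟨min η₁ η₂, lt_min hη₁ hη₂, fun t' ht' t'' ht'' hlt' hlt'' => ?_⟩
    rw [← hiso _ (key t' ht' hlt') _ (key t'' ht'' hlt''), (he t' ht').2, (he t'' ht'').2]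
    exact hl t' ht' t'' ht'' (hlt'.trans_le (min_le_right _ _)) (hlt''.trans_le (min_le_right _ _))
  have := H3.lor_of_local_geodesic hd hel
  rw [e0, e1, H3.lor_self] at this
  exact (Real.one_lt_cosh.2 hd.ne').ne this

/-- If the cone angle is less than `2π`, a hyperbolic ball does not meet the core. -/
theorem IsHyperbolicBall.le_rad (hα : 0 < α) (hα' : α < 2 * Real.pi) {ξ : HHat} {ρ : ℝ}
    (h : IsHyperbolicBall (mk ξ : ModelSolidTorus α lam τ) ρ) : ρ ≤ rad ξ := by
  by_contra hlt
  push Not at hlt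
  obtain ⟨f, f0, hf, hfl⟩ := h
  obtain ⟨a, ha, hh⟩ := exists_axis_point (height ξ)
  have hca : (mk a : ModelSolidTorus α lam τ) ∈ ball (mk ξ) ρ := by
    refine (dist_mk_le a ξ).trans_lt ?_
    rwa [_root_.dist_comm, dist_axis ha hh]
  obtain ⟨q, hq, hfq⟩ := hf.surjOn hca
  obtain ⟨η, hη, -, him, hiso⟩ := hfl q hq
  rw [hfq] at him
  -- Near a core point the chart supplies, for `p` at distance `s` from the core, an opposite point
  -- at distance `2 * s` from it. On a cone of angle `α < 2π` every point can be rotated to within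
  -- `α / 2 < π` of `p`, so no such opposite point exists.
  set s := η / 2 with hs
  have hs0 : 0 < s := by positivity
  set p := ofCoords s (height a) 0
  have hpr : rad p = s := rad_ofCoords hs0.le _ _
  have hph : height p = height a := height_ofCoords _ _ _
  have hpθ : angle p = 0 := angle_ofCoords hs0 _ _
  have hpa : Dist.dist p a = s := by rw [dist_axis ha hph.symm, hpr]
  have hpa' : dist (mk p : ModelSolidTorus α lam τ) (mk a) = s := by
    refine le_antisymm ((dist_mk_le p a).trans hpa.le) ?_
    have := abs_rad_sub_le_dist (α := α) (lam := lam) (τ := τ) p a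
    rwa [hpr, ha, sub_zero, abs_of_pos hs0] at this
  have hpb : (mk p : ModelSolidTorus α lam τ) ∈ ball (mk a) η := by
    change dist _ _ < _
    rw [hpa']; linarith
  rw [← him] at hpb
  obtain ⟨u, hu, hfu⟩ := hpb
  have hqq : q ∈ Metric.ball q η := Metric.mem_ball_self hη
  have huq : Dist.dist u q = s := by rw [← hiso u hu q hqq, hfu, hfq, hpa']
  set v := H3.pointReflection q u with hv'
  have hqv : Dist.dist q v = s := by
    rw [hv', H3.dist_self_pointReflection, _root_.dist_comm, huq]
  have huv : Dist.dist u v = 2 * s := by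
    rw [hv', H3.dist_pointReflection_self, _root_.dist_comm, huq]
  have hv : v ∈ Metric.ball q η := by
    rw [Metric.mem_ball, _root_.dist_comm, hqv]; linarith
  have hd1 : dist (mk a) (f v) = s := by rw [← hfq, hiso q hqq v hv, hqv]
  have hd2 : dist (mk p) (f v) = 2 * s := by rw [← hfu, hiso u hu v hv, huv]
  -- After that rotation `k` bounds `-angCos` of the angle difference; it is below `1` because `α /
  -- 2 < π`.
  obtain ⟨k, hk⟩ : ∃ k, k = max 0 (-Real.cos (α / 2)) := ⟨_, rfl⟩
  have hk0 : 0 ≤ k := by rw [hk]; exact le_max_left _ _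
  have hk1 : k < 1 := by
    rw [hk]
    refine max_lt one_pos ?_
    have : Real.cos Real.pi < Real.cos (α / 2) :=
      Real.cos_lt_cos_of_nonneg_of_le_pi (by linarith) le_rfl (by linarith)
    rw [Real.cos_pi] at this
    linarith
  have hss : 0 < Real.sinh s := Real.sinh_pos_iff.2 hs0
  -- The quotient distance is an infimum, so a lift is only available at distance less than `s + κ`;
  -- the slack is removed by letting `κ` tend to `0`.
  have key : ∀ κ > 0, Real.cosh (2 * s) ≤
      Real.cosh s * Real.cosh (s + κ) + k * Real.sinh s * Real.sinh (s + κ) := by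
    intro κ hκ
    obtain ⟨y, hy, hay⟩ := exists_lift (show dist (mk a) (f v) < s + κ by rw [hd1]; linarith)
    obtain ⟨n, hn⟩ := exists_int_abs_add_mul_le hα (angle y)
    have hmk : mk (deck α lam τ 0 n +ᵥ y) = f v := by rw [mk_deck_vadd, hy]
    have hle := dist_mk_le (α := α) (lam := lam) (τ := τ) p (deck α lam τ 0 n +ᵥ y)
    rw [hmk, hd2] at hle
    have hc : Real.cosh (2 * s) ≤ Real.cosh (Dist.dist p (deck α lam τ 0 n +ᵥ y)) := by
      rw [Real.cosh_le_cosh, abs_of_pos (by linarith), abs_of_nonneg _root_.dist_nonneg]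
      exact hle
    have hay' := HHat.cosh_dist a y
    rw [ha, Real.cosh_zero, Real.sinh_zero, zero_mul, zero_mul, sub_zero, one_mul] at hay'
    have hB : Real.cosh (rad y) * Real.cosh (height a - height y) ≤ Real.cosh (s + κ) := by
      rw [← hay', Real.cosh_le_cosh, abs_of_nonneg _root_.dist_nonneg, abs_of_pos (by linarith)]
      exact hay.le
    have hr : rad y ≤ s + κ := by
      have := abs_rad_sub_le a y
      rw [ha, zero_sub, abs_neg] at this
      exact (le_abs_self _).trans (this.trans hay.le)
    have hsr := Real.sinh_le_sinh.2 hr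
    have hang : -(Real.sinh (rad y) * angCos (angle p - angle (deck α lam τ 0 n +ᵥ y))) ≤
        k * Real.sinh (s + κ) := by
      have h0 : 0 ≤ k * Real.sinh (s + κ) := mul_nonneg hk0 ((sinh_rad_nonneg y).trans hsr)
      rcases (rad_nonneg y).eq_or_lt with hy0 | hy0
      · rw [← hy0, Real.sinh_zero, zero_mul, neg_zero]; exact h0
      · have e : angle (deck α lam τ 0 n +ᵥ y) = angle y + n * α := by
          rw [angle_vadd _ hy0]; simp [deck]
        have hk2 : -angCos (angle p - angle (deck α lam τ 0 n +ᵥ y)) ≤ k := by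
          rw [hpθ, zero_sub, e, hk]
          refine le_max_of_le_right (neg_le_neg ?_)
          have hα2 : |α / 2| ≤ Real.pi := by rw [abs_of_pos (by linarith)]; linarith
          rw [← angCos_eq_cos hα2]
          apply angCos_le_angCos
          rw [abs_neg, abs_of_pos (show (0 : ℝ) < α / 2 by linarith)]
          exact hn
        have m1 := mul_le_mul_of_nonneg_left hk2 (sinh_rad_nonneg y)
        have m2 := mul_le_mul_of_nonneg_left hsr hk0
        linarith
    rw [HHat.cosh_dist, hpr, rad_vadd, height_vadd, hph] at hc
    have hre : (deck α lam τ 0 n).re = 0 := by simp [deck]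
    rw [hre, add_zero] at hc
    have m1 := mul_le_mul_of_nonneg_left hB (Real.cosh_pos s).le
    have m2 := mul_le_mul_of_nonneg_left hang hss.le
    linarith
  have hlim : Real.cosh (2 * s) ≤
      Real.cosh s * Real.cosh (s + 0) + k * Real.sinh s * Real.sinh (s + 0) := by
    have hcont : Continuous fun κ : ℝ =>
        Real.cosh s * Real.cosh (s + κ) + k * Real.sinh s * Real.sinh (s + κ) := by
      have h1 := Real.continuous_cosh
      have h2 := Real.continuous_sinh
      fun_prop
    refine ge_of_tendsto ((hcont.tendsto 0).mono_left (nhdsWithin_le_nhds (s := Ioi 0))) ?_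
    filter_upwards [self_mem_nhdsWithin] with κ hκ using key κ hκ
  rw [add_zero, Real.cosh_two_mul] at hlim
  nlinarith [pow_pos hss 2]

end ModelSolidTorus

/-! ### Displacement by deck elements and hyperbolic balls. -/

theorem lam_le_abs_int_mul {lam : ℝ} (hlam : 0 < lam) {m : ℤ} (hm : m ≠ 0) : lam ≤ |m * lam| := by
  rw [abs_mul, abs_of_pos hlam]
  have : (1 : ℝ) ≤ |(m : ℝ)| := by
    rw [← Int.cast_abs]; exact_mod_cast Int.one_le_abs hm
  nlinarith

theorem HHat.abs_height_sub_le_dist_pr (ξ η : HHat) :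
    |height ξ - height η| ≤ dist (pr ξ) (pr η) := by
  rw [← abs_of_nonneg (dist_nonneg (x := pr ξ) (y := pr η)), ← Real.cosh_le_cosh, H3.cosh_dist,
    lor_pr]
  refine (le_cosh_mul_sub (a := rad ξ) (b := rad η) (Real.one_le_cosh _)).trans ?_
  have := mul_le_mul_of_nonneg_left (Real.cos_le_one (angle ξ - angle η))
    (mul_nonneg (sinh_rad_nonneg ξ) (sinh_rad_nonneg η))
  linarith

namespace ModelSolidTorus

variable {α lam τ : ℝ}

theorem height_deck_sub (m n : ℤ) (ξ : HHat) :
    height ξ - height (deck α lam τ m n +ᵥ ξ) = -(m * lam) := by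
  rw [height_vadd]; simp [deck]

theorem dist_rotate_le (n : ℤ) (ξ : HHat) :
    Dist.dist ξ (deck α lam τ 0 n +ᵥ ξ) ≤ 2 * rad ξ := by
  obtain ⟨a, ha, hh⟩ := exists_axis_point (height ξ)
  have h1 := dist_axis ha hh
  have h2 : Dist.dist (deck α lam τ 0 n +ᵥ ξ) a = rad ξ := by
    rw [dist_axis ha, rad_vadd]
    have := height_deck_sub (α := α) (lam := lam) (τ := τ) 0 n ξ
    simp only [Int.cast_zero, zero_mul, neg_zero] at this
    rw [hh]; linarith
  linarith [dist_triangle_right ξ (deck α lam τ 0 n +ᵥ ξ) a]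

/-- The deck group moves a point off the axis by a definite amount. -/
theorem exists_displacement_bound (hα : 0 < α) (hlam : 0 < lam) {ξ : HHat} (hξ : 0 < rad ξ) :
    ∃ μ > 0, ∀ m n : ℤ, (m ≠ 0 ∨ n ≠ 0) → μ ≤ Dist.dist ξ (deck α lam τ m n +ᵥ ξ) := by
  have hs : 0 < Real.sinh (rad ξ) := Real.sinh_pos_iff.2 hξ
  have hc : 0 < Real.sinh (rad ξ) ^ 2 * (1 - angCos α) :=
    mul_pos (by positivity) (sub_pos.2 (angCos_lt_one hα.ne'))
  refine ⟨min lam (Real.arcosh (1 + Real.sinh (rad ξ) ^ 2 * (1 - angCos α))),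
    lt_min hlam (Real.arcosh_pos (by linarith)), fun m n hmn => ?_⟩
  by_cases hm : m = 0
  · subst hm
    have hn : n ≠ 0 := by simpa using hmn
    refine (min_le_right _ _).trans ?_
    have h := cosh_dist_vadd_self (deck α lam τ 0 n) ξ
    rw [← abs_of_nonneg (_root_.dist_nonneg (x := ξ)),
      ← abs_of_nonneg (Real.arcosh_nonneg (x := 1 + Real.sinh (rad ξ) ^ 2 * (1 - angCos α))
        (by linarith)), ← Real.cosh_le_cosh, Real.cosh_arcosh (by linarith), h]
    have h1 : (deck α lam τ 0 n).re = 0 := by simp [deck]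
    have h2 : (deck α lam τ 0 n).im = n * α := by simp [deck]
    rw [h1, h2, Real.cosh_zero]
    have h3 : angCos (n * α) ≤ angCos α := by
      apply angCos_le_angCos
      rw [abs_of_pos hα]
      exact lam_le_abs_int_mul hα hn
    have := mul_le_mul_of_nonneg_left h3 (pow_pos hs 2).le
    linarith
  · refine (min_le_left _ _).trans ((lam_le_abs_int_mul hlam hm).trans ?_)
    rw [← abs_neg, ← height_deck_sub (α := α) (τ := τ) m n ξ]
    exact abs_height_sub_le _ _

/-! ### Cone angle less than `2π` -/

/-- The chart is the section at the angle of `ξ`. The bound `ρ ≤ rad ξ` keeps the ball in a half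
space on which the section is isometric, and a deck element identifying two points of the ball would
move `ξ` by less than `2 * ρ`. -/
theorem isHyperbolicBall_of_displacement {ξ : HHat} {ρ : ℝ} (hρ : ρ ≤ rad ξ)
    (h : ∀ m n : ℤ, (m ≠ 0 ∨ n ≠ 0) → 2 * ρ ≤ Dist.dist ξ (deck α lam τ m n +ᵥ ξ)) :
    IsHyperbolicBall (mk ξ : ModelSolidTorus α lam τ) ρ := by
  have hpl : ∀ u ∈ Metric.ball (pr ξ) ρ, 0 < (Cover.planar (angle ξ) u).re := fun u hu =>
    planar_re_pos_of_dist_lt ((by rwa [_root_.dist_comm] : Dist.dist (pr ξ) u < ρ).trans_le hρ)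
  have hξu : ∀ u ∈ Metric.ball (pr ξ) ρ, Dist.dist ξ (sect (angle ξ) u) = Dist.dist u (pr ξ) := by
    intro u hu
    have h0 : pr ξ ∈ Metric.ball (pr ξ) ρ :=
      Metric.mem_ball_self (_root_.dist_nonneg.trans_lt hu)
    have := dist_sect (hpl _ h0) (hpl u hu)
    rwa [sect_pr_self, _root_.dist_comm (pr ξ)] at this
  have key := isHyperbolicBall_of_map (α := α) (lam := lam) (τ := τ) (P := pr ξ) (ρ := ρ)
    (fun u => mk (sect (angle ξ) u)) ?_ ?_ ?_
  · rwa [sect_pr_self] at key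
  · intro u hu v hv
    exact (dist_mk_le _ _).trans (dist_sect (hpl u hu) (hpl v hv)).le
  · intro u hu η hη y hy
    obtain ⟨q, rfl, hq⟩ := exists_lift hy
    have hq' : Dist.dist ξ q < rad ξ := by
      have := dist_triangle ξ (sect (angle ξ) u) q
      rw [hξu u hu] at this
      linarith
    refine ⟨pr q, ?_, ?_⟩
    · have := dist_pr_le (sect (angle ξ) u) q
      rw [pr_sect] at this
      exact this.trans_lt hq
    · have := abs_angle_sub_lt_of_dist_lt hq'
      rw [abs_sub_comm] at this
      rw [sect_pr this]
  · intro u hu v hv huv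
    obtain ⟨m, n, hmn⟩ := mk_eq_mk_iff.1 huv
    by_cases hne : m ≠ 0 ∨ n ≠ 0
    · exfalso
      have h1 := h m n hne
      have h2 := dist_triangle ξ (sect (angle ξ) u) (deck α lam τ m n +ᵥ ξ)
      rw [hξu u hu, hmn, dist_vadd, _root_.dist_comm _ ξ, hξu v hv] at h2
      rw [Metric.mem_ball] at hu hv
      linarith
    · push Not at hne
      rw [hne.1, hne.2, deck_zero, zero_vadd] at hmn
      rw [← pr_sect (angle ξ) u, hmn, pr_sect]

theorem exists_ball_dist_mk_eq (hα : 0 < α) (hlam : 0 < lam) {ξ : HHat} (hξ : 0 < rad ξ) :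
    ∃ η > 0, ∀ u v : HHat, Dist.dist u ξ < η → Dist.dist v ξ < η →
      dist (mk u : ModelSolidTorus α lam τ) (mk v) = Dist.dist u v := by
  obtain ⟨μ, hμ, h⟩ := exists_displacement_bound (τ := τ) hα hlam hξ
  -- A nontrivial translate of `v` is at distance more than `μ - 2 * (μ / 4)` from `u`, while `u`
  -- and `v` are less than `μ / 2` apart.
  refine ⟨μ / 4, by positivity, fun u v hu hv => le_antisymm (dist_mk_le u v) ?_⟩
  refine le_dist_mk fun m n => ?_
  by_cases hne : m ≠ 0 ∨ n ≠ 0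
  · have h1 := h m n hne
    have h2 := dist_triangle4 ξ u (deck α lam τ m n +ᵥ v) (deck α lam τ m n +ᵥ ξ)
    rw [dist_vadd, _root_.dist_comm ξ u] at h2
    have h3 := dist_triangle_right u v ξ
    linarith
  · push Not at hne
    rw [hne.1, hne.2, deck_zero, zero_vadd]

/-- Suppose the displacement is less than `2 * ρ`. Since `ρ ≤ rad ξ`, the element turns by less than
`π`, so the geodesic from `ξ` to its translate lifts to the cover and avoids the axis. Every point
of it is within half its length of an endpoint, so its image is a locally geodesic loop inside the
ball. -/
theorem IsHyperbolicBall.le_displacement (hα : 0 < α) (hα' : α < 2 * Real.pi) (hlam : 0 < lam)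
    {ξ : HHat} {ρ : ℝ} (h : IsHyperbolicBall (mk ξ : ModelSolidTorus α lam τ) ρ) (m n : ℤ)
    (hmn : m ≠ 0 ∨ n ≠ 0) : 2 * ρ ≤ Dist.dist ξ (deck α lam τ m n +ᵥ ξ) := by
  have hρ := h.le_rad hα hα'
  by_contra hlt
  push Not at hlt
  set w := deck α lam τ m n
  have hd0 := _root_.dist_nonneg (x := ξ) (y := w +ᵥ ξ)
  have hrad : 0 < rad ξ := by linarith
  obtain ⟨μ, hμ, hμd⟩ := exists_displacement_bound (τ := τ) hα hlam hrad
  have hdpos : 0 < Dist.dist ξ (w +ᵥ ξ) := hμ.trans_le (hμd m n hmn)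
  have hang : |w.im| < Real.pi := by
    by_contra hge
    push Not at hge
    have h1 := cosh_dist_vadd_self w ξ
    rw [angCos_eq_neg_one hge] at h1
    have h2 : Real.cosh (Dist.dist ξ (w +ᵥ ξ)) < Real.cosh (2 * rad ξ) := by
      rw [Real.cosh_lt_cosh, abs_of_pos hdpos, abs_of_pos (by linarith)]
      linarith
    rw [h1, Real.cosh_two_mul, Real.cosh_sq (rad ξ)] at h2
    nlinarith [Real.one_le_cosh w.re, sq_nonneg (Real.sinh (rad ξ))]
  obtain ⟨p, rfl⟩ := exists_coe_of_rad_pos hrad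
  rw [← UniformSpace.Completion.coe_vadd, UniformSpace.Completion.dist_eq] at *
  have hpq : |p.θ - (w +ᵥ p).θ| < Real.pi := by
    rw [Cover.vadd_def, sub_add_cancel_left, abs_neg]; exact hang
  have hdist := Cover.dist_eq_of_abs_lt hpq
  rw [hdist] at hlt hdpos
  obtain ⟨γ, hγ, hγd⟩ := Cover.exists_lift_geodesic hpq (dist_pos.1 hdpos)
  set d := Dist.dist p.proj (w +ᵥ p).proj
  have hiso : ∀ s ∈ Icc 0 d, ∀ s' ∈ Icc 0 d,
      Dist.dist (γ s : HHat) (γ s') = |s - s'| := fun s hs s' hs' => by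
    rw [UniformSpace.Completion.dist_eq, Cover.dist_eq_of_abs_lt (hγd s hs s' hs').2]
    exact (hγd s hs s' hs').1
  have c0 : (mk (γ 0 : HHat) : ModelSolidTorus α lam τ) = mk p := by rw [hγ.left]
  have c1 : (mk (γ d : HHat) : ModelSolidTorus α lam τ) = mk p := by
    rw [hγ.right, UniformSpace.Completion.coe_vadd]; exact mk_deck_vadd m n _
  refine not_isHyperbolicBall_of_loop hdpos (c := fun t => mk (γ t)) c0 c1 ?_ ?_ h
  · intro t ht
    change dist (mk (γ t : HHat)) (mk (p : HHat)) < ρ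
    rcases le_total t (d / 2) with hh | hh
    · rw [← c0]
      refine (dist_mk_le _ _).trans_lt ?_
      rw [hiso t ht 0 ⟨le_rfl, hdpos.le⟩, sub_zero, abs_of_nonneg ht.1]
      linarith
    · rw [← c1]
      refine (dist_mk_le _ _).trans_lt ?_
      rw [hiso t ht d ⟨hdpos.le, le_rfl⟩, abs_sub_comm, abs_of_nonneg (by linarith [ht.2])]
      linarith
  · intro t ht
    obtain ⟨η, hη, hl⟩ := exists_ball_dist_mk_eq (τ := τ) hα hlam (ξ := (γ t : HHat))
      (by rw [rad_coe]; exact (γ t).r_pos)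
    refine ⟨η, hη, fun t' ht' t'' ht'' h1 h2 => ?_⟩
    rw [hl _ _ (by rwa [hiso t' ht' t ht]) (by rwa [hiso t'' ht'' t ht]), hiso t' ht' t'' ht'']

/-! ### Cone angle `2π` -/

theorem mk_eq_of_pr_eq {ξ η : HHat} (h : pr ξ = pr η) :
    (mk ξ : ModelSolidTorus (2 * Real.pi) lam τ) = mk η := by
  obtain ⟨n, rfl⟩ := exists_turns_of_pr_eq h
  exact mk_eq_mk_iff.2 ⟨0, n, by rw [deck_zero_two_pi]⟩

theorem pr_deck_zero (n : ℤ) (ξ : HHat) : pr (deck (2 * Real.pi) lam τ 0 n +ᵥ ξ) = pr ξ := by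
  rw [deck_zero_two_pi, pr_turns]

/-- Full turns bring the two angles within `π` of each other, where distances upstairs and in `H3`
agree. -/
theorem exists_dist_eq_dist_pr (ξ η : HHat) : ∃ n : ℤ,
    Dist.dist ξ (deck (2 * Real.pi) lam τ 0 n +ᵥ η) = Dist.dist (pr ξ) (pr η) := by
  rcases (rad_nonneg η).eq_or_lt with h0 | h0
  · refine ⟨0, ?_⟩
    rw [deck_zero, zero_vadd]
    symm
    apply H3.dist_eq_of_lor_eq_cosh _root_.dist_nonneg
    rw [lor_pr, HHat.cosh_dist, ← h0]; simp
  · obtain ⟨n, hn⟩ := exists_int_abs_add_mul_le Real.two_pi_pos (angle η - angle ξ)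
    refine ⟨n, ?_⟩
    rw [dist_eq_dist_pr, pr_deck_zero]
    rw [deck_zero_two_pi, angle_vadd _ h0, abs_sub_comm]
    rw [show angle η + n * (2 * Real.pi) - angle ξ = angle η - angle ξ + n * (2 * Real.pi) by ring]
    linarith

theorem dist_mk_le_dist_pr (ξ η : HHat) :
    dist (mk ξ : ModelSolidTorus (2 * Real.pi) lam τ) (mk η) ≤ Dist.dist (pr ξ) (pr η) := by
  obtain ⟨n, hn⟩ := exists_dist_eq_dist_pr (lam := lam) (τ := τ) ξ η
  rw [← hn, ← mk_deck_vadd 0 n η]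
  exact dist_mk_le _ _

theorem lam_le_dist_pr_deck (hlam : 0 < lam) {m : ℤ} (hm : m ≠ 0) (n : ℤ) (ξ : HHat) :
    lam ≤ Dist.dist (pr ξ) (pr (deck α lam τ m n +ᵥ ξ)) := by
  refine (lam_le_abs_int_mul hlam hm).trans ?_
  rw [← abs_neg, ← height_deck_sub (α := α) (τ := τ) m n ξ]
  exact abs_height_sub_le_dist_pr _ _

theorem dist_mk_eq_dist_pr (hlam : 0 < lam) {ξ η : HHat} (h : Dist.dist (pr ξ) (pr η) ≤ lam / 2) :
    dist (mk ξ : ModelSolidTorus (2 * Real.pi) lam τ) (mk η) = Dist.dist (pr ξ) (pr η) := by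
  refine le_antisymm (dist_mk_le_dist_pr ξ η) (le_dist_mk fun m n => ?_)
  refine le_trans ?_ (dist_pr_le _ _)
  by_cases hm : m = 0
  · rw [hm, pr_deck_zero]
  · have h1 := lam_le_dist_pr_deck (α := 2 * Real.pi) (τ := τ) hlam hm n η
    have h2 := dist_triangle_left (pr η) (pr (deck (2 * Real.pi) lam τ m n +ᵥ η)) (pr ξ)
    linarith

/-- For cone angle `2π` the map `mk` factors through `pr`. The jump of `sect 0` is therefore
invisible in the quotient, and the ball may meet the axis. -/
theorem isHyperbolicBall_of_displacement_pr {ξ : HHat} {ρ : ℝ}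
    (h : ∀ m n : ℤ, m ≠ 0 →
      2 * ρ ≤ Dist.dist (pr ξ) (pr (deck (2 * Real.pi) lam τ m n +ᵥ ξ))) :
    IsHyperbolicBall (mk ξ : ModelSolidTorus (2 * Real.pi) lam τ) ρ := by
  have key := isHyperbolicBall_of_map (α := 2 * Real.pi) (lam := lam) (τ := τ) (P := pr ξ) (ρ := ρ)
    (fun u => mk (sect 0 u)) ?_ ?_ ?_
  · rwa [mk_eq_of_pr_eq (pr_sect 0 (pr ξ))] at key
  · intro u _ v _
    have := dist_mk_le_dist_pr (lam := lam) (τ := τ) (sect 0 u) (sect 0 v)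
    rwa [pr_sect, pr_sect] at this
  · intro u _ η _ y hy
    obtain ⟨q, rfl, hq⟩ := exists_lift hy
    refine ⟨pr q, ?_, mk_eq_of_pr_eq (pr_sect 0 (pr q))⟩
    have := dist_pr_le (sect 0 u) q
    rw [pr_sect] at this
    exact this.trans_lt hq
  · intro u hu v hv huv
    obtain ⟨m, n, hmn⟩ := mk_eq_mk_iff.1 huv
    have hu' := congrArg pr hmn
    rw [pr_sect] at hu'
    by_cases hm : m = 0
    · rw [hm, pr_deck_zero, pr_sect] at hu'
      exact hu'
    · exfalso
      have h1 := h m n hm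
      have h2 := dist_triangle_left (pr ξ) (pr (deck (2 * Real.pi) lam τ m n +ᵥ ξ)) u
      rw [Metric.mem_ball] at hu hv
      have h3 : Dist.dist u (pr (deck (2 * Real.pi) lam τ m n +ᵥ ξ)) = Dist.dist v (pr ξ) := by
        rw [hu', dist_pr_vadd, pr_sect]
      linarith

theorem IsHyperbolicBall.le_displacement_pr (hlam : 0 < lam) {ξ : HHat} {ρ : ℝ}
    (h : IsHyperbolicBall (mk ξ : ModelSolidTorus (2 * Real.pi) lam τ) ρ) (m n : ℤ) (hm : m ≠ 0) :
    2 * ρ ≤ Dist.dist (pr ξ) (pr (deck (2 * Real.pi) lam τ m n +ᵥ ξ)) := by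
  by_contra hlt
  push Not at hlt
  have hdpos := hlam.trans_le (lam_le_dist_pr_deck (α := 2 * Real.pi) (τ := τ) hlam hm n ξ)
  obtain ⟨G, A, B, -, -, G0, G1, -, Gd⟩ := H3.exists_geodesic (dist_pos.1 hdpos)
  set d := Dist.dist (pr ξ) (pr (deck (2 * Real.pi) lam τ m n +ᵥ ξ))
  have c0 : (mk (sect 0 (G 0)) : ModelSolidTorus (2 * Real.pi) lam τ) = mk ξ :=
    mk_eq_of_pr_eq (by rw [pr_sect, G0])
  have c1 : (mk (sect 0 (G d)) : ModelSolidTorus (2 * Real.pi) lam τ) = mk ξ := by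
    rw [← mk_deck_vadd m n ξ]
    exact mk_eq_of_pr_eq (by rw [pr_sect, G1])
  have hle : ∀ t ∈ Icc 0 d, ∀ t' ∈ Icc 0 d, dist (mk (sect 0 (G t)) :
      ModelSolidTorus (2 * Real.pi) lam τ) (mk (sect 0 (G t'))) ≤ |t - t'| := by
    intro t ht t' ht'
    have := dist_mk_le_dist_pr (lam := lam) (τ := τ) (sect 0 (G t)) (sect 0 (G t'))
    rwa [pr_sect, pr_sect, Gd t ht t' ht'] at this
  refine not_isHyperbolicBall_of_loop hdpos (c := fun t => mk (sect 0 (G t))) c0 c1 ?_ ?_ h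
  · intro t ht
    change dist (mk (sect 0 (G t))) (mk ξ) < ρ
    rcases le_total t (d / 2) with hh | hh
    · rw [← c0]
      refine (hle t ht 0 ⟨le_rfl, hdpos.le⟩).trans_lt ?_
      rw [sub_zero, abs_of_nonneg ht.1]
      linarith
    · rw [← c1]
      refine (hle t ht d ⟨hdpos.le, le_rfl⟩).trans_lt ?_
      rw [abs_sub_comm, abs_of_nonneg (by linarith [ht.2])]
      linarith
  · intro t ht
    -- Parameters within `lam / 4` of `t` give points at most `lam / 2` apart, the range in which
    -- `dist_mk_eq_dist_pr` holds.
    refine ⟨lam / 4, by positivity, fun t' ht' t'' ht'' h1 h2 => ?_⟩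
    have hG := Gd t' ht' t'' ht''
    have h3 : |t' - t''| ≤ lam / 2 := by
      rw [abs_lt] at h1 h2
      rw [abs_le]
      constructor <;> linarith
    change dist (mk (sect 0 (G t'))) (mk (sect 0 (G t''))) = _
    rw [dist_mk_eq_dist_pr hlam (by rw [pr_sect, pr_sect, hG]; exact h3), pr_sect, pr_sect, hG]

/-! ### Both cases -/

/-- The elements of the deck group that act nontrivially on the smooth part of the developing
space: all nontrivial elements, or the loxodromic ones if the cone angle is `2π`. -/
def Essential (α : ℝ) (m n : ℤ) : Prop := m ≠ 0 ∨ (α < 2 * Real.pi ∧ n ≠ 0)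

theorem isHyperbolicBall_mk_iff (hα : 0 < α) (hα' : α ≤ 2 * Real.pi) (hlam : 0 < lam) (ξ : HHat)
    (ρ : ℝ) : IsHyperbolicBall (mk ξ : ModelSolidTorus α lam τ) ρ ↔
      ∀ m n, Essential α m n → 2 * ρ ≤ Dist.dist ξ (deck α lam τ m n +ᵥ ξ) := by
  rcases hα'.eq_or_lt with rfl | hlt
  · constructor
    · intro h m n hmn
      have hm : m ≠ 0 := by simpa [Essential] using hmn
      exact (h.le_displacement_pr hlam m n hm).trans (dist_pr_le _ _)
    · intro h
      refine isHyperbolicBall_of_displacement_pr fun m n hm => ?_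
      -- The distance in `H3` is attained upstairs after extra full turns, which keep the same
      -- nonzero `m`.
      obtain ⟨k, hk⟩ := exists_dist_eq_dist_pr (lam := lam) (τ := τ) ξ
        (deck (2 * Real.pi) lam τ m n +ᵥ ξ)
      rw [← hk, vadd_vadd, ← deck_add, zero_add]
      exact h m _ (Or.inl hm)
  · have he : ∀ m n, Essential α m n ↔ (m ≠ 0 ∨ n ≠ 0) := by simp [Essential, hlt]
    simp only [he]
    constructor
    · exact fun h m n hmn => h.le_displacement hα hlt hlam m n hmn
    · intro h
      -- The generating rotation moves `ξ` by at most `2 * rad ξ`, so the displacement condition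
      -- already contains `ρ ≤ rad ξ`.
      have h1 := (h 0 1 (Or.inr one_ne_zero)).trans (dist_rotate_le 1 ξ)
      exact isHyperbolicBall_of_displacement (by linarith) h

end ModelSolidTorus

/-! ### The thin part and the tube radius through displacement coefficients. -/

namespace ModelSolidTorus

variable {α lam τ : ℝ}

/-- The pairs `(c, B)` for which `1 + c + B sinh² R` is the hyperbolic cosine of the displacement at
distance `R` from the axis of some essential element of the deck group. -/
def coeffs (α lam τ : ℝ) : Set (ℝ × ℝ) :=
  {x | ∃ m n : ℤ, Essential α m n ∧ x.1 = Real.cosh (m * lam) - 1 ∧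
    x.2 = Real.cosh (m * lam) - angCos (n * α + m * τ)}

theorem mem_coeffs (lam τ : ℝ) {m n : ℤ} (h : Essential α m n) :
    (Real.cosh (m * lam) - 1, Real.cosh (m * lam) - angCos (n * α + m * τ)) ∈ coeffs α lam τ :=
  ⟨m, n, h, rfl, rfl⟩

theorem coeffs_fst_le_snd {x : ℝ × ℝ} (hx : x ∈ coeffs α lam τ) : x.1 ≤ x.2 := by
  obtain ⟨m, n, -, h1, h2⟩ := hx
  rw [h1, h2]; linarith [angCos_le_one (n * α + m * τ)]

theorem coeffs_snd_pos (hα : 0 < α) (hlam : 0 < lam) {x : ℝ × ℝ} (hx : x ∈ coeffs α lam τ) :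
    0 < x.2 := by
  obtain ⟨m, n, hmn, -, h2⟩ := hx
  rw [h2]
  by_cases hm : m = 0
  · subst hm
    have hn : n ≠ 0 := by
      rcases hmn with h | h
      · exact absurd rfl h
      · exact h.2
    have hne : (n : ℝ) * α + (0 : ℤ) * τ ≠ 0 := by
      simp [hn, hα.ne']
    linarith [angCos_lt_one hne, Real.one_le_cosh ((0 : ℤ) * lam)]
  · have : (m : ℝ) * lam ≠ 0 := mul_ne_zero (by exact_mod_cast hm) hlam.ne'
    linarith [Real.one_lt_cosh.2 this, angCos_le_one (n * α + m * τ)]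

theorem one_zero_mem_coeffs (α lam τ : ℝ) (n : ℤ) :
    (Real.cosh lam - 1, Real.cosh lam - angCos (n * α + τ)) ∈ coeffs α lam τ :=
  ⟨1, n, Or.inl one_ne_zero, by simp, by simp⟩

/-- A bound on `c` bounds `m`. Infinitely many `n` remain, but all those with angle at least `π` in
absolute value share `angCos = -1`, so only finitely many pairs occur; this is why pairs are counted
rather than deck elements. -/
theorem finite_coeffs (hα : 0 < α) (hlam : 0 < lam) (K : ℝ) :
    {x ∈ coeffs α lam τ | x.1 ≤ K}.Finite := by
  obtain ⟨M, hM⟩ := exists_nat_gt ((K + 1) / lam)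
  obtain ⟨N, hN⟩ := exists_nat_gt ((Real.pi + M * |τ|) / α)
  rw [div_lt_iff₀ hlam] at hM
  rw [div_lt_iff₀ hα] at hN
  have hfin : (((fun p : ℤ × ℤ => (Real.cosh (p.1 * lam) - 1,
      Real.cosh (p.1 * lam) - angCos (p.2 * α + p.1 * τ))) ''
        (Icc (-(M : ℤ)) M ×ˢ Icc (-(N : ℤ)) N)) ∪
      ((fun m : ℤ => (Real.cosh (m * lam) - 1, Real.cosh (m * lam) - (-1))) ''
        Icc (-(M : ℤ)) M)).Finite :=
    (((finite_Icc _ _).prod (finite_Icc _ _)).image _).union ((finite_Icc _ _).image _)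
  refine hfin.subset ?_
  rintro ⟨c, B⟩ ⟨⟨m, n, -, h1, h2⟩, hK⟩
  simp only at h1 h2 hK
  have hm : |(m : ℝ)| ≤ M := by
    have h3 : |m * lam| ≤ Real.sinh |m * lam| := Real.self_le_sinh_iff.2 (abs_nonneg _)
    have h4 := Real.sinh_lt_cosh |m * lam|
    rw [Real.cosh_abs] at h4
    rw [abs_mul, abs_of_pos hlam] at h3 h4
    by_contra hlt
    push Not at hlt
    nlinarith
  have hm' : m ∈ Icc (-(M : ℤ)) M := by
    rw [← Int.cast_abs] at hm
    exact abs_le.1 (by exact_mod_cast hm)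
  rcases le_or_gt Real.pi |n * α + m * τ| with hge | hlt
  · right
    refine ⟨m, hm', ?_⟩
    rw [h1, h2, angCos_eq_neg_one hge]
  · left
    refine ⟨(m, n), ⟨hm', ?_⟩, by rw [h1, h2]⟩
    have h3 : |(n : ℝ)| * α < N * α := by
      have e : (n : ℝ) * α = (n * α + m * τ) - m * τ := by ring
      have h4 : |(n : ℝ) * α| ≤ |n * α + m * τ| + |m * τ| := by
        conv_lhs => rw [e]
        exact abs_sub _ _
      rw [abs_mul, abs_of_pos hα, abs_mul (m : ℝ)] at h4
      have h5 := mul_le_mul_of_nonneg_right hm (abs_nonneg τ)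
      linarith
    have h4 := (lt_of_mul_lt_mul_right h3 hα.le).le
    rw [← Int.cast_abs] at h4
    exact abs_le.1 (by exact_mod_cast h4)

/-- A pair whose first entry exceeds the value of a reference pair cannot compete, since `u * B ≥
0`; finitely many pairs remain. -/
theorem exists_minimal_coeffs (hα : 0 < α) (hlam : 0 < lam) {u : ℝ} (hu : 0 ≤ u) :
    ∃ x ∈ coeffs α lam τ, ∀ y ∈ coeffs α lam τ, x.1 + u * x.2 ≤ y.1 + u * y.2 := by
  have h0 := one_zero_mem_coeffs α lam τ 0
  set x₀ : ℝ × ℝ := (Real.cosh lam - 1, Real.cosh lam - angCos ((0 : ℤ) * α + τ))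
  have hmul : ∀ y ∈ coeffs α lam τ, 0 ≤ u * y.2 := fun y hy =>
    mul_nonneg hu (coeffs_snd_pos hα hlam hy).le
  obtain ⟨x, ⟨hx, -⟩, hmin⟩ := exists_min_image _ (fun y : ℝ × ℝ => y.1 + u * y.2)
    (finite_coeffs (τ := τ) hα hlam (x₀.1 + u * x₀.2)) ⟨x₀, h0, by linarith [hmul x₀ h0]⟩
  refine ⟨x, hx, fun y hy => ?_⟩
  rcases le_or_gt y.1 (x₀.1 + u * x₀.2) with h | h
  · exact hmin y ⟨hy, h⟩
  · have := hmin x₀ ⟨h0, by linarith [hmul x₀ h0]⟩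
    linarith [hmul y hy]

theorem cosh_displacement (m n : ℤ) (ξ : HHat) :
    Real.cosh (Dist.dist ξ (deck α lam τ m n +ᵥ ξ)) = 1 + ((Real.cosh (m * lam) - 1) +
      Real.sinh (rad ξ) ^ 2 * (Real.cosh (m * lam) - angCos (n * α + m * τ))) := by
  rw [cosh_dist_vadd_self]
  simp only [deck]
  ring

/-- The least essential displacement `d` is attained, so the radii of hyperbolic balls fill `Icc 0
(d / 2)` and the injectivity radius is `d / 2`. -/
theorem mk_mem_thinPart_iff (hα : 0 < α) (hα' : α ≤ 2 * Real.pi) (hlam : 0 < lam) {ε : ℝ}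
    (hε : 0 < ε) (ξ : HHat) : (mk ξ : ModelSolidTorus α lam τ) ∈ thinPart α lam τ ε ↔
      ∃ x ∈ coeffs α lam τ, x.1 + Real.sinh (rad ξ) ^ 2 * x.2 ≤ Real.cosh ε - 1 := by
  obtain ⟨x, hx, hmin⟩ := exists_minimal_coeffs (τ := τ) hα hlam (sq_nonneg (Real.sinh (rad ξ)))
  obtain ⟨m, n, hmn, h1, h2⟩ := hx
  have hd := cosh_displacement (α := α) (lam := lam) (τ := τ) m n ξ
  rw [← h1, ← h2] at hd
  have hd0 := _root_.dist_nonneg (x := ξ) (y := deck α lam τ m n +ᵥ ξ)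
  set d := Dist.dist ξ (deck α lam τ m n +ᵥ ξ)
  have hset : {ρ | 0 ≤ ρ ∧ IsHyperbolicBall (mk ξ : ModelSolidTorus α lam τ) ρ} = Icc 0 (d / 2) := by
    ext ρ
    simp only [mem_ofPred_eq, isHyperbolicBall_mk_iff hα hα' hlam, mem_Icc]
    refine and_congr_right fun hρ => ⟨fun h => by linarith [h m n hmn], fun h m' n' hmn' => ?_⟩
    have h3 := hmin _ (mem_coeffs lam τ hmn')
    have h4 : d ≤ Dist.dist ξ (deck α lam τ m' n' +ᵥ ξ) := by
      rw [← abs_of_nonneg hd0, ← abs_of_nonneg (_root_.dist_nonneg (x := ξ)), ← Real.cosh_le_cosh,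
        hd, cosh_displacement]
      simp only at h3
      linarith
    linarith
  have hinj : injrad (mk ξ : ModelSolidTorus α lam τ) = d / 2 := by
    rw [injrad, hset, csSup_Icc (by linarith)]
  have hle : (mk ξ : ModelSolidTorus α lam τ) ∈ thinPart α lam τ ε ↔ d ≤ ε := by
    change injrad _ ≤ ε / 2 ↔ _
    rw [hinj]
    constructor <;> intro h <;> linarith
  rw [hle, ← abs_of_nonneg hd0, ← abs_of_pos hε, ← Real.cosh_le_cosh, hd, abs_of_pos hε]
  constructor
  · intro h
    exact ⟨x, ⟨m, n, hmn, h1, h2⟩, by linarith⟩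
  · rintro ⟨y, hy, h⟩
    linarith [hmin y hy]

/-- The level at which the minimal displacement takes a given value. -/
theorem exists_level (hα : 0 < α) (hlam : 0 < lam) {E : ℝ}
    (hE : ∃ x ∈ coeffs α lam τ, x.1 ≤ E) :
    ∃ U, 0 ≤ U ∧ (∀ y ∈ coeffs α lam τ, E ≤ y.1 + U * y.2) ∧
      ∃ x ∈ coeffs α lam τ, x.1 + U * x.2 = E := by
  obtain ⟨x₀, h0, h0E⟩ := hE
  -- The level is the largest root `u` of the equations `c + u * B = E`; pairs with `c > E` exceed
  -- `E` at every nonnegative level.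
  obtain ⟨x, ⟨hx, hxE⟩, hmax⟩ := exists_max_image _ (fun y : ℝ × ℝ => (E - y.1) / y.2)
    (finite_coeffs (τ := τ) hα hlam E) ⟨x₀, h0, h0E⟩
  have hxp := coeffs_snd_pos hα hlam hx
  have hU : 0 ≤ (E - x.1) / x.2 := div_nonneg (by linarith) hxp.le
  refine ⟨(E - x.1) / x.2, hU, fun y hy => ?_, x, hx, ?_⟩
  · have hyp := coeffs_snd_pos hα hlam hy
    rcases le_or_gt y.1 E with h | h
    · have := hmax y ⟨hy, h⟩
      rw [div_le_iff₀ hyp] at this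
      linarith
    · linarith [mul_nonneg hU hyp.le]
  · field_simp; ring

/-- A point of radius `r` can be pushed radially outwards. The case `r = 0`, in which the frontier
is the axis itself, is the one that occurs when the bound is sharp. -/
theorem frontier_rad_le {r : ℝ} (hr : 0 ≤ r) : frontier {ξ : HHat | rad ξ ≤ r} = {ξ | rad ξ = r} := by
  refine Subset.antisymm (frontier_le_subset_eq continuous_rad continuous_const) fun ξ hξ => ?_
  rw [mem_ofPred_eq] at hξ
  rw [frontier_eq_closure_inter_closure]
  refine ⟨subset_closure hξ.le, ?_⟩
  rw [Metric.mem_closure_iff]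
  intro η hη
  have hr' : 0 < r + η / 2 := by linarith
  have h1 := rad_ofCoords hr'.le (height ξ) (angle ξ)
  refine ⟨ofCoords (r + η / 2) (height ξ) (angle ξ), ?_, ?_⟩
  · rw [mem_compl_iff, mem_ofPred_eq, h1]; linarith
  · have h2 := HHat.cosh_dist ξ (ofCoords (r + η / 2) (height ξ) (angle ξ))
    rw [h1, height_ofCoords, angle_ofCoords hr', sub_self, sub_self, Real.cosh_zero, angCos_zero,
      mul_one, mul_one, ← Real.cosh_sub, hξ, show r - (r + η / 2) = -(η / 2) by ring,
      Real.cosh_neg] at h2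
    have h3 : Dist.dist ξ (ofCoords (r + η / 2) (height ξ) (angle ξ)) = η / 2 :=
      Real.cosh_injOn _root_.dist_nonneg (by positivity : 0 ≤ η / 2) h2
    linarith

/-- The quotient map is open and continuous, so the frontier can be computed upstairs, where it is a
nonempty level set of `rad`. -/
theorem tubeRadius_eq {ε r : ℝ} (hr : 0 ≤ r)
    (h : ∀ ξ : HHat, (mk ξ : ModelSolidTorus α lam τ) ∈ thinPart α lam τ ε ↔ rad ξ ≤ r) :
    tubeRadius α lam τ ε = r := by
  have hpre : (mk : HHat → ModelSolidTorus α lam τ) ⁻¹' frontier (thinPart α lam τ ε) =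
      {ξ | rad ξ = r} := by
    rw [isOpenMap_mk.preimage_frontier_eq_frontier_preimage continuous_mk, ← frontier_rad_le hr]
    congr 1
    ext ξ
    exact h ξ
  have himg : radius '' frontier (thinPart α lam τ ε) = {r} := by
    ext s
    rw [mem_singleton_iff]
    constructor
    · rintro ⟨x, hx, rfl⟩
      obtain ⟨ξ, rfl⟩ := mk_surjective x
      rw [radius_mk]
      exact (hpre ▸ hx : ξ ∈ {ξ | rad ξ = r})
    · rintro rfl
      obtain ⟨ξ, h1, -⟩ := exists_coords hr 0 0
      have : ξ ∈ (mk : HHat → ModelSolidTorus α lam τ) ⁻¹' frontier (thinPart α lam τ ε) := by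
        rw [hpre]; exact h1
      exact ⟨mk ξ, this, by rw [radius_mk, h1]⟩
  rw [tubeRadius, himg, csSup_singleton]

/-- All that the comparison needs to know about the tube radius: at its level no displacement
function lies below `cosh ε - 1`, and one of them equals it. -/
theorem tubeRadius_spec (hα : 0 < α) (hα' : α ≤ 2 * Real.pi) (hlam : 0 < lam) {ε : ℝ} (hε : 0 < ε)
    (hE : ∃ x ∈ coeffs α lam τ, x.1 ≤ Real.cosh ε - 1) :
    0 ≤ tubeRadius α lam τ ε ∧
      (∀ y ∈ coeffs α lam τ,
        Real.cosh ε - 1 ≤ y.1 + Real.sinh (tubeRadius α lam τ ε) ^ 2 * y.2) ∧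
      ∃ x ∈ coeffs α lam τ,
        x.1 + Real.sinh (tubeRadius α lam τ ε) ^ 2 * x.2 = Real.cosh ε - 1 := by
  obtain ⟨U, hU, h1, x, hx, h2⟩ := exists_level hα hlam hE
  have hr : 0 ≤ Real.arsinh (Real.sqrt U) := Real.arsinh_nonneg_iff.2 (Real.sqrt_nonneg U)
  have hs : Real.sinh (Real.arsinh (Real.sqrt U)) ^ 2 = U := by
    rw [Real.sinh_arsinh, Real.sq_sqrt hU]
  have heq : tubeRadius α lam τ ε = Real.arsinh (Real.sqrt U) := by
    refine tubeRadius_eq hr fun ξ => ?_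
    have hle : rad ξ ≤ Real.arsinh (Real.sqrt U) ↔ Real.sinh (rad ξ) ^ 2 ≤ U := by
      rw [← Real.sinh_le_sinh, Real.sinh_arsinh, Real.le_sqrt (sinh_rad_nonneg ξ) hU]
    rw [mk_mem_thinPart_iff hα hα' hlam hε, hle]
    constructor
    · rintro ⟨y, hy, h⟩
      have hyp := coeffs_snd_pos hα hlam hy
      exact le_of_mul_le_mul_right (by linarith [h1 y hy]) hyp
    · intro h
      have := mul_le_mul_of_nonneg_right h (coeffs_snd_pos hα hlam hx).le
      exact ⟨x, hx, by linarith⟩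
  rw [heq, hs]
  exact ⟨hr, h1, x, hx, h2⟩

end ModelSolidTorus

/-! ### Comparison of two tube radii and the equality case. -/

/-- The comparison of tube radii, for one displacement function `c + B sinh² r`. -/
theorem cosh_sub_sq_mul_le {c B E r s : ℝ} (hcB : c ≤ B) (hB : 0 < B) (hr : 0 ≤ r)
    (hrs : r ≤ s) (hE : E ≤ c + Real.sinh r ^ 2 * B) :
    Real.cosh (s - r) ^ 2 * E ≤ c + Real.sinh s ^ 2 * B ∧
      (Real.cosh (s - r) ^ 2 * E = c + Real.sinh s ^ 2 * B → r < s → r = 0 ∧ B = c ∧ E = c) := by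
  set d := s - r with hd
  have hd0 : 0 ≤ d := sub_nonneg.2 hrs
  have hsum : Real.cosh s = Real.cosh d * Real.cosh r + Real.sinh d * Real.sinh r := by
    rw [← Real.cosh_add, hd, sub_add_cancel]
  have hcd := Real.one_le_cosh d
  have hcr := Real.one_le_cosh r
  have hsd : 0 ≤ Real.sinh d := Real.sinh_nonneg_iff.2 hd0
  have hsr : 0 ≤ Real.sinh r := Real.sinh_nonneg_iff.2 hr
  have es := Real.cosh_sq s
  have er := Real.cosh_sq r
  have ed := Real.cosh_sq d
  obtain ⟨X, hX⟩ : ∃ X, X = Real.cosh s ^ 2 - (Real.cosh d * Real.cosh r) ^ 2 := ⟨_, rfl⟩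
  have hX0 : X = Real.sinh d * Real.sinh r * (2 * Real.cosh d * Real.cosh r +
      Real.sinh d * Real.sinh r) := by rw [hX, hsum]; ring
  have hX1 : 0 ≤ X := by rw [hX0]; positivity
  -- Three nonnegative terms; `X ≥ 0` by the addition formula for `cosh s`. If their sum is zero and
  -- `d > 0`, they force in turn `r = 0`, `B = c` and `E = c`.
  have hid : c + Real.sinh s ^ 2 * B - Real.cosh d ^ 2 * E =
      B * X + (B - c) * Real.sinh d ^ 2 + Real.cosh d ^ 2 * (c + Real.sinh r ^ 2 * B - E) := by
    rw [hX]
    linear_combination B * (-es + Real.cosh d ^ 2 * er) + (B - c) * ed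
  have t1 : 0 ≤ B * X := mul_nonneg hB.le hX1
  have t2 : 0 ≤ (B - c) * Real.sinh d ^ 2 := mul_nonneg (sub_nonneg.2 hcB) (sq_nonneg _)
  have t3 : 0 ≤ Real.cosh d ^ 2 * (c + Real.sinh r ^ 2 * B - E) :=
    mul_nonneg (sq_nonneg _) (sub_nonneg.2 hE)
  refine ⟨by linarith, fun heq hlt => ?_⟩
  have hsd' : 0 < Real.sinh d := Real.sinh_pos_iff.2 (sub_pos.2 hlt)
  have z1 : B * X = 0 := by linarith
  have z2 : (B - c) * Real.sinh d ^ 2 = 0 := by linarith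
  have z3 : Real.cosh d ^ 2 * (c + Real.sinh r ^ 2 * B - E) = 0 := by linarith
  have hr0 : Real.sinh r = 0 := by
    have hX2 : X = 0 := (mul_eq_zero.1 z1).resolve_left hB.ne'
    rw [hX0] at hX2
    rcases mul_eq_zero.1 hX2 with h | h
    · exact (mul_eq_zero.1 h).resolve_left hsd'.ne'
    · have : 0 < Real.cosh d * Real.cosh r := by positivity
      linarith [mul_nonneg hsd hsr]
  have hBc : B - c = 0 := (mul_eq_zero.1 z2).resolve_right (pow_pos hsd' 2).ne'
  have hEc := (mul_eq_zero.1 z3).resolve_left (pow_pos (Real.cosh_pos d) 2).ne'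
  rw [hr0] at hEc
  exact ⟨Real.sinh_eq_zero.1 hr0, by linarith, by linarith⟩

open ModelSolidTorus

theorem cosh_tubeDist_sq_mul_le {δ ε α lam τ : ℝ} (hδ : 0 < δ) (hδε : δ < ε) (hα : 0 < α)
    (hα' : α ≤ 2 * Real.pi) (hlam : 0 < lam) (hthin : (thinPart α lam τ δ).Nonempty) :
    0 ≤ tubeDist α lam τ δ ε ∧
    Real.cosh (tubeDist α lam τ δ ε) ^ 2 * (Real.cosh δ - 1) ≤ Real.cosh ε - 1 ∧
      (Real.cosh (tubeDist α lam τ δ ε) ^ 2 * (Real.cosh δ - 1) = Real.cosh ε - 1 ↔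
        α = 2 * Real.pi ∧ lam = δ ∧ ∃ k : ℤ, τ = 2 * Real.pi * k) := by
  have hε : 0 < ε := hδ.trans hδε
  have hEδ : 0 < Real.cosh δ - 1 := sub_pos.2 (Real.one_lt_cosh.2 hδ.ne')
  have hEE : Real.cosh δ - 1 < Real.cosh ε - 1 := by
    have : Real.cosh δ < Real.cosh ε := by
      rw [Real.cosh_lt_cosh, abs_of_pos hδ, abs_of_pos hε]; exact hδε
    linarith
  have hex : ∃ x ∈ coeffs α lam τ, x.1 ≤ Real.cosh δ - 1 := by
    obtain ⟨y, hy⟩ := hthin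
    obtain ⟨ξ, rfl⟩ := mk_surjective y
    obtain ⟨x, hx, h⟩ := (mk_mem_thinPart_iff hα hα' hlam hδ ξ).1 hy
    have := mul_nonneg (sq_nonneg (Real.sinh (rad ξ))) (coeffs_snd_pos hα hlam hx).le
    exact ⟨x, hx, by linarith⟩
  obtain ⟨hr, hlr, x, hx, hxr⟩ := tubeRadius_spec hα hα' hlam hδ hex
  obtain ⟨hs, hls, y, hy, hys⟩ := tubeRadius_spec hα hα' hlam hε
    (hex.imp fun x hx => ⟨hx.1, hx.2.trans hEE.le⟩)
  unfold tubeDist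
  set r := tubeRadius α lam τ δ
  set s := tubeRadius α lam τ ε
  have hrs : r < s := by
    have h1 := hls x hx
    have hxp := coeffs_snd_pos hα hlam hx
    have h2 : Real.sinh r ^ 2 < Real.sinh s ^ 2 := lt_of_mul_lt_mul_right (by linarith) hxp.le
    exact Real.sinh_lt_sinh.1 (lt_of_pow_lt_pow_left₀ 2 (Real.sinh_nonneg_iff.2 hs) h2)
  -- The pair `y` attains the envelope at the outer radius `s`; at the inner radius `r` it is only
  -- known to lie above the envelope.
  obtain ⟨hle, heq⟩ := cosh_sub_sq_mul_le (coeffs_fst_le_snd hy) (coeffs_snd_pos hα hlam hy) hr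
    hrs.le (hlr y hy)
  rw [hys] at hle heq
  refine ⟨sub_nonneg.2 hrs.le, hle, fun h => ?_, ?_⟩
  · obtain ⟨hr0, hB, hE⟩ := heq h hrs
    rw [hr0, Real.sinh_zero] at hlr
    obtain ⟨m, n, hmn, h1, h2⟩ := hy
    have hcosh : Real.cosh (m * lam) = Real.cosh δ := by linarith
    have habs : |m * lam| = δ := by
      refine Real.cosh_injOn (mem_Ici.2 (abs_nonneg _)) hδ.le ?_
      rw [Real.cosh_abs, hcosh]
    have hm : m ≠ 0 := by
      rintro rfl
      simp only [Int.cast_zero, zero_mul, abs_zero] at habs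
      exact hδ.ne habs
    have hδlam : δ ≤ lam := by
      have h3 := hlr _ (one_zero_mem_coeffs α lam τ 0)
      simp only at h3
      have h4 : Real.cosh δ ≤ Real.cosh lam := by linarith
      rwa [Real.cosh_le_cosh, abs_of_pos hδ, abs_of_pos hlam] at h4
    have hlamδ : lam = δ := le_antisymm (habs ▸ lam_le_abs_int_mul hlam hm) hδlam
    have hm1 : |m| = 1 := by
      rw [abs_mul, abs_of_pos hlam, hlamδ] at habs
      have : |(m : ℝ)| = 1 := mul_right_cancel₀ hδ.ne' (by rw [habs, one_mul])
      rw [← Int.cast_abs] at this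
      exact_mod_cast this
    have hα2 : α = 2 * Real.pi := by
      refine hα'.eq_or_lt.resolve_right fun hlt => ?_
      -- If `α < 2π`, the generating rotation is essential and fixes the core, which would give
      -- `cosh δ - 1 ≤ 0` at level `0`.
      have h3 := hlr _ (mem_coeffs lam τ (Or.inr ⟨hlt, one_ne_zero⟩ : Essential α 0 1))
      simp only [Int.cast_zero, zero_mul, Real.cosh_zero] at h3
      linarith
    have hang : (n : ℝ) * α + m * τ = 0 := by
      by_contra hne
      linarith [angCos_lt_one hne]
    refine ⟨hα2, hlamδ, ?_⟩
    rw [hα2] at hang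
    rcases (abs_eq (by norm_num)).1 hm1 with rfl | rfl
    · refine ⟨-n, ?_⟩
      push_cast at hang ⊢
      linarith
    · refine ⟨n, ?_⟩
      push_cast at hang ⊢
      linarith
  · rintro ⟨rfl, rfl, k, rfl⟩
    refine le_antisymm hle ?_
    -- With `α = 2π` every essential element has `m ≠ 0`, so its first coefficient is already at
    -- least `cosh lam - 1`. The inner tube thus degenerates to the core.
    have hr0 : Real.sinh r ^ 2 = 0 := by
      obtain ⟨m, n, hmn, h1, h2⟩ := id hx
      have hm : m ≠ 0 := by simpa [Essential] using hmn
      have h3 : Real.cosh lam ≤ Real.cosh (m * lam) := by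
        rw [Real.cosh_le_cosh, abs_of_pos hδ]
        exact lam_le_abs_int_mul hδ hm
      have h4 := coeffs_snd_pos hα hlam hx
      have h5 := mul_nonneg (sq_nonneg (Real.sinh r)) h4.le
      have h6 : Real.sinh r ^ 2 * x.2 = 0 := by linarith
      exact (mul_eq_zero.1 h6).resolve_right h4.ne'
    have hr1 : r = 0 := Real.sinh_eq_zero.1 ((pow_eq_zero_iff two_ne_zero).1 hr0)
    -- The exponent `-k` cancels the twist `2πk`, leaving a pure translation with `B = c`, whose
    -- value at level `sinh² s` is `cosh² s * (cosh lam - 1)`.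
    have h3 := hls _ (one_zero_mem_coeffs _ lam (2 * Real.pi * k) (-k))
    have hz : ((-k : ℤ) : ℝ) * (2 * Real.pi) + 2 * Real.pi * k = 0 := by push_cast; ring
    simp only [hz, angCos_zero] at h3
    rw [hr1, sub_zero, Real.cosh_sq]
    linarith

end HypTube

end

theorem proposition5p4 (δ ε α lam τ : ℝ) (hδ : 0 < δ) (hδε : δ < ε) (hα : 0 < α)
    (hα' : α ≤ 2 * Real.pi) (hlam : 0 < lam)
    (hthin : (HypTube.thinPart α lam τ δ).Nonempty) :
    HypTube.tubeDist α lam τ δ ε ≤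
        Real.arcosh (Real.sqrt ((Real.cosh ε - 1) / (Real.cosh δ - 1))) ∧
      (HypTube.tubeDist α lam τ δ ε =
          Real.arcosh (Real.sqrt ((Real.cosh ε - 1) / (Real.cosh δ - 1))) ↔
        α = 2 * Real.pi ∧ lam = δ ∧ ∃ k : ℤ, τ = 2 * Real.pi * k) := by
  obtain ⟨h0, hle, hiff⟩ := HypTube.cosh_tubeDist_sq_mul_le hδ hδε hα hα' hlam hthin
  have hEδ : 0 < Real.cosh δ - 1 := sub_pos.2 (Real.one_lt_cosh.2 hδ.ne')
  have hEE : Real.cosh δ - 1 ≤ Real.cosh ε - 1 := by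
    have : Real.cosh δ ≤ Real.cosh ε := by
      rw [Real.cosh_le_cosh, abs_of_pos hδ, abs_of_pos (hδ.trans hδε)]; exact hδε.le
    linarith
  set d := HypTube.tubeDist α lam τ δ ε
  set q := (Real.cosh ε - 1) / (Real.cosh δ - 1) with hq
  have hq1 : 1 ≤ q := (one_le_div hEδ).2 hEE
  have hqs : 1 ≤ Real.sqrt q := Real.one_le_sqrt.2 hq1
  have hc := Real.cosh_pos d
  rw [← hiff, ← eq_div_iff hEδ.ne', ← hq]
  rw [← le_div_iff₀ hEδ, ← hq] at hle
  constructor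
  · rw [← abs_of_nonneg h0, ← abs_of_nonneg (Real.arcosh_nonneg hqs), ← Real.cosh_le_cosh,
      Real.cosh_arcosh hqs]
    exact Real.le_sqrt_of_sq_le hle
  · constructor
    · intro h
      rw [h, Real.cosh_arcosh hqs, Real.sq_sqrt (by linarith)]
    · intro h
      rw [← h, Real.sqrt_sq hc.le, Real.arcosh_cosh h0]
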